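/- Let $(M^{2m},\omega)$, $m\ge 1$, be a closed (compact, without boundary) symplectic manifold with an arbitrary smooth Riemannian metric $(\cdot,\cdot)$, not necessarily compatible with $\omega$. For a smooth function $f$ let $\mathrm{sgrad}\,f$ be its Hamiltonian field, $i_{\mathrm{sgrad} f}\,\omega=df$, and let $\{f,h\}=\omega(\mathrm{sgrad}\,f,\mathrm{sgrad}\,h)$. For a smooth function $\psi$ put $v=\mathrm{sgrad}\,\psi$ and let the Laplacian $\Delta\psi$ be the symplectic vorticity function $\nu$ of $v$, i.e. the function defined by $$d(v^\flat)\wedge\omega^{m-1}=\nu\,\omega^m,\qquad \nu=\Delta\psi .$$ The Euler equation of Hamiltonian fluids is $\partial_t\nu=-L_v\nu$ $(=\{\psi,\nu\})$; $\psi$ is the Hamiltonian of a steady field if the time-independent $\psi$ solves it. A Hamiltonian isotopy is a smooth family of diffeomorphisms $\varphi_t$, $t\in\mathbb R$, with $\varphi_0=\mathrm{id}$ and $\partial_t\varphi_t=\mathrm{sgrad}\,H_t\circ\varphi_t$ for a smooth family of functions $H_t$; Hamiltonian diffeomorphisms are the time-one maps $\varphi_1$. Let $\psi_0$ be a smooth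 function and let $\mathcal O=\{\psi_0\circ f : f \text{ a Hamiltonian diffeomorphism}\}$ be its orbit. Consider the Dirichlet functional $$D(\psi)=\int_M(\mathrm{sgrad}\,\psi,\mathrm{sgrad}\,\psi)\,\omega^m$$ on $\mathcal O$. Call $\psi\in\mathcal O$ an extremal if $\frac{d}{dt}\big|_{t=0}D(\psi\circ\varphi_t)=0$ for every Hamiltonian isotopy $\varphi_t$. Then for every $\psi\in\mathcal O$: 1. $\psi$ is an extremal if and only if $\{\psi,\Delta\psi\}=0$; 2. $\psi$ is an extremal if and only if it is the Hamiltonian of a steady field; 3. if $\psi$ minimizes $D$ on $\mathcal O$, then it is an extremal; 4. if the metric is compatible with $\omega$, i.e. $\omega(v,w)=(Jv,w)$ for an almost complex structure $J$, then $\psi$ is an extremal if and only if $\{\psi,\Delta_{LB}\,\psi\}=0$, where $\Delta_{LB}$ is the Laplace-Beltrami operator of the metric. -/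

import Mathlib

open scoped Manifold ContDiff Topology

noncomputable section

namespace SymplecticFluid

/-- The model space `ℝ^{2m}`. -/
abbrev Model (m : ℕ) : Type := EuclideanSpace ℝ (Fin (2 * m))

/-- The standard basis of `ℝ^{2m}`. -/
def stdBasis (m : ℕ) (i : Fin (2 * m)) : Model m := EuclideanSpace.single i 1

section Wedge

variable {V : Type*} [NormedAddCommGroup V] [NormedSpace ℝ V]

/-- The value at `v₀, …, v_{2m-1}` of the wedge product `β₀ ∧ β₁ ∧ ⋯ ∧ β_{m-1}` of `m` two-forms,
`2^{-m} ∑_σ sgn σ ∏_k β_k (v_{σ(2k)}, v_{σ(2k+1)})`. -/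
def wedgeTwoForms {m : ℕ} (β : Fin m → V [⋀^Fin 2]→L[ℝ] ℝ) (v : Fin (2 * m) → V) : ℝ :=
  ((2 : ℝ) ^ m)⁻¹ * ∑ σ : Equiv.Perm (Fin (2 * m)),
    ((Equiv.Perm.sign σ : ℤ) : ℝ) *
      ∏ k : Fin m, β k ![v (σ ⟨2 * (k : ℕ), by omega⟩), v (σ ⟨2 * (k : ℕ) + 1, by omega⟩)]

/-- The top-degree form `Ω^m = Ω ∧ ⋯ ∧ Ω`. -/
def topPower (m : ℕ) (Ω : V [⋀^Fin 2]→L[ℝ] ℝ) (v : Fin (2 * m) → V) : ℝ :=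
  wedgeTwoForms (fun _ : Fin m => Ω) v

/-- The top-degree form `β ∧ Ω^{m-1}` (for `m ≥ 1`). -/
def wedgePower (m : ℕ) (β Ω : V [⋀^Fin 2]→L[ℝ] ℝ) (v : Fin (2 * m) → V) : ℝ :=
  wedgeTwoForms (fun k : Fin m => if (k : ℕ) = 0 then β else Ω) v

end Wedge

section Manifold

variable {m : ℕ} {M : Type*} [TopologicalSpace M] [ChartedSpace (Model m) M]

/-- The tangent space of `M` at `p`. -/
abbrev TM (m : ℕ) {M : Type*} [TopologicalSpace M] [ChartedSpace (Model m) M] (p : M) : Type :=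
  TangentSpace 𝓘(ℝ, Model m) p

/-- The derivative at `y` of the inverse of the preferred chart at `x`. -/
def chartInvDeriv (x : M) (y : Model m) :
    Model m →L[ℝ] TM m ((chartAt (Model m) x).symm y) :=
  mfderiv 𝓘(ℝ, Model m) 𝓘(ℝ, Model m) (chartAt (Model m) x).symm y

/-- The coordinate vector field `∂_i` of the chart at `x`, at the point with coordinates `y`. -/
def coordVec (x : M) (y : Model m) (i : Fin (2 * m)) : TM m ((chartAt (Model m) x).symm y) :=
  chartInvDeriv x y (stdBasis m i)

/-- The representative of the `k`-form `α` in the chart at `x`: its pullback by the inverse of the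
chart. -/
def chartRep {k : ℕ} (α : ∀ p : M, TM m p [⋀^Fin k]→L[ℝ] ℝ) (x : M) (y : Model m) :
    Model m [⋀^Fin k]→L[ℝ] ℝ :=
  (α ((chartAt (Model m) x).symm y)).compContinuousLinearMap (chartInvDeriv x y)

/-- A `k`-form is smooth if its representatives in charts are. -/
def IsSmoothForm {k : ℕ} (α : ∀ p : M, TM m p [⋀^Fin k]→L[ℝ] ℝ) : Prop :=
  ∀ x : M, ContDiffOn ℝ ∞ (chartRep α x) (chartAt (Model m) x).target

/-- The exterior derivative of a `k`-form, computed at `p` in the chart at `p`. -/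
def extD {k : ℕ} (α : ∀ p : M, TM m p [⋀^Fin k]→L[ℝ] ℝ) (p : M) : TM m p [⋀^Fin (k + 1)]→L[ℝ] ℝ :=
  (extDeriv (chartRep α p) (chartAt (Model m) p p)).compContinuousLinearMap
    (mfderiv 𝓘(ℝ, Model m) 𝓘(ℝ, Model m) (chartAt (Model m) p) p : TM m p →L[ℝ] Model m)

/-- The differential of a function. -/
def dFun (f : M → ℝ) (p : M) : TM m p →L[ℝ] ℝ :=
  (mfderiv 𝓘(ℝ, Model m) 𝓘(ℝ, ℝ) f p : TM m p →L[ℝ] ℝ)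

/-- Smooth real functions on `M`. -/
def SmoothFun (m : ℕ) {M : Type*} [TopologicalSpace M] [ChartedSpace (Model m) M]
    (f : M → ℝ) : Prop :=
  ContMDiff 𝓘(ℝ, Model m) 𝓘(ℝ, ℝ) ∞ f

/-- Jointly smooth time-dependent real functions on `M`. -/
def SmoothFamily (m : ℕ) {M : Type*} [TopologicalSpace M] [ChartedSpace (Model m) M]
    (H : ℝ → M → ℝ) : Prop :=
  ContMDiff (𝓘(ℝ, ℝ).prod 𝓘(ℝ, Model m)) 𝓘(ℝ, ℝ) ∞ (fun q : ℝ × M => H q.1 q.2)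

/-- A symplectic form: a smooth, closed, nondegenerate two-form. -/
structure SymplecticForm (m : ℕ) (M : Type*) [TopologicalSpace M] [ChartedSpace (Model m) M] where
  form : ∀ p : M, TM m p [⋀^Fin 2]→L[ℝ] ℝ
  smooth : IsSmoothForm form
  closed : ∀ p, extD form p = 0
  nondegenerate : ∀ (p : M) (v : TM m p), (∀ w, form p ![v, w] = 0) → v = 0

/-- A smooth Riemannian metric on `M`. -/
abbrev Metric (m : ℕ) (M : Type*) [TopologicalSpace M] [ChartedSpace (Model m) M]
    [IsManifold 𝓘(ℝ, Model m) ∞ M] :=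
  Bundle.ContMDiffRiemannianMetric 𝓘(ℝ, Model m) ∞ (Model m)
    (fun p : M => TangentSpace 𝓘(ℝ, Model m) p)

theorem SymplecticForm.exists_contraction (Ω : SymplecticForm m M) (p : M)
    (ℓ : TM m p →L[ℝ] ℝ) : ∃ v : TM m p, ∀ w, Ω.form p ![v, w] = ℓ w := by
  let A : Model m [⋀^Fin 2]→L[ℝ] ℝ := Ω.form p
  have hA : ∀ v : Model m, (∀ w, A ![v, w] = 0) → v = 0 := Ω.nondegenerate p
  have h0 : ∀ a b c : Model m, Function.update ![a, b] 0 c = ![c, b] := by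
    intro a b c; funext i; fin_cases i <;> rfl
  have h1 : ∀ a b c : Model m, Function.update ![a, b] 1 c = ![a, c] := by
    intro a b c; funext i; fin_cases i <;> rfl
  let B : Model m →ₗ[ℝ] Module.Dual ℝ (Model m) :=
    LinearMap.mk₂ ℝ (fun v w => A ![v, w])
      (fun v v' w => by simpa only [h0] using A.map_update_add ![v, w] 0 v v')
      (fun c v w => by simpa only [h0] using A.map_update_smul ![v, w] 0 c v)
      (fun v w w' => by simpa only [h1] using A.map_update_add ![v, w] 1 w w')
      (fun c v w => by simpa only [h1] using A.map_update_smul ![v, w] 1 c w)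
  have hinj : Function.Injective B := by
    rw [← LinearMap.ker_eq_bot, LinearMap.ker_eq_bot']
    intro v hv
    exact hA v fun w => LinearMap.congr_fun hv w
  have hsurj : Function.Surjective B :=
    (LinearMap.injective_iff_surjective_of_finrank_eq_finrank
      (Subspace.dual_finrank_eq (K := ℝ) (V := Model m)).symm).1 hinj
  obtain ⟨v, hv⟩ := hsurj (ℓ.toLinearMap : Model m →ₗ[ℝ] ℝ)
  exact ⟨v, fun w => LinearMap.congr_fun hv w⟩

/-- The Hamiltonian vector field `sgrad f`: the unique `v` with `i_v Ω = df`. -/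
def sgrad (Ω : SymplecticForm m M) (f : M → ℝ) (p : M) : TM m p :=
  Classical.choose (Ω.exists_contraction p (dFun f p))

theorem sgrad_spec (Ω : SymplecticForm m M) (f : M → ℝ) (p : M) (w : TM m p) :
    Ω.form p ![sgrad Ω f p, w] = dFun f p w :=
  Classical.choose_spec (Ω.exists_contraction p (dFun f p)) w

/-- The Poisson bracket `{f, h} = Ω(sgrad f, sgrad h)`; for `Ω = ∑ dx_k ∧ dy_k` it is
`∑ (∂f/∂x_k ∂h/∂y_k - ∂f/∂y_k ∂h/∂x_k)`. -/
def poisson (Ω : SymplecticForm m M) (f h : M → ℝ) (p : M) : ℝ :=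
  Ω.form p ![sgrad Ω f p, sgrad Ω h p]

section Integral

variable [IsManifold 𝓘(ℝ, Model m) ∞ M] [T2Space M] [CompactSpace M]

variable (m M) in
/-- A smooth partition of unity subordinate to the cover of `M` by the domains of its charts. -/
def chartPartition : SmoothPartitionOfUnity M 𝓘(ℝ, Model m) M Set.univ :=
  Classical.choose
    (SmoothPartitionOfUnity.exists_isSubordinate_chartAt_source 𝓘(ℝ, Model m) M)

theorem chartPartition_isSubordinate :
    (chartPartition m M).IsSubordinate (fun x => (chartAt (Model m) x).source) :=
  Classical.choose_spec
    (SmoothPartitionOfUnity.exists_isSubordinate_chartAt_source 𝓘(ℝ, Model m) M)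

/-- The integral `∫_M f Ω^m`, where `M` is oriented by `Ω^m`: with a partition of unity `ρ`
subordinate to charts, it is the (finite) sum over the charts of the Lebesgue integrals of
`ρ f |Ω^m(∂_1, …, ∂_{2m})|` in coordinates. -/
def integralTop (Ω : SymplecticForm m M) (f : M → ℝ) : ℝ :=
  ∑ᶠ x : M, ∫ y in (chartAt (Model m) x).target,
    chartPartition m M x ((chartAt (Model m) x).symm y) * f ((chartAt (Model m) x).symm y) *
      |topPower m (V := Model m) (Ω.form ((chartAt (Model m) x).symm y)) (coordVec x y)|

/-- The Dirichlet functional `D(ψ) = ∫_M (sgrad ψ, sgrad ψ) Ω^m`. -/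
def dirichlet (Ω : SymplecticForm m M) (g : Metric m M) (ψ : M → ℝ) : ℝ :=
  integralTop Ω fun p => g.inner p (sgrad Ω ψ p) (sgrad Ω ψ p)

end Integral

/-- A Hamiltonian isotopy: a smooth family of diffeomorphisms `φ_t` with `φ_0 = id`, which is the
flow of the Hamiltonian vector fields of a smooth time-dependent function `H_t`, i.e.
`∂_t φ_t(x) = sgrad H_t (φ_t(x))`. -/
structure IsHamiltonianIsotopy (Ω : SymplecticForm m M)
    (φ : ℝ → Diffeomorph 𝓘(ℝ, Model m) 𝓘(ℝ, Model m) M M ∞) (H : ℝ → M → ℝ) : Prop where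
  smooth_hamiltonian : SmoothFamily m H
  smooth_flow : ContMDiff (𝓘(ℝ, ℝ).prod 𝓘(ℝ, Model m)) 𝓘(ℝ, Model m) ∞
    (fun q : ℝ × M => φ q.1 q.2)
  map_zero : ∀ x, φ 0 x = x
  flow : ∀ (t : ℝ) (x : M), HasMFDerivAt 𝓘(ℝ, ℝ) 𝓘(ℝ, Model m) (fun s : ℝ => φ s x) t
    ((1 : ℝ →L[ℝ] ℝ).smulRight (sgrad Ω (H t) (φ t x)))

/-- The Hamiltonian diffeomorphisms: the time-one maps of Hamiltonian isotopies. -/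
def IsHamiltonianDiffeo (Ω : SymplecticForm m M)
    (f : Diffeomorph 𝓘(ℝ, Model m) 𝓘(ℝ, Model m) M M ∞) : Prop :=
  ∃ φ H, IsHamiltonianIsotopy Ω φ H ∧ φ 1 = f

/-- The orbit of the function `ψ₀` under the Hamiltonian diffeomorphisms. -/
def hamOrbit (Ω : SymplecticForm m M) (ψ₀ : M → ℝ) : Set (M → ℝ) :=
  {ψ | ∃ f, IsHamiltonianDiffeo Ω f ∧ ψ = ψ₀ ∘ f}

section Riemannian

variable [IsManifold 𝓘(ℝ, Model m) ∞ M]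

/-- `ψ` is an extremal of the Dirichlet functional on the orbit of `ψ₀`: it lies in the orbit, and
the first variation of the functional along every curve `ψ ∘ φ_t`, with `φ_t` a Hamiltonian
isotopy, vanishes. -/
def IsExtremal [T2Space M] [CompactSpace M] (Ω : SymplecticForm m M) (g : Metric m M)
    (ψ₀ ψ : M → ℝ) : Prop :=
  ψ ∈ hamOrbit Ω ψ₀ ∧ ∀ φ H, IsHamiltonianIsotopy Ω φ H →
    HasDerivAt (fun t : ℝ => dirichlet Ω g (ψ ∘ φ t)) 0 0

/-- `ψ` is a minimizer of the Dirichlet functional on the orbit of `ψ₀`. -/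
def IsMinimizer [T2Space M] [CompactSpace M] (Ω : SymplecticForm m M) (g : Metric m M)
    (ψ₀ ψ : M → ℝ) : Prop :=
  ψ ∈ hamOrbit Ω ψ₀ ∧ ∀ ψ' ∈ hamOrbit Ω ψ₀, dirichlet Ω g ψ ≤ dirichlet Ω g ψ'

/-- The one-form `v^♭` dual to the vector field `v`. -/
def flat (g : Metric m M) (v : ∀ p : M, TM m p) (p : M) : TM m p [⋀^Fin 1]→L[ℝ] ℝ :=
  ContinuousAlternatingMap.ofSubsingleton ℝ (Model m) ℝ (0 : Fin 1) (g.inner p (v p))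

/-- The symplectic vorticity function `ν` of the vector field `v`, i.e. the ratio of top-degree
forms in `d(v^♭) ∧ Ω^{m-1} = ν Ω^m` (evaluated on a basis of the tangent space). -/
def vorticity (Ω : SymplecticForm m M) (g : Metric m M) (v : ∀ p : M, TM m p) (p : M) : ℝ :=
  wedgePower m (V := Model m) (extD (flat g v) p) (Ω.form p) (stdBasis m) /
    topPower m (V := Model m) (Ω.form p) (stdBasis m)

/-- The Laplacian `Δψ = ν` of the Riemannian symplectic manifold: the symplectic vorticity function
of `v = sgrad ψ`, i.e. `d(v^♭) ∧ Ω^{m-1} = Δψ Ω^m`. For compatible metrics it is a nonzero constant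
multiple of the Laplace-Beltrami operator. -/
def laplacian (Ω : SymplecticForm m M) (g : Metric m M) (ψ : M → ℝ) : M → ℝ :=
  vorticity Ω g (sgrad Ω ψ)

/-- Solutions, in terms of the time-dependent Hamiltonian `Ψ_t` of the velocity field
`v = sgrad Ψ_t`, of the Euler equation `∂_t ν = - L_v ν` of Hamiltonian fluids, where `ν` is the
symplectic vorticity function of `v`. -/
def IsEulerSolution (Ω : SymplecticForm m M) (g : Metric m M) (Ψ : ℝ → M → ℝ) : Prop :=
  SmoothFamily m Ψ ∧ ∀ (t : ℝ) (p : M),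
    HasDerivAt (fun s : ℝ => vorticity Ω g (sgrad Ω (Ψ s)) p)
      (-(dFun (vorticity Ω g (sgrad Ω (Ψ t))) p (sgrad Ω (Ψ t) p))) t

/-- `ψ` is the Hamiltonian of a steady vector field: a time-independent solution of the Euler
equation. -/
def IsSteadyHamiltonian (Ω : SymplecticForm m M) (g : Metric m M) (ψ : M → ℝ) : Prop :=
  IsEulerSolution Ω g fun _ => ψ

/-- The metric is compatible with the symplectic form: `Ω(v, w) = (J v, w)` for an almost complex
structure `J` (which is then smooth, as `Ω` and the metric are). -/
def IsCompatible (Ω : SymplecticForm m M) (g : Metric m M) : Prop :=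
  ∃ J : ∀ p : M, TM m p →L[ℝ] TM m p, ∀ (p : M) (v w : TM m p),
    J p (J p v) = -v ∧ Ω.form p ![v, w] = g.inner p (J p v) w

/-- The Gram matrix `(g_{ij})` of the metric in the chart at `x`. -/
def gram (g : Metric m M) (x : M) (y : Model m) : Matrix (Fin (2 * m)) (Fin (2 * m)) ℝ :=
  Matrix.of fun i j => g.inner ((chartAt (Model m) x).symm y) (coordVec x y i) (coordVec x y j)

/-- The Laplace-Beltrami operator of the metric,
`|g|^{-1/2} ∑_i ∂_i (|g|^{1/2} ∑_j g^{ij} ∂_j f)`, computed at `p` in the chart at `p`. -/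
def laplaceBeltrami (g : Metric m M) (f : M → ℝ) (p : M) : ℝ :=
  (√(gram g p (chartAt (Model m) p p)).det)⁻¹ * ∑ i,
    fderiv ℝ (fun y => √(gram g p y).det * ∑ j, (gram g p y)⁻¹ i j *
      fderiv ℝ (f ∘ (chartAt (Model m) p).symm) y (stdBasis m j))
      (chartAt (Model m) p p) (stdBasis m i)

end Riemannian

end Manifold

end SymplecticFluid

end

/-! Along a Hamiltonian isotopy with Hamiltonians H_t, the function ψ ∘ φ_t has velocity {ψ, H_0} at
t = 0, so the first variation of D is 2 ∫ (sgrad ψ, sgrad {ψ, H_0}) ω^m. Green's formula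
`integralTop_inner_sgrad` turns it into 2m ∫ {ψ, H_0} Δψ ω^m and, since Poisson brackets have zero
mean, into -2m ∫ H_0 {ψ, Δψ} ω^m (`hasDerivAt_dirichlet_isotopy`). It vanishes for all isotopies if
{ψ, Δψ} = 0. Conversely, the choice H = {ψ, Δψ} makes the integrand a square and forces {ψ, Δψ} = 0;
this requires that every smooth function generates an isotopy (`exists_isHamiltonianIsotopy`). For a
time-independent ψ the Euler equation also says {ψ, Δψ} = 0. A minimizer is an extremal because ψ ∘
φ_t stays in the orbit, as Hamiltonian diffeomorphisms compose
(`IsHamiltonianIsotopy.isHamiltonianDiffeo_trans`).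

Green's formula `integralTop_formSgrad` is the divergence theorem. If i_X ω = α, Cartan's formula
and dω = 0 give L_X ω = dα, hence L_X ω^m = m dα ∧ ω^{m-1}: the ratio m dα ∧ ω^{m-1} / ω^m is the
divergence of X. Moreover α(sgrad F) = -dF(X), and the divergence of F X has zero integral. The
pointwise algebra is `wedgeTwoForms_variation`: on products of m two-forms, an endomorphism acts as
a derivation and also as multiplication by its trace. The same identity shows that ω^m vanishes
nowhere (`topPower_ne_zero`).

Flows come from the implicit function theorem on a space of continuous paths; compactness of M makes
them complete and smooth in all variables.

For a compatible metric J sgrad ψ = grad ψ, so (sgrad ψ)^♭ = i_X ω with X = -grad ψ, and mΔψ is the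
divergence of X with respect to ω^m. The Riemannian density has the same logarithmic derivatives as
ω^m, whence Δ_LB = -mΔ (`laplaceBeltrami_eq_laplacian`). -/

noncomputable section

namespace SymplecticFluid

/-! ### Algebra of wedge products of two-forms -/

section WedgeAlgebra

theorem update_vec_zero {V : Type*} (a b c : V) : Function.update ![a, b] 0 c = ![c, b] := by
  funext i; fin_cases i <;> rfl

theorem update_vec_one {V : Type*} (a b c : V) : Function.update ![a, b] 1 c = ![a, c] := by
  funext i; fin_cases i <;> rfl

variable {V : Type*} [NormedAddCommGroup V] [NormedSpace ℝ V] {m : ℕ}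

/-- The bijection `(k, b) ↦ 2k + b`. -/
def pairEquiv (m : ℕ) : Fin m × Fin 2 ≃ Fin (2 * m) :=
  finProdFinEquiv.trans (finCongr (mul_comm m 2))

theorem pairEquiv_zero (k : Fin m) : pairEquiv m (k, 0) = ⟨2 * (k : ℕ), by omega⟩ := by
  ext; simp [pairEquiv]

theorem pairEquiv_one (k : Fin m) : pairEquiv m (k, 1) = ⟨2 * (k : ℕ) + 1, by omega⟩ := by
  ext; simp [pairEquiv]; omega

/-- The alternating sum `∑_σ sgn σ ∏_k b_k (σ(2k), σ(2k+1))`. -/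
def altSum (b : Fin m → Fin (2 * m) → Fin (2 * m) → ℝ) : ℝ :=
  ∑ σ : Equiv.Perm (Fin (2 * m)), ((Equiv.Perm.sign σ : ℤ) : ℝ) *
    ∏ k : Fin m, b k (σ (pairEquiv m (k, 0))) (σ (pairEquiv m (k, 1)))

theorem wedgeTwoForms_eq_altSum (β : Fin m → V [⋀^Fin 2]→L[ℝ] ℝ) (v : Fin (2 * m) → V) :
    wedgeTwoForms β v = ((2 : ℝ) ^ m)⁻¹ * altSum fun k i j => β k ![v i, v j] := by
  simp only [wedgeTwoForms, altSum, pairEquiv_zero, pairEquiv_one]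

/-- Two-forms commute: permuting the factors by π permutes the 2m arguments in pairs, by a
permutation of sign (sgn π)² = 1. -/
theorem altSum_comp_perm (b : Fin m → Fin (2 * m) → Fin (2 * m) → ℝ) (π : Equiv.Perm (Fin m)) :
    altSum (fun k => b (π k)) = altSum b := by
  let Q : Equiv.Perm (Fin (2 * m)) :=
    (pairEquiv m).permCongr (Equiv.prodCongrLeft fun _ : Fin 2 => π)
  have hs : Equiv.Perm.sign Q = 1 := by
    rw [Equiv.Perm.sign_permCongr, Equiv.Perm.sign_prodCongrLeft, Fin.prod_univ_two]
    exact Int.units_mul_self _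
  have hQ : ∀ k c, Q (pairEquiv m (k, c)) = pairEquiv m (π k, c) := by
    intro k c
    simp [Q, Equiv.permCongr_apply, Equiv.prodCongrLeft]
  unfold altSum
  rw [← Equiv.sum_comp (Equiv.mulRight Q)]
  refine Finset.sum_congr rfl fun σ _ => ?_
  simp only [Equiv.coe_mulRight, Equiv.Perm.sign_mul, hs, mul_one, Equiv.Perm.mul_apply, hQ]
  congr 1
  exact Equiv.prod_comp π
    fun k => b k (σ (pairEquiv m (k, 0))) (σ (pairEquiv m (k, 1)))

/-- Exchanging the two arguments of one factor reindexes the sum by a transposition, which is odd.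
-/
theorem altSum_flip (b : Fin m → Fin (2 * m) → Fin (2 * m) → ℝ) (k : Fin m) :
    altSum (Function.update b k fun i j => b k j i) = -altSum b := by
  let τ : Equiv.Perm (Fin (2 * m)) := Equiv.swap (pairEquiv m (k, 0)) (pairEquiv m (k, 1))
  have hs : Equiv.Perm.sign τ = -1 := by
    apply Equiv.Perm.sign_swap
    simp
  unfold altSum
  rw [← Equiv.sum_comp (Equiv.mulRight τ), ← Finset.sum_neg_distrib]
  refine Finset.sum_congr rfl fun σ _ => ?_
  simp only [Equiv.coe_mulRight, Equiv.Perm.sign_mul, hs, Equiv.Perm.mul_apply]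
  have : ∏ j : Fin m, Function.update b k (fun i j => b k j i) j (σ (τ (pairEquiv m (j, 0))))
      (σ (τ (pairEquiv m (j, 1)))) =
      ∏ j : Fin m, b j (σ (pairEquiv m (j, 0))) (σ (pairEquiv m (j, 1))) := by
    refine Finset.prod_congr rfl fun j _ => ?_
    by_cases h : j = k
    · subst h
      simp [τ]
    · rw [Function.update_of_ne h, Equiv.swap_apply_of_ne_of_ne, Equiv.swap_apply_of_ne_of_ne] <;>
        simp [h]
  rw [this]
  push_cast
  ring

theorem altSum_update_sub (b : Fin m → Fin (2 * m) → Fin (2 * m) → ℝ) (k : Fin m)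
    (c d : Fin (2 * m) → Fin (2 * m) → ℝ) :
    altSum (Function.update b k fun i j => c i j - d i j) =
      altSum (Function.update b k c) - altSum (Function.update b k d) := by
  have key : ∀ (e : Fin (2 * m) → Fin (2 * m) → ℝ) (σ : Equiv.Perm (Fin (2 * m))),
      ∏ j : Fin m, Function.update b k e j (σ (pairEquiv m (j, 0))) (σ (pairEquiv m (j, 1))) =
      e (σ (pairEquiv m (k, 0))) (σ (pairEquiv m (k, 1))) *
      ∏ j ∈ Finset.univ.erase k, b j (σ (pairEquiv m (j, 0))) (σ (pairEquiv m (j, 1))) := by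
    intro e σ
    rw [← Finset.mul_prod_erase _ _ (Finset.mem_univ k), Function.update_self]
    congr 1
    refine Finset.prod_congr rfl fun j hj => ?_
    rw [Function.update_of_ne (Finset.ne_of_mem_erase hj)]
  unfold altSum
  rw [← Finset.sum_sub_distrib]
  refine Finset.sum_congr rfl fun σ _ => ?_
  simp only [key]
  ring

/-- The alternating sum already antisymmetrizes each factor, so doing it beforehand only doubles the
value, once per factor in `S`. This reduces products of skew forms to products of tensors. -/
theorem altSum_antisymm (b : Fin m → Fin (2 * m) → Fin (2 * m) → ℝ) (S : Finset (Fin m)) :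
    altSum (fun k i j => if k ∈ S then b k i j - b k j i else b k i j) =
      2 ^ S.card * altSum b := by
  classical
  induction S using Finset.induction_on with
  | empty => simp
  | insert a S ha ih =>
    let B : Fin m → Fin (2 * m) → Fin (2 * m) → ℝ :=
      fun k i j => if k ∈ S then b k i j - b k j i else b k i j
    have h1 : (fun (k : Fin m) (i j : Fin (2 * m)) =>
        if k ∈ insert a S then b k i j - b k j i else b k i j) =
        Function.update B a (fun i j => B a i j - B a j i) := by
      funext k i j
      by_cases h : k = a
      · subst h; simp [B, ha]
      · simp [B, h]
    rw [h1, altSum_update_sub, altSum_flip, Function.update_eq_self,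
      Finset.card_insert_of_notMem ha]
    change altSum B = _ at ih
    rw [ih]; ring

theorem altSum_one :
    altSum (fun (k : Fin m) i j => (if i = pairEquiv m (k, 0) then (1 : ℝ) else 0) *
      (if j = pairEquiv m (k, 1) then (1 : ℝ) else 0)) = 1 := by
  unfold altSum
  rw [Finset.sum_eq_single (1 : Equiv.Perm (Fin (2 * m)))]
  · simp
  · intro σ _ hσ
    have : ∃ q, σ (pairEquiv m q) ≠ pairEquiv m q := by
      by_contra! h
      apply hσ
      ext i
      obtain ⟨q, rfl⟩ := (pairEquiv m).surjective i
      simp [h q]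
    obtain ⟨⟨k, c⟩, hq⟩ := this
    refine mul_eq_zero_of_right _ (Finset.prod_eq_zero (Finset.mem_univ k) ?_)
    fin_cases c
    · simp at hq; simp [hq]
    · simp at hq; simp [hq]
  · simp

theorem wedgeTwoForms_comp_perm (β : Fin m → V [⋀^Fin 2]→L[ℝ] ℝ) (π : Equiv.Perm (Fin m))
    (v : Fin (2 * m) → V) : wedgeTwoForms (fun k => β (π k)) v = wedgeTwoForms β v := by
  simp only [wedgeTwoForms_eq_altSum]
  rw [altSum_comp_perm (fun k i j => β k ![v i, v j])]

/-- The bilinear map underlying a two-form. -/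
def toBilin (A : V [⋀^Fin 2]→L[ℝ] ℝ) : V →ₗ[ℝ] V →ₗ[ℝ] ℝ :=
  LinearMap.mk₂ ℝ (fun v w => A ![v, w])
    (fun v v' w => by simpa only [update_vec_zero] using A.map_update_add ![v, w] 0 v v')
    (fun c v w => by simpa only [update_vec_zero] using A.map_update_smul ![v, w] 0 c v)
    (fun v w w' => by simpa only [update_vec_one] using A.map_update_add ![v, w] 1 w w')
    (fun c v w => by simpa only [update_vec_one] using A.map_update_smul ![v, w] 1 c w)

@[simp]
theorem toBilin_apply (A : V [⋀^Fin 2]→L[ℝ] ℝ) (v w : V) : toBilin A v w = A ![v, w] := rfl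

theorem twoForm_swap (A : V [⋀^Fin 2]→L[ℝ] ℝ) (v w : V) : A ![v, w] = -A ![w, v] := by
  have h := A.toAlternatingMap.map_swap ![w, v] (i := 0) (j := 1) (by simp)
  have h2 : ![w, v] ∘ (Equiv.swap (0 : Fin 2) 1) = ![v, w] := by
    funext i; fin_cases i <;> simp
  rw [h2] at h
  exact h

/-- The multilinear map `v ↦ ∏_k β_k (v_{2k}, v_{2k+1})`. -/
def pairProd (β : Fin m → V [⋀^Fin 2]→L[ℝ] ℝ) : MultilinearMap ℝ (fun _ : Fin (2 * m) => V) ℝ where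
  toFun v := ∏ k, β k ![v (pairEquiv m (k, 0)), v (pairEquiv m (k, 1))]
  map_update_add' {inst} v i x y := by
    -- The field of `MultilinearMap` quantifies over the decidability instance inside
    -- `Function.update`.
    obtain rfl : inst = instDecidableEqFin _ := Subsingleton.elim _ _
    obtain ⟨⟨k, c⟩, rfl⟩ := (pairEquiv m).surjective i
    have key : ∀ z, ∏ j ∈ Finset.univ.erase k,
        β j ![Function.update v (pairEquiv m (k, c)) z (pairEquiv m (j, 0)),
          Function.update v (pairEquiv m (k, c)) z (pairEquiv m (j, 1))] =
        ∏ j ∈ Finset.univ.erase k, β j ![v (pairEquiv m (j, 0)), v (pairEquiv m (j, 1))] := by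
      intro z
      refine Finset.prod_congr rfl fun j hj => ?_
      have := Finset.ne_of_mem_erase hj
      rw [Function.update_of_ne, Function.update_of_ne] <;> simp [this]
    simp only [← Finset.mul_prod_erase _ _ (Finset.mem_univ k), key]
    simp only [← toBilin_apply]
    fin_cases c <;> simp [-toBilin_apply, add_mul]
  map_update_smul' {inst} v i r x := by
    obtain rfl : inst = instDecidableEqFin _ := Subsingleton.elim _ _
    obtain ⟨⟨k, c⟩, rfl⟩ := (pairEquiv m).surjective i
    have key : ∀ z, ∏ j ∈ Finset.univ.erase k,
        β j ![Function.update v (pairEquiv m (k, c)) z (pairEquiv m (j, 0)),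
          Function.update v (pairEquiv m (k, c)) z (pairEquiv m (j, 1))] =
        ∏ j ∈ Finset.univ.erase k, β j ![v (pairEquiv m (j, 0)), v (pairEquiv m (j, 1))] := by
      intro z
      refine Finset.prod_congr rfl fun j hj => ?_
      have := Finset.ne_of_mem_erase hj
      rw [Function.update_of_ne, Function.update_of_ne] <;> simp [this]
    simp only [← Finset.mul_prod_erase _ _ (Finset.mem_univ k), key]
    simp only [← toBilin_apply]
    fin_cases c <;> simp [-toBilin_apply, mul_assoc]

/-- The wedge product of two-forms as an alternating map. -/
def wedgeAlt (β : Fin m → V [⋀^Fin 2]→L[ℝ] ℝ) : V [⋀^Fin (2 * m)]→ₗ[ℝ] ℝ :=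
  ((2 : ℝ) ^ m)⁻¹ • MultilinearMap.alternatization (pairProd β)

theorem wedgeAlt_apply (β : Fin m → V [⋀^Fin 2]→L[ℝ] ℝ) (v : Fin (2 * m) → V) :
    wedgeAlt β v = wedgeTwoForms β v := by
  rw [wedgeTwoForms_eq_altSum, wedgeAlt, AlternatingMap.smul_apply,
    MultilinearMap.alternatization_apply, smul_eq_mul]
  congr 1
  refine Finset.sum_congr rfl fun σ _ => ?_
  rw [Units.smul_def, zsmul_eq_mul]
  rfl

/-- In dimension 2m an alternating 2m-form is a multiple of the determinant of a basis. -/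
theorem wedgeTwoForms_comp_linearMap [FiniteDimensional ℝ V] (e : Module.Basis (Fin (2 * m)) ℝ V)
    (β : Fin m → V [⋀^Fin 2]→L[ℝ] ℝ) (A : V →ₗ[ℝ] V) (v : Fin (2 * m) → V) :
    wedgeTwoForms β (fun i => A (v i)) = LinearMap.det A * wedgeTwoForms β v := by
  have h := AlternatingMap.eq_smul_basis_det e (wedgeAlt β)
  have h1 : ∀ w, wedgeTwoForms β w = wedgeAlt β e * e.det w := by
    intro w
    rw [← wedgeAlt_apply]
    conv_lhs => rw [h]
    rfl
  rw [h1, h1 v, show (fun i => A (v i)) = A ∘ v from rfl, Module.Basis.det_comp]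
  ring

theorem wedgeTwoForms_compContinuousLinearMap {W : Type*} [NormedAddCommGroup W] [NormedSpace ℝ W]
    (β : Fin m → V [⋀^Fin 2]→L[ℝ] ℝ) (A : W →L[ℝ] V) (v : Fin (2 * m) → W) :
    wedgeTwoForms (fun k => (β k).compContinuousLinearMap A) v =
      wedgeTwoForms β (fun i => A (v i)) := by
  simp only [wedgeTwoForms_eq_altSum]
  congr 2
  funext k i j
  change β k (A ∘ ![v i, v j]) = _
  congr 1
  funext l; fin_cases l <;> rfl

theorem hasDerivAt_altSum {b : ℝ → Fin m → Fin (2 * m) → Fin (2 * m) → ℝ}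
    {b' : Fin m → Fin (2 * m) → Fin (2 * m) → ℝ} {t : ℝ}
    (h : ∀ k i j, HasDerivAt (fun s => b s k i j) (b' k i j) t) :
    HasDerivAt (fun s => altSum (b s)) (∑ k, altSum (Function.update (b t) k (b' k))) t := by
  have hf := HasDerivAt.fun_sum (x := t) (u := Finset.univ)
    (A := fun (σ : Equiv.Perm (Fin (2 * m))) s => ((Equiv.Perm.sign σ : ℤ) : ℝ) *
      ∏ k : Fin m, b s k (σ (pairEquiv m (k, 0))) (σ (pairEquiv m (k, 1))))
    (fun σ _ => (HasDerivAt.fun_finsetProd (u := Finset.univ)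
      (fun k _ => h k (σ (pairEquiv m (k, 0))) (σ (pairEquiv m (k, 1))))).const_mul
        ((Equiv.Perm.sign σ : ℤ) : ℝ))
  refine hf.congr_deriv ?_
  unfold altSum
  rw [Finset.sum_comm]
  refine Finset.sum_congr rfl fun σ _ => ?_
  rw [Finset.mul_sum]
  refine Finset.sum_congr rfl fun k _ => ?_
  congr 1
  rw [← Finset.mul_prod_erase _ _ (Finset.mem_univ k), Function.update_self, smul_eq_mul, mul_comm]
  congr 1
  refine Finset.prod_congr rfl fun j hj => ?_
  rw [Function.update_of_ne (Finset.ne_of_mem_erase hj)]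

/-- The Leibniz rule for the wedge product of two-forms, evaluated along curves of vectors. -/
theorem hasDerivAt_wedgeTwoForms {β : ℝ → Fin m → V [⋀^Fin 2]→L[ℝ] ℝ}
    {β' : Fin m → V [⋀^Fin 2]→L[ℝ] ℝ} {v : ℝ → Fin (2 * m) → V} {t : ℝ}
    (h : ∀ k i j, HasDerivAt (fun s => β s k ![v s i, v s j]) (β' k ![v t i, v t j]) t) :
    HasDerivAt (fun s => wedgeTwoForms (β s) (v s))
      (∑ k, wedgeTwoForms (Function.update (β t) k (β' k)) (v t)) t := by
  simp only [wedgeTwoForms_eq_altSum]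
  have := (hasDerivAt_altSum h).const_mul ((2 : ℝ) ^ m)⁻¹
  refine this.congr_deriv ?_
  rw [Finset.mul_sum]
  refine Finset.sum_congr rfl fun k _ => ?_
  congr 2
  funext j
  by_cases hj : j = k
  · subst hj; simp
  · simp [hj]

/-- `wedgePower` puts β in slot 0; by commutativity every slot gives the same value. This is the
factor m in d(ω^m) = m dω ∧ ω^{m-1} and so in Green's formula. -/
theorem sum_wedgeTwoForms_update_const (hm : 1 ≤ m) (β w : V [⋀^Fin 2]→L[ℝ] ℝ)
    (v : Fin (2 * m) → V) :
    ∑ k, wedgeTwoForms (Function.update (fun _ : Fin m => w) k β) v = m * wedgePower m β w v := by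
  rw [Finset.sum_congr rfl (g := fun _ => wedgePower m β w v), Finset.sum_const, Finset.card_univ,
    Fintype.card_fin, nsmul_eq_mul]
  intro k _
  unfold wedgePower
  rw [← wedgeTwoForms_comp_perm _ (Equiv.swap k ⟨0, hm⟩)]
  congr 1
  funext j
  have h0 : ∀ i : Fin m, (i : ℕ) = 0 ↔ i = ⟨0, hm⟩ := fun i => by rw [Fin.ext_iff]
  by_cases hj : (j : ℕ) = 0
  · rw [if_pos hj, (h0 j).1 hj, Equiv.swap_apply_right, Function.update_self]
  · rw [if_neg hj, Function.update_of_ne]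
    intro h
    rw [Equiv.swap_apply_eq_iff, Equiv.swap_apply_left] at h
    exact hj ((h0 j).2 h)

end WedgeAlgebra

/-! ### Infinitesimal action of endomorphisms on two-forms -/

section

variable {V : Type*} [NormedAddCommGroup V] [NormedSpace ℝ V] {m : ℕ}

theorem compContinuousLinearMap_vec {W : Type*} [NormedAddCommGroup W] [NormedSpace ℝ W]
    (w : V [⋀^Fin 2]→L[ℝ] ℝ) (A : W →L[ℝ] V) (x y : W) :
    w.compContinuousLinearMap A ![x, y] = w ![A x, A y] := by
  change w (A ∘ ![x, y]) = _
  congr 1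
  funext l; fin_cases l <;> rfl

/-- The infinitesimal action `(u, v) ↦ w(T u, v) + w(u, T v)` of an endomorphism on two-forms. -/
def formAction (T : V →L[ℝ] V) (w : V [⋀^Fin 2]→L[ℝ] ℝ) : V [⋀^Fin 2]→L[ℝ] ℝ :=
  -- These are the terms of w((1 + T)u, (1 + T)v) of degree one in T; the form is thus alternating
  -- and continuous by construction.
  w.compContinuousLinearMap (ContinuousLinearMap.id ℝ V + T) - w - w.compContinuousLinearMap T

theorem formAction_apply (T : V →L[ℝ] V) (w : V [⋀^Fin 2]→L[ℝ] ℝ) (x y : V) :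
    formAction T w ![x, y] = w ![T x, y] + w ![x, T y] := by
  simp only [formAction, ContinuousAlternatingMap.sub_apply, compContinuousLinearMap_vec]
  simp only [← toBilin_apply]
  simp [-toBilin_apply]
  ring

/-- The two-form `(u, v) ↦ A u v - A v u`. -/
def skewForm (A : V →L[ℝ] V →L[ℝ] ℝ) : V [⋀^Fin 2]→L[ℝ] ℝ :=
  ContinuousAlternatingMap.alternatizeUncurryFin
    ((ContinuousAlternatingMap.ofSubsingletonLIE (𝕜 := ℝ)
      (E := V) (F := ℝ) (0 : Fin 1)).toContinuousLinearEquiv.toContinuousLinearMap ∘L A)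

theorem skewForm_apply (A : V →L[ℝ] V →L[ℝ] ℝ) (u v : V) :
    skewForm A ![u, v] = A u v - A v u := by
  rw [skewForm, ContinuousAlternatingMap.alternatizeUncurryFin_apply, Fin.sum_univ_two]
  simp [Fin.removeNth, ← sub_eq_add_neg]

theorem wedgeTwoForms_eq_zero_of_slot {β : Fin m → V [⋀^Fin 2]→L[ℝ] ℝ} {k : Fin m} (h : β k = 0)
    (v : Fin (2 * m) → V) : wedgeTwoForms β v = 0 := by
  rw [wedgeTwoForms_eq_altSum, altSum]
  refine mul_eq_zero_of_right _ (Finset.sum_eq_zero fun σ _ => mul_eq_zero_of_right _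
    (Finset.prod_eq_zero (Finset.mem_univ k) ?_))
  simp [h]

end

/-! ### The top power of a nondegenerate two-form is nonzero -/

section Nonvanishing

variable {V : Type*} [NormedAddCommGroup V] [NormedSpace ℝ V] [FiniteDimensional ℝ V] {m : ℕ}

theorem hasDerivAt_det_one_add_smul {n : Type*} [Fintype n] [DecidableEq n] (B : Matrix n n ℝ) :
    HasDerivAt (fun t : ℝ => (1 + t • B).det) B.trace 0 := by
  rw [funext fun t : ℝ => Matrix.det_one_add_smul t B]
  have := (((hasDerivAt_id (0 : ℝ)).const_mul B.trace).const_add 1).add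
    (((Polynomial.hasDerivAt (Matrix.det (1 + (Polynomial.X : Polynomial ℝ) •
      B.map Polynomial.C)).divX.divX (0 : ℝ)).mul ((hasDerivAt_id (0 : ℝ)).pow 2)))
  refine this.congr_deriv ?_
  simp

theorem hasDerivAt_det_id_add_smul (T : V →ₗ[ℝ] V) :
    HasDerivAt (fun t : ℝ => LinearMap.det (LinearMap.id + t • T)) (LinearMap.trace ℝ V T) 0 := by
  let b := Module.finBasis ℝ V
  have h : ∀ t : ℝ, LinearMap.det (LinearMap.id + t • T) =
      Matrix.det (1 + t • LinearMap.toMatrix b b T) := by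
    intro t
    rw [← LinearMap.det_toMatrix b, map_add, map_smul, LinearMap.toMatrix_id]
  rw [funext h, LinearMap.trace_eq_matrix_trace ℝ b]
  exact hasDerivAt_det_one_add_smul _

/-- The two ways of differentiating `∏ β_k(t)` on the moving frame `e + t T e`. -/
theorem wedgeTwoForms_variation (e : Module.Basis (Fin (2 * m)) ℝ V) (T : V →L[ℝ] V)
    {β : ℝ → Fin m → V [⋀^Fin 2]→L[ℝ] ℝ} {β' : Fin m → V [⋀^Fin 2]→L[ℝ] ℝ}
    (h : ∀ k x y, HasDerivAt (fun s => β s k ![x, y]) (β' k ![x, y]) 0) :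
    LinearMap.trace ℝ V T * wedgeTwoForms (β 0) e +
      ∑ k, wedgeTwoForms (Function.update (β 0) k (β' k)) e =
      ∑ k, wedgeTwoForms (Function.update (β 0) k (β' k + formAction T (β 0 k))) e := by
  -- Leibniz rule: each slot contributes the derivative of its form and the action of T on it.
  have h1 : HasDerivAt (fun s => wedgeTwoForms (β s) (fun i => e i + s • T (e i)))
      (∑ k, wedgeTwoForms (Function.update (β 0) k (β' k + formAction T (β 0 k)))
        (fun i => e i + (0 : ℝ) • T (e i))) 0 := by
    refine hasDerivAt_wedgeTwoForms fun k i j => ?_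
    have e1 : (fun s => β s k ![e i + s • T (e i), e j + s • T (e j)]) = fun s =>
        β s k ![e i, e j] + s * (β s k ![T (e i), e j] + β s k ![e i, T (e j)]) +
          s ^ 2 * β s k ![T (e i), T (e j)] := by
      funext s
      simp only [← toBilin_apply]
      simp [-toBilin_apply]
      ring
    rw [e1]
    have := ((h k (e i) (e j)).add ((hasDerivAt_id (0 : ℝ)).mul
      ((h k (T (e i)) (e j)).add (h k (e i) (T (e j)))))).add
      (((hasDerivAt_id (0 : ℝ)).pow 2).mul (h k (T (e i)) (T (e j))))
    refine this.congr_deriv ?_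
    simp [formAction_apply]
  -- On the moving frame a top-degree form is multiplied by det (1 + sT), whose derivative at 0 is
  -- the trace of T.
  have h2 : HasDerivAt (fun s => wedgeTwoForms (β s) (fun i => e i + s • T (e i)))
      (LinearMap.trace ℝ V T * wedgeTwoForms (β 0) e +
      ∑ k, wedgeTwoForms (Function.update (β 0) k (β' k)) e) 0 := by
    have e1 : (fun s => wedgeTwoForms (β s) (fun i => e i + s • T (e i))) =
        fun s => LinearMap.det (LinearMap.id + s • (T : V →ₗ[ℝ] V)) * wedgeTwoForms (β s) e := by
      funext s
      rw [← wedgeTwoForms_comp_linearMap e]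
      rfl
    rw [e1]
    have := (hasDerivAt_det_id_add_smul (T : V →ₗ[ℝ] V)).mul
      (hasDerivAt_wedgeTwoForms (v := fun _ => e) (t := 0) fun k i j => h k (e i) (e j))
    refine this.congr_deriv ?_
    simp
  simpa using h2.unique h1

theorem exists_form_contraction {w : V [⋀^Fin 2]→L[ℝ] ℝ}
    (hw : ∀ v, (∀ u, w ![v, u] = 0) → v = 0) (β : V [⋀^Fin 2]→L[ℝ] ℝ) :
    ∃ T : V →L[ℝ] V, ∀ u v, w ![T u, v] = 2⁻¹ * β ![u, v] := by
  have hinj : Function.Injective (toBilin w) := by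
    rw [← LinearMap.ker_eq_bot, LinearMap.ker_eq_bot']
    exact fun v hv => hw v fun u => LinearMap.congr_fun hv u
  let e := LinearEquiv.ofInjectiveOfFinrankEq (toBilin w) hinj
    (Subspace.dual_finrank_eq (K := ℝ) (V := V)).symm
  refine ⟨LinearMap.toContinuousLinearMap (e.symm.toLinearMap ∘ₗ ((2⁻¹ : ℝ) • toBilin β)),
    fun u v => ?_⟩
  have : toBilin w (e.symm ((2⁻¹ : ℝ) • toBilin β u)) = (2⁻¹ : ℝ) • toBilin β u :=
    e.apply_symm_apply _
  exact LinearMap.congr_fun this v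

/-- Since w and β are both skew, w(Tu, v) and w(u, Tv) contribute equally; hence the factor 1/2. The
explicit formula for w(Tu, v) is kept for the computation of determinants in
`hasDerivAt_det_formMatrix`. -/
theorem exists_formAction_eq {w : V [⋀^Fin 2]→L[ℝ] ℝ}
    (hw : ∀ v, (∀ u, w ![v, u] = 0) → v = 0) (β : V [⋀^Fin 2]→L[ℝ] ℝ) :
    ∃ T : V →L[ℝ] V, (∀ u v, w ![T u, v] = 2⁻¹ * β ![u, v]) ∧ formAction T w = β := by
  obtain ⟨T, hT⟩ := exists_form_contraction hw β
  refine ⟨T, hT, ?_⟩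
  ext v
  have : v = ![v 0, v 1] := by funext i; fin_cases i <;> rfl
  rw [this, formAction_apply, hT, twoForm_swap w _ (T _), hT, twoForm_swap β _ (v 0)]
  ring

/-- Every two-form is the image of w under some derivation T, and a derivation multiplies top-degree
products by its trace. Vanishing therefore spreads from w^m to all products, one slot at a time; `S`
is the set of slots freed from w so far. No symplectic basis is needed. -/
theorem wedgeTwoForms_eq_zero_of_topPower (e : Module.Basis (Fin (2 * m)) ℝ V)
    {w : V [⋀^Fin 2]→L[ℝ] ℝ} (hw : ∀ v, (∀ u, w ![v, u] = 0) → v = 0)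
    (h0 : topPower m w e = 0) (S : Finset (Fin m)) (β : Fin m → V [⋀^Fin 2]→L[ℝ] ℝ) :
    wedgeTwoForms (fun k => if k ∈ S then β k else w) e = 0 := by
  induction S using Finset.induction_on generalizing β with
  | empty => simpa [topPower] using h0
  | insert a S ha ih =>
    obtain ⟨T, -, hT⟩ := exists_formAction_eq hw (β a)
    -- T acts on the product with the slots of `S` freed, which is zero by induction; the forms are
    -- constant in time.
    have key := wedgeTwoForms_variation e T (β := fun _ k => if k ∈ S then β k else w)
      (β' := fun _ => 0) (fun k x y => hasDerivAt_const _ _)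
    have hz : ∀ k, wedgeTwoForms (Function.update (fun k => if k ∈ S then β k else w) k 0) e = 0 :=
      fun k => wedgeTwoForms_eq_zero_of_slot (k := k) (Function.update_self _ _ _) _
    simp only [hz, ih β, mul_zero, Finset.sum_const_zero, add_zero, zero_add] at key
    set C := wedgeTwoForms (fun k => if k ∈ insert a S then β k else w) e with hC
    -- If T hits a slot in `S`, the result is a product of the same kind, zero by induction. If it
    -- hits w, that slot receives `β a`, and commuting factors moves it to slot `a`.
    have hin : ∀ k, wedgeTwoForms (Function.update (fun k => if k ∈ S then β k else w) k
        (formAction T (if k ∈ S then β k else w))) e = if k ∈ S then 0 else C := by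
      intro k
      by_cases hk : k ∈ S
      · rw [if_pos hk, if_pos hk, ← ih (Function.update β k (formAction T (β k)))]
        congr 1
        funext j
        by_cases hj : j = k
        · subst hj; simp [hk]
        · simp [hj]
      · rw [if_neg hk, if_neg hk, hT, hC, ← wedgeTwoForms_comp_perm _ (Equiv.swap a k)]
        congr 1
        funext j
        by_cases hja : j = a
        · subst hja; simp
        · by_cases hjk : j = k
          · subst hjk
            simp [ha, hk, Ne.symm hja, hja]
          · simp [Equiv.swap_apply_of_ne_of_ne hja hjk, hjk, hja]
    rw [Finset.sum_congr rfl fun k _ => hin k, Finset.sum_ite, Finset.sum_const_zero, zero_add,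
      Finset.sum_const, nsmul_eq_mul] at key
    refine (mul_eq_zero.1 key.symm).resolve_left ?_
    -- The multiplicity of C is the number of slots outside `S`, and `a` is one of them.
    exact Nat.cast_ne_zero.2 (Finset.card_ne_zero.2 ⟨a, by simp [ha]⟩)

/-- The witness is the product of the forms ξ_{2k} ∧ ξ_{2k+1} of the dual basis. -/
theorem exists_wedgeTwoForms_ne_zero (e : Module.Basis (Fin (2 * m)) ℝ V) :
    ∃ β : Fin m → V [⋀^Fin 2]→L[ℝ] ℝ, wedgeTwoForms β e ≠ 0 := by
  let ξ : Fin (2 * m) → V →L[ℝ] ℝ := fun i => LinearMap.toContinuousLinearMap (e.coord i)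
  let A : Fin m → V →L[ℝ] V →L[ℝ] ℝ := fun k =>
    (ξ (pairEquiv m (k, 0))).smulRight (ξ (pairEquiv m (k, 1)))
  have hξ : ∀ i j, ξ i (e j) = if j = i then 1 else 0 := by
    intro i j
    simp [ξ, Finsupp.single_apply]
  refine ⟨fun k => skewForm (A k), ?_⟩
  have h1 := altSum_antisymm (fun (k : Fin m) i j =>
    (if i = pairEquiv m (k, 0) then (1 : ℝ) else 0) *
      (if j = pairEquiv m (k, 1) then (1 : ℝ) else 0)) Finset.univ
  rw [altSum_one] at h1
  rw [wedgeTwoForms_eq_altSum]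
  have h2 : (fun (k : Fin m) i j => skewForm (A k) ![e i, e j]) = fun (k : Fin m) i j =>
      if k ∈ Finset.univ then
        (if i = pairEquiv m (k, 0) then (1 : ℝ) else 0) *
          (if j = pairEquiv m (k, 1) then (1 : ℝ) else 0) -
        (if j = pairEquiv m (k, 0) then (1 : ℝ) else 0) *
          (if i = pairEquiv m (k, 1) then (1 : ℝ) else 0)
      else (if i = pairEquiv m (k, 0) then (1 : ℝ) else 0) *
          (if j = pairEquiv m (k, 1) then (1 : ℝ) else 0) := by
    funext k i j
    rw [skewForm_apply, if_pos (Finset.mem_univ k)]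
    simp only [A, ContinuousLinearMap.smulRight_apply, _root_.smul_apply, smul_eq_mul,
      hξ]
  rw [h2, h1]
  positivity

/-- The top power of a nondegenerate two-form does not vanish. -/
theorem topPower_ne_zero (e : Module.Basis (Fin (2 * m)) ℝ V)
    {w : V [⋀^Fin 2]→L[ℝ] ℝ} (hw : ∀ v, (∀ u, w ![v, u] = 0) → v = 0) : topPower m w e ≠ 0 := by
  intro h0
  obtain ⟨β, hβ⟩ := exists_wedgeTwoForms_ne_zero e
  apply hβ
  simpa using wedgeTwoForms_eq_zero_of_topPower e hw h0 Finset.univ β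

end Nonvanishing

/-! ### Cartan's formula and divergence in a vector space -/

section LocalCalculus

variable {V : Type*} [NormedAddCommGroup V] [NormedSpace ℝ V] {m : ℕ}

/-- One-forms as covectors. -/
def covectorCLE (V : Type*) [NormedAddCommGroup V] [NormedSpace ℝ V] :
    (V →L[ℝ] ℝ) ≃L[ℝ] (V [⋀^Fin 1]→L[ℝ] ℝ) :=
  (ContinuousAlternatingMap.ofSubsingletonLIE (𝕜 := ℝ) (E := V) (F := ℝ)
    (0 : Fin 1)).toContinuousLinearEquiv

@[simp]
theorem covectorCLE_apply (a : V →L[ℝ] ℝ) (v : Fin 1 → V) : covectorCLE V a v = a (v 0) := rfl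

@[simp]
theorem covectorCLE_symm_apply (a : V [⋀^Fin 1]→L[ℝ] ℝ) (v : V) :
    (covectorCLE V).symm a v = a ![v] := by
  obtain ⟨b, rfl⟩ := (covectorCLE V).surjective a
  simp

/-- Two-forms as continuous bilinear maps. -/
def bilinCLM (V : Type*) [NormedAddCommGroup V] [NormedSpace ℝ V] :
    (V [⋀^Fin 2]→L[ℝ] ℝ) →L[ℝ] (V →L[ℝ] V →L[ℝ] ℝ) :=
  ((ContinuousLinearMap.compL ℝ V (V [⋀^Fin 1]→L[ℝ] ℝ) (V →L[ℝ] ℝ))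
    (covectorCLE V).symm.toContinuousLinearMap) ∘L
  (ContinuousAlternatingMap.curryLeftLI (𝕜 := ℝ) (E := V) (F := ℝ) (n := 1)).toContinuousLinearMap

@[simp]
theorem bilinCLM_apply (w : V [⋀^Fin 2]→L[ℝ] ℝ) (u v : V) : bilinCLM V w u v = w ![u, v] := by
  simp [bilinCLM]

theorem contDiff_bilinCLM {n : WithTop ℕ∞} : ContDiff ℝ n (fun w => bilinCLM V w) := by
  exact ContinuousLinearMap.contDiff _

theorem contDiff_wedgeTwoForms {n : WithTop ℕ∞} (v : Fin (2 * m) → V) :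
    ContDiff ℝ n (fun β : Fin m → V [⋀^Fin 2]→L[ℝ] ℝ => wedgeTwoForms β v) := by
  unfold wedgeTwoForms
  simp only [← bilinCLM_apply]
  refine contDiff_const.mul
    (ContDiff.sum fun σ _ => contDiff_const.mul (contDiff_prod fun k _ => ?_))
  fun_prop

theorem contDiff_topPower {n : WithTop ℕ∞} (v : Fin (2 * m) → V) :
    ContDiff ℝ n (fun w : V [⋀^Fin 2]→L[ℝ] ℝ => topPower m w v) :=
  (contDiff_wedgeTwoForms v).comp (contDiff_pi.2 fun _ => contDiff_id)

theorem contDiff_wedgePower {n : WithTop ℕ∞} (v : Fin (2 * m) → V) :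
    ContDiff ℝ n (fun q : (V [⋀^Fin 2]→L[ℝ] ℝ) × (V [⋀^Fin 2]→L[ℝ] ℝ) =>
      wedgePower m q.1 q.2 v) := by
  refine (contDiff_wedgeTwoForms v).comp (contDiff_pi.2 fun k => ?_)
  by_cases h : (k : ℕ) = 0
  · simpa [h] using contDiff_fst
  · simpa [h] using contDiff_snd

theorem isInvertible_bilinCLM [FiniteDimensional ℝ V] {w : V [⋀^Fin 2]→L[ℝ] ℝ}
    (hw : ∀ v, (∀ u, w ![v, u] = 0) → v = 0) : (bilinCLM V w).IsInvertible := by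
  have hinj : Function.Injective (bilinCLM V w : V →ₗ[ℝ] (V →L[ℝ] ℝ)) := by
    rw [← LinearMap.ker_eq_bot, LinearMap.ker_eq_bot']
    intro v hv
    exact hw v fun u => by simpa using congrArg (fun f : V →L[ℝ] ℝ => f u) hv
  have hfin : Module.finrank ℝ V = Module.finrank ℝ (V →L[ℝ] ℝ) := by
    rw [← (LinearMap.toContinuousLinearMap : (V →ₗ[ℝ] ℝ) ≃ₗ[ℝ] (V →L[ℝ] ℝ)).finrank_eq]
    exact (Subspace.dual_finrank_eq (K := ℝ) (V := V)).symm
  exact ⟨(LinearEquiv.ofInjectiveOfFinrankEq _ hinj hfin).toContinuousLinearEquiv, by ext; rfl⟩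

/-- The vector dual to a covector by a nondegenerate two-form. -/
def raise (w : V [⋀^Fin 2]→L[ℝ] ℝ) (a : V →L[ℝ] ℝ) : V := (bilinCLM V w).inverse a

theorem raise_spec [FiniteDimensional ℝ V] {w : V [⋀^Fin 2]→L[ℝ] ℝ}
    (hw : ∀ v, (∀ u, w ![v, u] = 0) → v = 0) (a : V →L[ℝ] ℝ) (u : V) :
    w ![raise w a, u] = a u := by
  rw [← bilinCLM_apply, raise, (isInvertible_bilinCLM hw).self_apply_inverse]

theorem eq_raise [FiniteDimensional ℝ V] {w : V [⋀^Fin 2]→L[ℝ] ℝ}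
    (hw : ∀ v, (∀ u, w ![v, u] = 0) → v = 0) {a : V →L[ℝ] ℝ} {v : V}
    (h : ∀ u, w ![v, u] = a u) : v = raise w a := by
  rw [← sub_eq_zero]
  refine hw _ fun u => ?_
  rw [← bilinCLM_apply, map_sub]
  simp [h, raise_spec hw]

/-- Inversion of linear maps is smooth near invertible ones. This is the source of the smoothness of
Hamiltonian fields, which `sgrad` defines by a pointwise choice. -/
theorem contDiffAt_raise [FiniteDimensional ℝ V] {n : WithTop ℕ∞}
    {w : V [⋀^Fin 2]→L[ℝ] ℝ} (hw : ∀ v, (∀ u, w ![v, u] = 0) → v = 0) (a : V →L[ℝ] ℝ) :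
    ContDiffAt ℝ n (fun q : (V [⋀^Fin 2]→L[ℝ] ℝ) × (V →L[ℝ] ℝ) => raise q.1 q.2) (w, a) := by
  have : CompleteSpace V := FiniteDimensional.complete ℝ V
  obtain ⟨e, he⟩ := isInvertible_bilinCLM hw
  have h1 : ContDiffAt ℝ n (ContinuousLinearMap.inverse (R := ℝ) (M := V) (M₂ := V →L[ℝ] ℝ))
      (bilinCLM V w) := by
    rw [← he]
    exact contDiffAt_map_inverse (𝕜 := ℝ) (E := V) (F := V →L[ℝ] ℝ) e
  have h2 : ContDiffAt ℝ n (fun q : (V [⋀^Fin 2]→L[ℝ] ℝ) × (V →L[ℝ] ℝ) => bilinCLM V q.1)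
      (w, a) := (contDiff_bilinCLM.comp contDiff_fst).contDiffAt
  have h3 : ContDiffAt ℝ n (fun q : (V [⋀^Fin 2]→L[ℝ] ℝ) × (V →L[ℝ] ℝ) =>
      ContinuousLinearMap.inverse (bilinCLM V q.1)) (w, a) :=
    ContDiffAt.comp (𝕜 := ℝ) (x := (w, a)) (g := ContinuousLinearMap.inverse)
      (f := fun q : (V [⋀^Fin 2]→L[ℝ] ℝ) × (V →L[ℝ] ℝ) => bilinCLM V q.1) h1 h2
  exact h3.clm_apply contDiffAt_snd

/-- Cartan's formula for a closed two-form: `d(i_X Θ) = L_X Θ`. -/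
theorem extDeriv_contraction {Θ : V → V [⋀^Fin 2]→L[ℝ] ℝ} {X : V → V}
    {α : V → V [⋀^Fin 1]→L[ℝ] ℝ} {y : V} (hΘ : DifferentiableAt ℝ Θ y)
    (hX : DifferentiableAt ℝ X y) (hα : DifferentiableAt ℝ α y)
    (hαX : ∀ᶠ z in 𝓝 y, ∀ u, α z ![u] = Θ z ![X z, u]) (hclosed : extDeriv Θ y = 0) :
    extDeriv α y = fderiv ℝ Θ y (X y) + formAction (fderiv ℝ X y) (Θ y) := by
  -- The product rule for Θ(X, v) with v constant.
  have hd : ∀ u v, fderiv ℝ (fun z => α z ![v]) y u =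
      fderiv ℝ Θ y u ![X y, v] + Θ y ![fderiv ℝ X y u, v] := by
    intro u v
    let G : Fin 2 → V → V := fun i z => if i = 0 then X z else v
    have hG : ∀ i, DifferentiableAt ℝ (G i) y := by
      intro i; fin_cases i
      · simpa [G] using hX
      · simp [G]
    have hGz : ∀ z, (fun i => G i z) = ![X z, v] := by
      intro z; funext i; fin_cases i <;> simp [G]
    have h1 : (fun z => α z ![v]) =ᶠ[𝓝 y] fun z => Θ z (fun i => G i z) := by
      filter_upwards [hαX] with z hz
      rw [hz, hGz]
    have hG0 : G 0 = X := rfl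
    have hG1 : G 1 = fun _ => v := rfl
    rw [h1.fderiv_eq, fderiv_continuousAlternatingMap_apply_apply hΘ hG, hGz, Fin.sum_univ_two,
      update_vec_zero, update_vec_one, hG0, hG1]
    have : Θ y ![X y, (0 : V)] = 0 := by rw [← toBilin_apply, map_zero]
    simp [this]
  -- Closedness evaluated on (X, u, v) trades the derivative along X for derivatives along u and v.
  have hd2 : ∀ u v, fderiv ℝ Θ y (X y) ![u, v] =
      fderiv ℝ Θ y u ![X y, v] - fderiv ℝ Θ y v ![X y, u] := by
    intro u v
    have h := congrArg (fun f => f ![X y, u, v]) hclosed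
    simp only [extDeriv, ContinuousAlternatingMap.alternatizeUncurryFin_apply] at h
    rw [Fin.sum_univ_three] at h
    have e0 : Fin.removeNth 0 ![X y, u, v] = ![u, v] := by
      funext i; fin_cases i <;> rfl
    have e1 : Fin.removeNth 1 ![X y, u, v] = ![X y, v] := by
      funext i; fin_cases i <;> rfl
    have e2 : Fin.removeNth 2 ![X y, u, v] = ![X y, u] := by
      funext i; fin_cases i <;> rfl
    rw [e0, e1, e2] at h
    simp at h
    linarith
  ext v
  have hv : v = ![v 0, v 1] := by funext i; fin_cases i <;> rfl
  rw [hv, extDeriv_apply hα, Fin.sum_univ_two, ContinuousAlternatingMap.add_apply, formAction_apply]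
  generalize v 0 = a
  generalize v 1 = b
  have e0 : Fin.removeNth 0 ![a, b] = ![b] := by
    funext i; fin_cases i; rfl
  have e1 : Fin.removeNth 1 ![a, b] = ![a] := by
    funext i; fin_cases i; rfl
  rw [e0, e1]
  simp only [Matrix.cons_val_zero, Matrix.cons_val_one]
  rw [hd, hd, hd2, twoForm_swap (Θ y) a]
  simp
  ring

theorem hasDerivAt_twoForm_line {Θ : V → V [⋀^Fin 2]→L[ℝ] ℝ} {y : V}
    (hΘ : DifferentiableAt ℝ Θ y) (Y u v : V) :
    HasDerivAt (fun s : ℝ => Θ (y + s • Y) ![u, v]) (fderiv ℝ Θ y Y ![u, v]) 0 := by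
  have h1 : HasDerivAt (fun s : ℝ => y + s • Y) Y 0 := by
    simpa using ((hasDerivAt_id (0 : ℝ)).smul_const Y).const_add y
  have h2 : HasFDerivAt Θ (fderiv ℝ Θ y) (y + (0 : ℝ) • Y) := by simpa using hΘ.hasFDerivAt
  have h3 := (h2.continuousAlternatingMap_apply_const ![u, v]).comp_hasDerivAt (0 : ℝ) h1
  exact h3

theorem differentiableAt_topPower {Θ : V → V [⋀^Fin 2]→L[ℝ] ℝ} {y : V}
    (hΘ : DifferentiableAt ℝ Θ y) (e : Fin (2 * m) → V) :
    DifferentiableAt ℝ (fun z => topPower m (Θ z) e) y :=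
  ((contDiff_topPower (n := 1) e).differentiable one_ne_zero (Θ y)).comp y hΘ

theorem fderiv_topPower {Θ : V → V [⋀^Fin 2]→L[ℝ] ℝ} {y : V}
    (hΘ : DifferentiableAt ℝ Θ y) (e : Fin (2 * m) → V) (Y : V) :
    fderiv ℝ (fun z => topPower m (Θ z) e) y Y =
      ∑ k, wedgeTwoForms (Function.update (fun _ : Fin m => Θ y) k (fderiv ℝ Θ y Y)) e := by
  have h1 : HasDerivAt (fun s : ℝ => y + s • Y) Y 0 := by
    simpa using ((hasDerivAt_id (0 : ℝ)).smul_const Y).const_add y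
  have h2 : HasFDerivAt (fun z => topPower m (Θ z) e) (fderiv ℝ (fun z => topPower m (Θ z) e) y)
      (y + (0 : ℝ) • Y) := by simpa using (differentiableAt_topPower hΘ e).hasFDerivAt
  have h3 := h2.comp_hasDerivAt (0 : ℝ) h1
  have h4 := hasDerivAt_wedgeTwoForms (β := fun s _ => Θ (y + s • Y)) (v := fun _ => e)
    (β' := fun _ : Fin m => fderiv ℝ Θ y Y) (t := 0)
    (fun k i j => hasDerivAt_twoForm_line hΘ Y (e i) (e j))
  simpa using h3.unique h4

variable [FiniteDimensional ℝ V]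

/-- The divergence of `X` with respect to the volume density of a closed two-form `Θ` is
`m d(i_X Θ) ∧ Θ^{m-1} / Θ^m`. -/
theorem divergence_topPower (hm : 1 ≤ m) (e : Module.Basis (Fin (2 * m)) ℝ V)
    {Θ : V → V [⋀^Fin 2]→L[ℝ] ℝ} {X : V → V}
    {α : V → V [⋀^Fin 1]→L[ℝ] ℝ} {y : V} (hΘ : DifferentiableAt ℝ Θ y)
    (hX : DifferentiableAt ℝ X y) (hα : DifferentiableAt ℝ α y)
    (hαX : ∀ᶠ z in 𝓝 y, ∀ u, α z ![u] = Θ z ![X z, u]) (hclosed : extDeriv Θ y = 0) :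
    LinearMap.trace ℝ V (fderiv ℝ X y) * topPower m (Θ y) e +
      fderiv ℝ (fun z => topPower m (Θ z) e) y (X y) =
    m * wedgePower m (extDeriv α y) (Θ y) e := by
  rw [extDeriv_contraction hΘ hX hα hαX hclosed, fderiv_topPower hΘ,
    ← sum_wedgeTwoForms_update_const hm]
  have := wedgeTwoForms_variation e (fderiv ℝ X y) (β := fun s _ => Θ (y + s • X y))
    (β' := fun _ : Fin m => fderiv ℝ Θ y (X y))
    (fun k u v => hasDerivAt_twoForm_line hΘ (X y) u v)
  simpa [topPower] using this

/-- The logarithmic derivative of the top power of a two-form. -/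
theorem fderiv_topPower_eq_trace_mul (e : Module.Basis (Fin (2 * m)) ℝ V)
    {Θ : V → V [⋀^Fin 2]→L[ℝ] ℝ} {y : V} (hΘ : DifferentiableAt ℝ Θ y) {Y : V} {T : V →L[ℝ] V}
    (hT : formAction T (Θ y) = fderiv ℝ Θ y Y) :
    fderiv ℝ (fun z => topPower m (Θ z) e) y Y = LinearMap.trace ℝ V T * topPower m (Θ y) e := by
  rw [fderiv_topPower hΘ]
  have := wedgeTwoForms_variation e T (β := fun _ _ => Θ y)
    (β' := fun _ : Fin m => 0) (fun k u v => hasDerivAt_const _ _)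
  have hz : ∀ k, wedgeTwoForms (Function.update (fun _ : Fin m => Θ y) k 0) e = 0 :=
      fun k => wedgeTwoForms_eq_zero_of_slot (k := k) (Function.update_self _ _ _) _
  simp only [hz, Finset.sum_const_zero, add_zero, zero_add, hT] at this
  exact this.symm

end LocalCalculus

/-! ### Forms, functions and Hamiltonian fields in charts -/

section Charts

variable {m : ℕ} {M : Type*} [TopologicalSpace M] [ChartedSpace (Model m) M]

/-- The derivative of the inverse chart, as an endomorphism of the model space. -/
abbrev invD (x : M) (y : Model m) : Model m →L[ℝ] Model m :=
  mfderiv 𝓘(ℝ, Model m) 𝓘(ℝ, Model m) (chartAt (Model m) x).symm y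

/-- The derivative of the chart, as an endomorphism of the model space. -/
abbrev chartD (x p : M) : Model m →L[ℝ] Model m :=
  mfderiv 𝓘(ℝ, Model m) 𝓘(ℝ, Model m) (chartAt (Model m) x) p

/-- The change of coordinates between the charts at `x` and at `z`. -/
def transition (x z : M) (y : Model m) : Model m :=
  chartAt (Model m) z ((chartAt (Model m) x).symm y)

theorem chartRep_eq_of_symm_eq {k : ℕ} (α : ∀ p : M, TM m p [⋀^Fin k]→L[ℝ] ℝ) (x : M)
    {y : Model m} {p : M} (h : (chartAt (Model m) x).symm y = p) :
    chartRep α x y =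
      ContinuousAlternatingMap.compContinuousLinearMap (M' := Model m) (α p) (invD x y) := by
  subst h; rfl

theorem chartRep_apply {k : ℕ} (α : ∀ p : M, TM m p [⋀^Fin k]→L[ℝ] ℝ) (x : M)
    (y : Model m) (v : Fin k → Model m) :
    chartRep α x y v = α ((chartAt (Model m) x).symm y) (fun i => invD x y (v i)) := rfl

theorem chartRep_two_apply (α : ∀ p : M, TM m p [⋀^Fin 2]→L[ℝ] ℝ) (x : M)
    (y u v : Model m) :
    chartRep α x y ![u, v] = α ((chartAt (Model m) x).symm y) ![invD x y u, invD x y v] :=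
  compContinuousLinearMap_vec (V := Model m) (W := Model m) _ _ u v

theorem symm_transition {x z : M} {y : Model m}
    (hz : (chartAt (Model m) x).symm y ∈ (chartAt (Model m) z).source) :
    (chartAt (Model m) z).symm (transition x z y) = (chartAt (Model m) x).symm y :=
  (chartAt (Model m) z).left_inv hz

theorem eventually_mem_chart {x z : M} {y : Model m} (hy : y ∈ (chartAt (Model m) x).target)
    (hz : (chartAt (Model m) x).symm y ∈ (chartAt (Model m) z).source) :
    ∀ᶠ y' in 𝓝 y, y' ∈ (chartAt (Model m) x).target ∧
      (chartAt (Model m) x).symm y' ∈ (chartAt (Model m) z).source :=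
  ((chartAt (Model m) x).open_target.mem_nhds hy |> Filter.eventually_mem_set.2).and
    (((chartAt (Model m) x).continuousAt_symm hy).eventually
      ((chartAt (Model m) z).open_source.mem_nhds hz))

theorem IsSmoothForm.contDiffAt {k : ℕ} {α : ∀ p : M, TM m p [⋀^Fin k]→L[ℝ] ℝ}
    (hα : IsSmoothForm α) {x : M} {y : Model m} (hy : y ∈ (chartAt (Model m) x).target) :
    ContDiffAt ℝ ∞ (chartRep α x) y :=
  (hα x).contDiffAt ((chartAt (Model m) x).open_target.mem_nhds hy)

theorem SmoothFun.mdifferentiableAt {F : M → ℝ} (hF : SmoothFun m F) (p : M) :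
    MDifferentiableAt 𝓘(ℝ, Model m) 𝓘(ℝ, ℝ) F p :=
  (hF p).mdifferentiableAt (by norm_num)

theorem poisson_eq (Ω : SymplecticForm m M) (F G : M → ℝ) (p : M) :
    poisson Ω F G p = dFun F p (sgrad Ω G p) :=
  sgrad_spec Ω F p _

theorem poisson_antisymm (Ω : SymplecticForm m M) (F G : M → ℝ) (p : M) :
    poisson Ω F G p = -poisson Ω G F p :=
  twoForm_swap (V := Model m) (Ω.form p) _ _

variable [IsManifold 𝓘(ℝ, Model m) ∞ M]

theorem invD_comp_chartD {x p : M} (hp : p ∈ (chartAt (Model m) x).source) :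
    invD x (chartAt (Model m) x p) ∘L chartD x p = ContinuousLinearMap.id ℝ (Model m) := by
  have : IsManifold 𝓘(ℝ, Model m) 1 M := IsManifold.of_le (n := ∞) (by norm_num)
  exact (mdifferentiable_chart (I := 𝓘(ℝ, Model m)) x).symm_comp_deriv hp

theorem chartD_comp_invD {x : M} {y : Model m} (hy : y ∈ (chartAt (Model m) x).target) :
    chartD x ((chartAt (Model m) x).symm y) ∘L invD x y = ContinuousLinearMap.id ℝ (Model m) := by
  have : IsManifold 𝓘(ℝ, Model m) 1 M := IsManifold.of_le (n := ∞) (by norm_num)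
  exact (mdifferentiable_chart (I := 𝓘(ℝ, Model m)) x).comp_symm_deriv hy

theorem invD_chartD_apply {x : M} {y : Model m} (hy : y ∈ (chartAt (Model m) x).target)
    (u : Model m) : invD x y (chartD x ((chartAt (Model m) x).symm y) u) = u := by
  have h := invD_comp_chartD ((chartAt (Model m) x).map_target hy)
  rw [(chartAt (Model m) x).right_inv hy] at h
  exact congrArg (fun f : Model m →L[ℝ] Model m => f u) h

theorem chartD_invD_apply {x : M} {y : Model m} (hy : y ∈ (chartAt (Model m) x).target)
    (u : Model m) : chartD x ((chartAt (Model m) x).symm y) (invD x y u) = u :=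
  congrArg (fun f : Model m →L[ℝ] Model m => f u) (chartD_comp_invD hy)

theorem contMDiffAt_symm {x : M} {y : Model m} (hy : y ∈ (chartAt (Model m) x).target) :
    ContMDiffAt 𝓘(ℝ, Model m) 𝓘(ℝ, Model m) ∞ (chartAt (Model m) x).symm y :=
  (contMDiffOn_chart_symm (x := x)).contMDiffAt ((chartAt (Model m) x).open_target.mem_nhds hy)

theorem contMDiffAt_chart {x p : M} (hp : p ∈ (chartAt (Model m) x).source) :
    ContMDiffAt 𝓘(ℝ, Model m) 𝓘(ℝ, Model m) ∞ (chartAt (Model m) x) p :=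
  (contMDiffOn_chart (x := x)).contMDiffAt ((chartAt (Model m) x).open_source.mem_nhds hp)

theorem contDiffAt_transition {x z : M} {y : Model m} (hy : y ∈ (chartAt (Model m) x).target)
    (hz : (chartAt (Model m) x).symm y ∈ (chartAt (Model m) z).source) :
    ContDiffAt ℝ ∞ (transition x z) y :=
  contMDiffAt_iff_contDiffAt.1 ((contMDiffAt_chart hz).comp y (contMDiffAt_symm hy))

theorem fderiv_transition {x z : M} {y : Model m} (hy : y ∈ (chartAt (Model m) x).target)
    (hz : (chartAt (Model m) x).symm y ∈ (chartAt (Model m) z).source) :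
    fderiv ℝ (transition x z) y = chartD z ((chartAt (Model m) x).symm y) ∘L invD x y := by
  rw [← mfderiv_eq_fderiv]
  exact mfderiv_comp y ((contMDiffAt_chart hz).mdifferentiableAt (by norm_num))
    ((contMDiffAt_symm hy).mdifferentiableAt (by norm_num))

theorem invD_comp_fderiv_transition {x z : M} {y : Model m}
    (hy : y ∈ (chartAt (Model m) x).target)
    (hz : (chartAt (Model m) x).symm y ∈ (chartAt (Model m) z).source) :
    invD z (transition x z y) ∘L fderiv ℝ (transition x z) y = invD x y := by
  rw [fderiv_transition hy hz, ← ContinuousLinearMap.comp_assoc]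
  have := invD_comp_chartD hz
  unfold transition
  rw [this, ContinuousLinearMap.id_comp]

theorem chartRep_transition {k : ℕ} (α : ∀ p : M, TM m p [⋀^Fin k]→L[ℝ] ℝ) {x z : M} {y : Model m}
    (hy : y ∈ (chartAt (Model m) x).target)
    (hz : (chartAt (Model m) x).symm y ∈ (chartAt (Model m) z).source) :
    chartRep α x y = (chartRep α z (transition x z y)).compContinuousLinearMap
      (fderiv ℝ (transition x z) y) := by
  rw [chartRep_eq_of_symm_eq α x rfl, chartRep_eq_of_symm_eq α z (symm_transition hz),
    ← invD_comp_fderiv_transition hy hz]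
  rfl

/-- The exterior derivative is computed in any chart. -/
theorem extDeriv_chartRep {k : ℕ} {α : ∀ p : M, TM m p [⋀^Fin k]→L[ℝ] ℝ}
    (hα : IsSmoothForm α) {x : M} {y : Model m} (hy : y ∈ (chartAt (Model m) x).target) :
    extDeriv (chartRep α x) y = chartRep (extD α) x y := by
  set p := (chartAt (Model m) x).symm y with hp
  have hz : (chartAt (Model m) x).symm y ∈ (chartAt (Model m) p).source := mem_chart_source _ _
  -- `extD` at p uses the chart at p; the two representatives differ by pullback along the
  -- transition map, with which d commutes.
  have h1 : chartRep α x =ᶠ[𝓝 y] fun y' => (chartRep α p (transition x p y')).compContinuousLinearMap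
      (fderiv ℝ (transition x p) y') := by
    filter_upwards [eventually_mem_chart hy hz] with y' hy'
    exact chartRep_transition α hy'.1 hy'.2
  rw [h1.extDeriv_eq, extDeriv_pullback (r := ∞) _ (contDiffAt_transition hy hz)
    (by rw [minSmoothness_of_isRCLikeNormedField]; exact WithTop.coe_le_coe.2 le_top),
    fderiv_transition hy hz]
  · rfl
  · exact (hα.contDiffAt ((chartAt (Model m) p).map_source hz)).differentiableAt (by norm_num)

theorem SmoothFun.contDiffAt {F : M → ℝ} (hF : SmoothFun m F) {x : M} {y : Model m}
    (hy : y ∈ (chartAt (Model m) x).target) :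
    ContDiffAt ℝ ∞ (F ∘ (chartAt (Model m) x).symm) y :=
  contMDiffAt_iff_contDiffAt.1 ((hF _).comp y (contMDiffAt_symm hy))

theorem smoothFun_of_contDiffAt {F : M → ℝ}
    (h : ∀ (x : M), ∀ y ∈ (chartAt (Model m) x).target,
      ContDiffAt ℝ ∞ (F ∘ (chartAt (Model m) x).symm) y) : SmoothFun m F := by
  intro p
  have h1 := (h p _ (mem_chart_target (Model m) p)).contMDiffAt
  have h2 := h1.comp p (contMDiffAt_chart (mem_chart_source (Model m) p))
  refine h2.congr_of_eventuallyEq ?_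
  filter_upwards [(chartAt (Model m) p).open_source.mem_nhds (mem_chart_source (Model m) p)]
    with q hq
  simp [(chartAt (Model m) p).left_inv hq]

theorem dFun_invD {F : M → ℝ} {x : M} {y : Model m} (hy : y ∈ (chartAt (Model m) x).target)
    (hF : MDifferentiableAt 𝓘(ℝ, Model m) 𝓘(ℝ, ℝ) F ((chartAt (Model m) x).symm y))
    (u : Model m) :
    dFun F ((chartAt (Model m) x).symm y) (invD x y u) =
      fderiv ℝ (F ∘ (chartAt (Model m) x).symm) y u := by
  rw [← mfderiv_eq_fderiv,
    mfderiv_comp y hF ((contMDiffAt_symm hy).mdifferentiableAt (by norm_num))]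
  rfl

variable (Ω : SymplecticForm m M)

theorem nondegenerate_chartRep {x : M} {y : Model m} (hy : y ∈ (chartAt (Model m) x).target)
    (v : Model m) (h : ∀ u, chartRep Ω.form x y ![v, u] = 0) : v = 0 := by
  have h1 : invD x y v = 0 := by
    refine Ω.nondegenerate ((chartAt (Model m) x).symm y) (invD x y v) fun (w : Model m) => ?_
    rw [← invD_chartD_apply hy w]
    exact (chartRep_two_apply Ω.form x y v _).symm.trans (h _)
  have h2 := chartD_invD_apply hy v
  rw [h1, map_zero] at h2
  exact h2.symm

/-- The vector field dual to a one-form, in coordinates. -/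
def chartRaise (x : M) (a : Model m → (Model m →L[ℝ] ℝ)) (y : Model m) : Model m :=
  raise (chartRep Ω.form x y) (a y)

theorem contDiffAt_chartRaise {x : M} {y : Model m} (hy : y ∈ (chartAt (Model m) x).target)
    {a : Model m → (Model m →L[ℝ] ℝ)} (ha : ContDiffAt ℝ ∞ a y) :
    ContDiffAt ℝ ∞ (chartRaise Ω x a) y :=
  ContDiffAt.comp (𝕜 := ℝ) (x := y)
    (g := fun q : (Model m [⋀^Fin 2]→L[ℝ] ℝ) × (Model m →L[ℝ] ℝ) => raise q.1 q.2)
    (f := fun y => (chartRep Ω.form x y, a y))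
    (contDiffAt_raise (nondegenerate_chartRep Ω hy) (a y))
    ((Ω.smooth.contDiffAt hy).prodMk ha)

theorem chartRaise_spec {x : M} {y : Model m} (hy : y ∈ (chartAt (Model m) x).target)
    (a : Model m → (Model m →L[ℝ] ℝ)) (u : Model m) :
    chartRep Ω.form x y ![chartRaise Ω x a y, u] = a y u :=
  raise_spec (nondegenerate_chartRep Ω hy) _ _

/-- The Hamiltonian vector field in coordinates. -/
def chartSgrad (x : M) (F : M → ℝ) : Model m → Model m :=
  chartRaise Ω x (fderiv ℝ (F ∘ (chartAt (Model m) x).symm))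

theorem contDiffAt_chartSgrad {F : M → ℝ} (hF : SmoothFun m F) {x : M} {y : Model m}
    (hy : y ∈ (chartAt (Model m) x).target) : ContDiffAt ℝ ∞ (chartSgrad Ω x F) y :=
  contDiffAt_chartRaise Ω hy ((hF.contDiffAt hy).fderiv_right (by norm_num))

/-- Nondegeneracy makes the contraction unique, so the chosen `sgrad` agrees with the explicit
solution in coordinates. All regularity of `sgrad` passes through this identity. -/
theorem invD_chartSgrad {F : M → ℝ} {x : M} {y : Model m}
    (hy : y ∈ (chartAt (Model m) x).target)
    (hF : MDifferentiableAt 𝓘(ℝ, Model m) 𝓘(ℝ, ℝ) F ((chartAt (Model m) x).symm y)) :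
    invD x y (chartSgrad Ω x F y) = sgrad Ω F ((chartAt (Model m) x).symm y) := by
  set p := (chartAt (Model m) x).symm y with hp
  let v : Model m := sgrad Ω F p
  suffices h : chartD x p v = chartSgrad Ω x F y by
    rw [← h]
    exact invD_chartD_apply hy v
  refine eq_raise (nondegenerate_chartRep Ω hy) fun u => ?_
  rw [chartRep_two_apply, invD_chartD_apply hy]
  exact (sgrad_spec Ω F p _).trans (dFun_invD hy hF u)

theorem poisson_comp_symm {F G : M → ℝ} (hF : SmoothFun m F) (hG : SmoothFun m G) {x : M}
    {y : Model m} (hy : y ∈ (chartAt (Model m) x).target) :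
    poisson Ω F G ((chartAt (Model m) x).symm y) =
      fderiv ℝ (F ∘ (chartAt (Model m) x).symm) y (chartSgrad Ω x G y) := by
  rw [poisson_eq, ← invD_chartSgrad Ω hy (hG.mdifferentiableAt _),
    dFun_invD hy (hF.mdifferentiableAt _)]

theorem SmoothFun.poisson {F G : M → ℝ} (hF : SmoothFun m F) (hG : SmoothFun m G) :
    SmoothFun m (poisson Ω F G) := by
  refine smoothFun_of_contDiffAt fun x y hy => ?_
  have h1 : ContDiffAt ℝ ∞ (fun y => fderiv ℝ (F ∘ (chartAt (Model m) x).symm) y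
      (chartSgrad Ω x G y)) y :=
    ((hF.contDiffAt hy).fderiv_right (by norm_num)).clm_apply (contDiffAt_chartSgrad Ω hG hy)
  refine h1.congr_of_eventuallyEq ?_
  filter_upwards [(chartAt (Model m) x).open_target.mem_nhds hy] with y' hy'
  exact poisson_comp_symm Ω hF hG hy'

end Charts

/-! ### The coordinate density of ω^m -/

section Density

variable {m : ℕ} {M : Type*} [TopologicalSpace M] [ChartedSpace (Model m) M]
  (Ω : SymplecticForm m M)

/-- The density of `Ω^m` in coordinates. -/
def chartDensity (x : M) (y : Model m) : ℝ :=
  topPower m (chartRep Ω.form x y) (stdBasis m)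

theorem contDiffAt_chartDensity {x : M} {y : Model m} (hy : y ∈ (chartAt (Model m) x).target) :
    ContDiffAt ℝ ∞ (chartDensity Ω x) y :=
  ContDiffAt.comp (𝕜 := ℝ) (x := y) (g := fun w : Model m [⋀^Fin 2]→L[ℝ] ℝ =>
    topPower m w (stdBasis m)) (f := fun y => chartRep Ω.form x y)
    (contDiff_topPower _).contDiffAt (Ω.smooth.contDiffAt hy)

end Density

/-! ### The metric, the dual one-form and the Laplacian in charts -/

section MetricCharts

variable {m : ℕ} {M : Type*} [TopologicalSpace M] [ChartedSpace (Model m) M]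
  [IsManifold 𝓘(ℝ, Model m) ∞ M]

/-- A smooth vector field in coordinates gives a smooth section of the tangent bundle. -/
theorem contMDiffOn_chartVector {x : M} {X : Model m → Model m}
    (hX : ContDiffOn ℝ ∞ X (chartAt (Model m) x).target) :
    ContMDiffOn 𝓘(ℝ, Model m) 𝓘(ℝ, Model m).tangent ∞
      (fun y => (⟨(chartAt (Model m) x).symm y, chartInvDeriv x y (X y)⟩ :
        TangentBundle 𝓘(ℝ, Model m) M)) (chartAt (Model m) x).target := by
  have ho := (chartAt (Model m) x).open_target
  have h1 := (contMDiffOn_chart_symm (I := 𝓘(ℝ, Model m)) (n := ∞)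
    (x := x)).contMDiffOn_tangentMapWithin (m := ∞) (by norm_num) ho.uniqueMDiffOn
  have h2 : ContMDiffOn 𝓘(ℝ, Model m) 𝓘(ℝ, Model m).tangent ∞
      (fun y => (⟨y, X y⟩ : TangentBundle 𝓘(ℝ, Model m) (Model m)))
      (chartAt (Model m) x).target := contMDiffOn_vectorSpace_iff_contDiffOn.2 hX
  refine (h1.comp h2 fun y hy => hy).congr fun y hy => ?_
  simp only [Function.comp_apply, tangentMapWithin]
  rw [mfderivWithin_of_isOpen ho hy]
  rfl

variable (g : Metric m M)

/-- The metric in coordinates. -/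
def chartMetric (x : M) (y : Model m) : Model m →L[ℝ] Model m →L[ℝ] ℝ :=
  let G : Model m →L[ℝ] Model m →L[ℝ] ℝ := g.inner ((chartAt (Model m) x).symm y)
  G.bilinearComp (invD x y) (invD x y)

theorem chartMetric_apply (x : M) (y u v : Model m) :
    chartMetric g x y u v =
      g.inner ((chartAt (Model m) x).symm y) (chartInvDeriv x y u) (chartInvDeriv x y v) := rfl

theorem contDiffOn_chartMetric (x : M) :
    ContDiffOn ℝ ∞ (chartMetric g x) (chartAt (Model m) x).target := by
  rw [contDiffOn_clm_apply]
  intro u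
  rw [contDiffOn_clm_apply]
  intro v
  have h1 := contMDiffOn_chartVector (x := x) (X := fun _ => u) contDiffOn_const
  have h2 := contMDiffOn_chartVector (x := x) (X := fun _ => v) contDiffOn_const
  have h3 := g.contMDiff.comp_contMDiffOn (contMDiffOn_chart_symm (I := 𝓘(ℝ, Model m)) (n := ∞)
    (x := x))
  have h4 : ContMDiffOn 𝓘(ℝ, Model m) (𝓘(ℝ, Model m).prod 𝓘(ℝ, ℝ)) ∞
      (fun y => Bundle.TotalSpace.mk' ℝ (E := Bundle.Trivial M ℝ)
        ((chartAt (Model m) x).symm y) (g.inner ((chartAt (Model m) x).symm y)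
          (chartInvDeriv x y u) (chartInvDeriv x y v))) (chartAt (Model m) x).target := by
    apply ContMDiffOn.clm_bundle_apply₂ (F₁ := Model m) (F₂ := Model m)
    · exact h3
    · exact h1
    · exact h2
  intro y hy
  have h5 := h4 y hy
  rw [Bundle.contMDiffWithinAt_totalSpace] at h5
  exact contMDiffWithinAt_iff_contDiffWithinAt.1 h5.2

theorem contDiffAt_chartMetric {x : M} {y : Model m} (hy : y ∈ (chartAt (Model m) x).target) :
    ContDiffAt ℝ ∞ (chartMetric g x) y :=
  (contDiffOn_chartMetric g x).contDiffAt ((chartAt (Model m) x).open_target.mem_nhds hy)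

theorem chartMetric_symm (x : M) (y u v : Model m) :
    chartMetric g x y u v = chartMetric g x y v u := g.symm _ _ _

/-- The dual one-form of a vector field in coordinates. -/
theorem chartRep_flat {v : ∀ p : M, TM m p} {x : M} {X : Model m → Model m} {y : Model m}
    (h : invD x y (X y) = v ((chartAt (Model m) x).symm y)) :
    chartRep (flat g v) x y = covectorCLE (Model m) (chartMetric g x y (X y)) := by
  ext w
  change g.inner _ (v ((chartAt (Model m) x).symm y)) (invD x y (w 0)) = _
  rw [← h]
  rfl

variable (Ω : SymplecticForm m M)

theorem chartRep_flat_sgrad {ψ : M → ℝ} (hψ : SmoothFun m ψ) {x : M} {y : Model m}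
    (hy : y ∈ (chartAt (Model m) x).target) :
    chartRep (flat g (sgrad Ω ψ)) x y =
      covectorCLE (Model m) (chartMetric g x y (chartSgrad Ω x ψ y)) :=
  chartRep_flat g (invD_chartSgrad Ω hy (hψ.mdifferentiableAt _))

theorem isSmoothForm_flat_sgrad {ψ : M → ℝ} (hψ : SmoothFun m ψ) :
    IsSmoothForm (flat g (sgrad Ω ψ)) := by
  intro x
  have h : ContDiffOn ℝ ∞ (fun y => covectorCLE (Model m)
      (chartMetric g x y (chartSgrad Ω x ψ y))) (chartAt (Model m) x).target := by
    refine ContDiff.comp_contDiffOn (g := fun a => covectorCLE (Model m) a)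
      (covectorCLE (Model m)).contDiff ?_
    exact (contDiffOn_chartMetric g x).clm_apply
      fun y hy => (contDiffAt_chartSgrad Ω hψ hy).contDiffWithinAt
  exact h.congr fun y hy => chartRep_flat_sgrad g Ω hψ hy

/-- The ratio `β ∧ Ω^{m-1} / Ω^m`. -/
def formRatio (β : ∀ p : M, TM m p [⋀^Fin 2]→L[ℝ] ℝ) (p : M) : ℝ :=
  wedgePower m (V := Model m) (β p) (Ω.form p) (stdBasis m) /
    topPower m (V := Model m) (Ω.form p) (stdBasis m)

theorem laplacian_eq_formRatio (ψ : M → ℝ) :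
    laplacian Ω g ψ = formRatio Ω (extD (flat g (sgrad Ω ψ))) := rfl

/-- The standard basis as a basis. -/
def modelBasis (m : ℕ) : Module.Basis (Fin (2 * m)) ℝ (Model m) :=
  (EuclideanSpace.basisFun (Fin (2 * m)) ℝ).toBasis

theorem coe_modelBasis (m : ℕ) : ⇑(modelBasis m) = stdBasis m := by
  funext i
  simp [modelBasis, stdBasis]

theorem chartDensity_ne_zero {x : M} {y : Model m} (hy : y ∈ (chartAt (Model m) x).target) :
    chartDensity Ω x y ≠ 0 := by
  rw [chartDensity, ← coe_modelBasis]
  exact topPower_ne_zero _ (nondegenerate_chartRep Ω hy)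

theorem wedgeTwoForms_compContinuousLinearMap_eq_det (β : Fin m → Model m [⋀^Fin 2]→L[ℝ] ℝ)
    (A : Model m →L[ℝ] Model m) :
    wedgeTwoForms (fun k => (β k).compContinuousLinearMap A) (stdBasis m) =
      LinearMap.det (A : Model m →ₗ[ℝ] Model m) * wedgeTwoForms β (stdBasis m) := by
  rw [wedgeTwoForms_compContinuousLinearMap, ← wedgeTwoForms_comp_linearMap (modelBasis m)]
  rfl

theorem topPower_compContinuousLinearMap (w : Model m [⋀^Fin 2]→L[ℝ] ℝ)
    (A : Model m →L[ℝ] Model m) :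
    topPower m (w.compContinuousLinearMap A) (stdBasis m) =
      LinearMap.det (A : Model m →ₗ[ℝ] Model m) * topPower m w (stdBasis m) :=
  wedgeTwoForms_compContinuousLinearMap_eq_det (fun _ => w) A

theorem wedgePower_compContinuousLinearMap (β w : Model m [⋀^Fin 2]→L[ℝ] ℝ)
    (A : Model m →L[ℝ] Model m) :
    wedgePower m (β.compContinuousLinearMap A) (w.compContinuousLinearMap A) (stdBasis m) =
      LinearMap.det (A : Model m →ₗ[ℝ] Model m) * wedgePower m β w (stdBasis m) := by
  unfold wedgePower
  rw [← wedgeTwoForms_compContinuousLinearMap_eq_det]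
  congr 1
  funext k
  by_cases h : (k : ℕ) = 0 <;> simp [h]

/-- Numerator and denominator are of top degree, so both acquire the determinant of the derivative
of the inverse chart, and it cancels. -/
theorem formRatio_comp_symm (β : ∀ p : M, TM m p [⋀^Fin 2]→L[ℝ] ℝ) {x : M} {y : Model m}
    (hy : y ∈ (chartAt (Model m) x).target) :
    formRatio Ω β ((chartAt (Model m) x).symm y) =
      wedgePower m (chartRep β x y) (chartRep Ω.form x y) (stdBasis m) / chartDensity Ω x y := by
  have h0 := chartDensity_ne_zero Ω hy
  have h1 := topPower_compContinuousLinearMap (Ω.form ((chartAt (Model m) x).symm y)) (invD x y)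
  have h2 := wedgePower_compContinuousLinearMap (β ((chartAt (Model m) x).symm y))
    (Ω.form ((chartAt (Model m) x).symm y)) (invD x y)
  have h3 : chartDensity Ω x y = LinearMap.det (invD x y : Model m →ₗ[ℝ] Model m) *
    topPower m (V := Model m) (Ω.form ((chartAt (Model m) x).symm y)) (stdBasis m) := h1
  have h4 : wedgePower m (chartRep β x y) (chartRep Ω.form x y) (stdBasis m) =
    LinearMap.det (invD x y : Model m →ₗ[ℝ] Model m) * wedgePower m (V := Model m)
      (β ((chartAt (Model m) x).symm y)) (Ω.form ((chartAt (Model m) x).symm y)) (stdBasis m) := h2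
  rw [h3] at h0
  rw [h3, h4, formRatio, mul_div_mul_left _ _ (left_ne_zero_of_mul h0)]

theorem contDiffAt_extDeriv {k : ℕ} {E : Type*} [NormedAddCommGroup E] [NormedSpace ℝ E]
    {α : E → E [⋀^Fin k]→L[ℝ] ℝ} {y : E} (h : ContDiffAt ℝ ∞ α y) :
    ContDiffAt ℝ ∞ (extDeriv α) y := by
  have h1 : ContDiffAt ℝ ∞ (fderiv ℝ α) y := h.fderiv_right (by norm_num)
  exact (ContinuousAlternatingMap.alternatizeUncurryFinCLM ℝ E ℝ).contDiff.contDiffAt.comp y h1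

theorem smoothFun_formRatio_extD {α : ∀ p : M, TM m p [⋀^Fin 1]→L[ℝ] ℝ} (hα : IsSmoothForm α) :
    SmoothFun m (formRatio Ω (extD α)) := by
  refine smoothFun_of_contDiffAt fun x y hy => ?_
  have h1 : ContDiffAt ℝ ∞ (fun y => wedgePower m (extDeriv (chartRep α x) y)
      (chartRep Ω.form x y) (stdBasis m) / chartDensity Ω x y) y := by
    refine ContDiffAt.div ?_ (contDiffAt_chartDensity Ω hy) (chartDensity_ne_zero Ω hy)
    exact ContDiffAt.comp (𝕜 := ℝ) (x := y) (g := fun q : (Model m [⋀^Fin 2]→L[ℝ] ℝ) ×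
      (Model m [⋀^Fin 2]→L[ℝ] ℝ) => wedgePower m q.1 q.2 (stdBasis m))
      (f := fun y => (extDeriv (chartRep α x) y, chartRep Ω.form x y))
      (contDiff_wedgePower _).contDiffAt
      ((contDiffAt_extDeriv (hα.contDiffAt hy)).prodMk (Ω.smooth.contDiffAt hy))
  refine h1.congr_of_eventuallyEq ?_
  filter_upwards [(chartAt (Model m) x).open_target.mem_nhds hy] with y' hy'
  rw [Function.comp_apply, formRatio_comp_symm Ω _ hy', extDeriv_chartRep hα hy']

theorem SmoothFun.laplacian {ψ : M → ℝ} (hψ : SmoothFun m ψ) : SmoothFun m (laplacian Ω g ψ) :=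
  smoothFun_formRatio_extD Ω (isSmoothForm_flat_sgrad g Ω hψ)

theorem extDeriv_chartRep_form {x : M} {y : Model m} (hy : y ∈ (chartAt (Model m) x).target) :
    extDeriv (chartRep Ω.form x) y = 0 := by
  rw [extDeriv_chartRep Ω.smooth hy, chartRep, Ω.closed]
  rfl

end MetricCharts

open MeasureTheory Set

/-! ### Extension by zero and the divergence theorem in ℝ^n -/

section LocalIntegrals

theorem hasCompactSupport_indicator {E F : Type*} [TopologicalSpace E] [T2Space E] [Zero F]
    {U K : Set E} (hK : IsCompact K)
    {h : E → F} (h0 : ∀ y ∈ U, y ∉ K → h y = 0) : HasCompactSupport (U.indicator h) := by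
  refine HasCompactSupport.intro hK fun y hy => ?_
  by_cases hyU : y ∈ U
  · rw [indicator_of_mem hyU, h0 y hyU hy]
  · exact indicator_of_notMem hyU h

variable {E F : Type*} [NormedAddCommGroup E] [NormedSpace ℝ E] [NormedAddCommGroup F]
  [NormedSpace ℝ F]

/-- `U` and the complement of `K` are open and cover the space; on the latter the extension is zero.
-/
theorem contDiff_indicator {n : WithTop ℕ∞} {U K : Set E} (hU : IsOpen U) (hK : IsCompact K)
    (hKU : K ⊆ U) {h : E → F} (hh : ∀ y ∈ U, ContDiffAt ℝ n h y) (h0 : ∀ y ∈ U, y ∉ K → h y = 0) :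
    ContDiff ℝ n (U.indicator h) := by
  rw [contDiff_iff_contDiffAt]
  intro y
  by_cases hy : y ∈ U
  · refine (hh y hy).congr_of_eventuallyEq ?_
    filter_upwards [hU.mem_nhds hy] with z hz using indicator_of_mem hz h
  · refine (contDiffAt_const (c := (0 : F))).congr_of_eventuallyEq ?_
    filter_upwards [hK.isClosed.isOpen_compl.mem_nhds fun hyK => hy (hKU hyK)] with z hz
    by_cases hzU : z ∈ U
    · rw [indicator_of_mem hzU, h0 z hzU hz]
    · exact indicator_of_notMem hzU h

theorem continuous_indicator_of_compact {U K : Set E} (hU : IsOpen U) (hK : IsCompact K)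
    (hKU : K ⊆ U) {h : E → F} (hh : ContinuousOn h U) (h0 : ∀ y ∈ U, y ∉ K → h y = 0) :
    Continuous (U.indicator h) := by
  rw [← contDiff_zero (𝕜 := ℝ)]
  have h1 : ContDiffOn ℝ 0 h U := contDiffOn_zero.2 hh
  exact contDiff_indicator hU hK hKU (fun y hy => h1.contDiffAt (hU.mem_nhds hy)) h0

theorem integrableOn_of_compact [MeasurableSpace E] [BorelSpace E] [FiniteDimensional ℝ E]
    (μ : Measure E) [IsFiniteMeasureOnCompacts μ] {U K : Set E} (hU : IsOpen U) (hK : IsCompact K)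
    (hKU : K ⊆ U) {h : E → ℝ} (hh : ContinuousOn h U) (h0 : ∀ y ∈ U, y ∉ K → h y = 0) :
    IntegrableOn h U μ := by
  rw [← integrable_indicator_iff hU.measurableSet]
  exact (continuous_indicator_of_compact hU hK hKU hh h0).integrable_of_hasCompactSupport
    (hasCompactSupport_indicator hK h0)

theorem trace_eq_sum_coord {n : ℕ} (A : EuclideanSpace ℝ (Fin n) →L[ℝ] EuclideanSpace ℝ (Fin n)) :
    LinearMap.trace ℝ _ (A : EuclideanSpace ℝ (Fin n) →ₗ[ℝ] EuclideanSpace ℝ (Fin n)) =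
      ∑ i, A (EuclideanSpace.single i 1) i := by
  rw [LinearMap.trace_eq_matrix_trace ℝ (EuclideanSpace.basisFun (Fin n) ℝ).toBasis, Matrix.trace]
  refine Finset.sum_congr rfl fun i _ => ?_
  simp [LinearMap.toMatrix_apply]

/-- The integral of the divergence of a compactly supported vector field vanishes. -/
theorem integral_trace_fderiv_eq_zero {n : ℕ}
    {W : EuclideanSpace ℝ (Fin n) → EuclideanSpace ℝ (Fin n)} (hW : ContDiff ℝ 1 W)
    (hc : HasCompactSupport W) :
    ∫ y, LinearMap.trace ℝ _ (fderiv ℝ W y : EuclideanSpace ℝ (Fin n) →ₗ[ℝ] _) = 0 := by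
  simp only [trace_eq_sum_coord]
  have hd : ∀ y, HasFDerivAt W (fderiv ℝ W y) y :=
    fun y => (hW.differentiable one_ne_zero y).hasFDerivAt
  have hi : ∀ i : Fin n, ∀ y, fderiv ℝ (fun z => W z i) y (EuclideanSpace.single i 1) =
      fderiv ℝ W y (EuclideanSpace.single i 1) i := by
    intro i y
    have := ((EuclideanSpace.proj (𝕜 := ℝ) i).hasFDerivAt (x := W y)).comp y (hd y)
    have h2 : HasFDerivAt (fun z => W z i) ((EuclideanSpace.proj (𝕜 := ℝ) i) ∘L fderiv ℝ W y) y :=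
      this
    rw [h2.fderiv]
    rfl
  have hWi : ∀ i : Fin n, ContDiff ℝ 1 fun z => W z i :=
    fun i => (EuclideanSpace.proj (𝕜 := ℝ) i).contDiff.comp hW
  have hci : ∀ i : Fin n, HasCompactSupport fun z => W z i := by
    intro i
    exact hc.comp_left (g := fun w : EuclideanSpace ℝ (Fin n) => w i) rfl
  have hint : ∀ i : Fin n, Integrable fun y =>
      fderiv ℝ (fun z => W z i) y (EuclideanSpace.single i (1 : ℝ)) := by
    intro i
    refine Continuous.integrable_of_hasCompactSupport
      (((hWi i).continuous_fderiv one_ne_zero).clm_apply continuous_const) ?_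
    exact (hci i).fderiv_apply ℝ _
  simp only [← hi]
  rw [integral_finsetSum _ fun i _ => hint i]
  refine Finset.sum_eq_zero fun i _ => ?_
  -- Integration by parts against the constant function 1.
  have h1 := integral_mul_fderiv_eq_neg_fderiv_mul_of_integrable (𝕜 := ℝ) (μ := volume)
    (f := fun _ : EuclideanSpace ℝ (Fin n) => (1 : ℝ)) (g := fun z => W z i)
    (v := EuclideanSpace.single i 1) (by simp) (by simpa using hint i)
    (by simpa using (hWi i).continuous.integrable_of_hasCompactSupport (hci i))
    (by simp) (fun y _ => (hWi i).differentiable one_ne_zero y)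
  simpa using h1

end LocalIntegrals

/-! ### The integral over M: chart independence, linearity, positivity -/

section IntegralTop

variable {m : ℕ} {M : Type*} [TopologicalSpace M] [ChartedSpace (Model m) M]

theorem topPower_coordVec (Ω : SymplecticForm m M) (x : M) (y : Model m) :
    topPower m (V := Model m) (Ω.form ((chartAt (Model m) x).symm y)) (coordVec x y) =
      chartDensity Ω x y :=
  (wedgeTwoForms_compContinuousLinearMap (V := Model m)
    (fun _ : Fin m => Ω.form ((chartAt (Model m) x).symm y)) (invD x y) (stdBasis m)).symm

/-- The integral in the chart at `x` of a function on `M` against `|Ω^m|`. -/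
def chartIntegral (Ω : SymplecticForm m M) (x : M) (f : M → ℝ) : ℝ :=
  ∫ y in (chartAt (Model m) x).target, f ((chartAt (Model m) x).symm y) * |chartDensity Ω x y|

theorem compact_chart_image [CompactSpace M] {x : M} {f : M → ℝ}
    (hf : tsupport f ⊆ (chartAt (Model m) x).source) :
    IsCompact ((chartAt (Model m) x) '' tsupport f) ∧
      (chartAt (Model m) x) '' tsupport f ⊆ (chartAt (Model m) x).target ∧
      ∀ y ∈ (chartAt (Model m) x).target, y ∉ (chartAt (Model m) x) '' tsupport f →
        (chartAt (Model m) x).symm y ∉ tsupport f := by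
  refine ⟨(isClosed_tsupport f).isCompact.image_of_continuousOn
    ((chartAt (Model m) x).continuousOn.mono hf), ?_, ?_⟩
  · rintro _ ⟨p, hp, rfl⟩
    exact (chartAt (Model m) x).map_source (hf hp)
  · intro y hy hyn hmem
    exact hyn ⟨_, hmem, (chartAt (Model m) x).right_inv hy⟩

variable [IsManifold 𝓘(ℝ, Model m) ∞ M]

omit [IsManifold 𝓘(ℝ, Model m) ∞ M] in
theorem continuousOn_chartDensity (Ω : SymplecticForm m M) (x : M) :
    ContinuousOn (chartDensity Ω x) (chartAt (Model m) x).target :=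
  fun _ hy => (contDiffAt_chartDensity Ω hy).continuousAt.continuousWithinAt

theorem chartDensity_transition (Ω : SymplecticForm m M) {x z : M} {y : Model m}
    (hy : y ∈ (chartAt (Model m) x).target)
    (hz : (chartAt (Model m) x).symm y ∈ (chartAt (Model m) z).source) :
    chartDensity Ω x y =
      (fderiv ℝ (transition x z) y).det * chartDensity Ω z (transition x z y) := by
  rw [chartDensity, chartRep_transition _ hy hz, topPower_compContinuousLinearMap]
  rfl

/-- The chart integral does not depend on the chart. -/
theorem chartIntegral_eq (Ω : SymplecticForm m M) {x z : M} {f : M → ℝ}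
    (hx : ∀ p, f p ≠ 0 → p ∈ (chartAt (Model m) x).source)
    (hz : ∀ p, f p ≠ 0 → p ∈ (chartAt (Model m) z).source) :
    chartIntegral Ω z f = chartIntegral Ω x f := by
  -- `A` and `B` are the images of the overlap of the two chart domains; f vanishes off the overlap,
  -- so both integrals restrict to them.
  let A : Set (Model m) := (chartAt (Model m) x).target ∩
    (chartAt (Model m) x).symm ⁻¹' (chartAt (Model m) z).source
  let B : Set (Model m) := (chartAt (Model m) z).target ∩
    (chartAt (Model m) z).symm ⁻¹' (chartAt (Model m) x).source
  have hA : IsOpen A := (chartAt (Model m) x).isOpen_inter_preimage_symm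
    (chartAt (Model m) z).open_source
  have hAB : transition x z '' A = B := by
    ext y'
    constructor
    · rintro ⟨y, hy, rfl⟩
      refine ⟨(chartAt (Model m) z).map_source hy.2, ?_⟩
      rw [mem_preimage, symm_transition hy.2]
      exact (chartAt (Model m) x).map_target hy.1
    · rintro ⟨h1, h2⟩
      refine ⟨transition z x y', ⟨(chartAt (Model m) x).map_source h2, ?_⟩, ?_⟩
      · rw [mem_preimage, symm_transition h2]
        exact (chartAt (Model m) z).map_target h1
      · rw [transition, symm_transition h2, (chartAt (Model m) z).right_inv h1]
  have hinj : InjOn (transition x z) A := by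
    intro y hy y' hy' h
    have h1 := congrArg (chartAt (Model m) z).symm h
    rw [symm_transition hy.2, symm_transition hy'.2] at h1
    exact (chartAt (Model m) x).symm.injOn hy.1 hy'.1 h1
  have h1 : chartIntegral Ω z f =
      ∫ y in B, f ((chartAt (Model m) z).symm y) * |chartDensity Ω z y| := by
    refine (setIntegral_eq_of_subset_of_forall_sdiff_eq_zero
      (chartAt (Model m) z).open_target.measurableSet inter_subset_left fun y hy => ?_)
    have : f ((chartAt (Model m) z).symm y) = 0 := by
      by_contra hne
      exact hy.2 ⟨hy.1, hx _ hne⟩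
    rw [this, zero_mul]
  have h2 : chartIntegral Ω x f =
      ∫ y in A, f ((chartAt (Model m) x).symm y) * |chartDensity Ω x y| := by
    refine (setIntegral_eq_of_subset_of_forall_sdiff_eq_zero
      (chartAt (Model m) x).open_target.measurableSet inter_subset_left fun y hy => ?_)
    have : f ((chartAt (Model m) x).symm y) = 0 := by
      by_contra hne
      exact hy.2 ⟨hy.1, hz _ hne⟩
    rw [this, zero_mul]
  rw [h1, h2, ← hAB, integral_image_eq_integral_abs_det_fderiv_smul volume hA.measurableSet
    (fun y hy => ((contDiffAt_transition hy.1 hy.2).differentiableAt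
      (by norm_num)).hasFDerivAt.hasFDerivWithinAt) hinj]
  refine setIntegral_congr_fun hA.measurableSet fun y hy => ?_
  -- The Jacobian of the change of variables is exactly the factor relating the two densities.
  rw [chartDensity_transition Ω hy.1 hy.2, abs_mul, symm_transition hy.2, smul_eq_mul]
  ring

variable [CompactSpace M]

omit [IsManifold 𝓘(ℝ, Model m) ∞ M] in
theorem integrableOn_chart (Ω : SymplecticForm m M) {x : M} {f : M → ℝ} (hc : Continuous f)
    (hf : tsupport f ⊆ (chartAt (Model m) x).source) :
    IntegrableOn (fun y => f ((chartAt (Model m) x).symm y) * |chartDensity Ω x y|)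
      (chartAt (Model m) x).target := by
  obtain ⟨h1, h2, h3⟩ := compact_chart_image hf
  refine integrableOn_of_compact volume (chartAt (Model m) x).open_target h1 h2 ?_ ?_
  · exact (hc.comp_continuousOn (chartAt (Model m) x).continuousOn_symm).mul
      (continuousOn_chartDensity Ω x).abs
  · intro y hy hyn
    rw [image_eq_zero_of_notMem_tsupport (h3 y hy hyn), zero_mul]

variable [T2Space M]

variable (m M) in
/-- The finite set of indices of the nonzero functions of the partition of unity. -/
def chartIndices : Finset M :=
  ((chartPartition m M).locallyFinite.finite_nonempty_of_compact).toFinset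

theorem chartPartition_eq_zero {x : M} (hx : x ∉ chartIndices m M) (p : M) :
    chartPartition m M x p = 0 := by
  by_contra h
  apply hx
  simp only [chartIndices, Finite.mem_toFinset]
  exact ⟨p, h⟩

theorem sum_chartPartition (p : M) : ∑ x ∈ chartIndices m M, chartPartition m M x p = 1 := by
  rw [← (chartPartition m M).sum_eq_one (mem_univ p), finsum_eq_sum_of_support_subset]
  intro x hx
  by_contra h
  exact hx (chartPartition_eq_zero h p)

theorem smooth_chartPartition (x : M) : SmoothFun m (fun p => chartPartition m M x p) :=
  (chartPartition m M x).contMDiff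

theorem tsupport_chartPartition (x : M) :
    tsupport (fun p => chartPartition m M x p) ⊆ (chartAt (Model m) x).source :=
  chartPartition_isSubordinate x

theorem tsupport_chartPartition_mul (x : M) (f : M → ℝ) :
    tsupport (fun p => chartPartition m M x p * f p) ⊆ (chartAt (Model m) x).source :=
  (closure_mono (Function.support_mul_subset_left _ _)).trans (tsupport_chartPartition x)

theorem continuous_chartPartition_mul (x : M) {f : M → ℝ} (hf : Continuous f) :
    Continuous (fun p => chartPartition m M x p * f p) :=
  (smooth_chartPartition x).continuous.mul hf

theorem integralTop_eq_sum (Ω : SymplecticForm m M) (f : M → ℝ) :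
    integralTop Ω f =
      ∑ x ∈ chartIndices m M, chartIntegral Ω x (fun p => chartPartition m M x p * f p) := by
  rw [integralTop, finsum_eq_sum_of_support_subset]
  · refine Finset.sum_congr rfl fun x _ => ?_
    simp only [topPower_coordVec]
    rfl
  · intro x hx
    by_contra h
    apply hx
    simp [chartPartition_eq_zero h]

/-- Each piece of f cut out by the partition lives in two charts and can be integrated in the chart
at x, where the pieces add up to f. -/
theorem integralTop_eq_chartIntegral (Ω : SymplecticForm m M) {x : M} {f : M → ℝ}
    (hc : Continuous f) (hf : tsupport f ⊆ (chartAt (Model m) x).source) :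
    integralTop Ω f = chartIntegral Ω x f := by
  rw [integralTop_eq_sum]
  have h1 : ∀ z, chartIntegral Ω z (fun p => chartPartition m M z p * f p) =
      chartIntegral Ω x (fun p => chartPartition m M z p * f p) := by
    intro z
    refine chartIntegral_eq Ω (fun p hp => ?_) fun p hp => ?_
    · exact hf (subset_tsupport _ (right_ne_zero_of_mul hp))
    · exact tsupport_chartPartition z (subset_tsupport _ (left_ne_zero_of_mul hp))
  rw [Finset.sum_congr rfl fun z _ => h1 z]
  unfold chartIntegral
  rw [← integral_finsetSum]
  · refine setIntegral_congr_fun (chartAt (Model m) x).open_target.measurableSet fun y _ => ?_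
    dsimp only
    rw [← Finset.sum_mul, ← Finset.sum_mul, sum_chartPartition, one_mul]
  · intro z _
    refine integrableOn_chart Ω (continuous_chartPartition_mul z hc) ?_
    exact (closure_mono (Function.support_mul_subset_right _ _)).trans hf

theorem integralTop_add (Ω : SymplecticForm m M) {f h : M → ℝ} (hf : Continuous f)
    (hh : Continuous h) :
    integralTop Ω (fun p => f p + h p) = integralTop Ω f + integralTop Ω h := by
  simp only [integralTop_eq_sum, ← Finset.sum_add_distrib]
  refine Finset.sum_congr rfl fun x _ => ?_
  unfold chartIntegral
  rw [← integral_add (integrableOn_chart Ω (continuous_chartPartition_mul x hf)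
    (tsupport_chartPartition_mul x f)) (integrableOn_chart Ω (continuous_chartPartition_mul x hh)
    (tsupport_chartPartition_mul x h))]
  refine integral_congr_ae (Filter.Eventually.of_forall fun y => ?_)
  dsimp only
  ring

theorem integralTop_const_mul (Ω : SymplecticForm m M) (c : ℝ) (f : M → ℝ) :
    integralTop Ω (fun p => c * f p) = c * integralTop Ω f := by
  simp only [integralTop_eq_sum, Finset.mul_sum]
  refine Finset.sum_congr rfl fun x _ => ?_
  unfold chartIntegral
  rw [← integral_const_mul]
  refine integral_congr_ae (Filter.Eventually.of_forall fun y => ?_)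
  dsimp only
  ring

/-- A nonnegative continuous function with zero integral vanishes. -/
theorem eq_zero_of_integralTop_eq_zero (Ω : SymplecticForm m M) {f : M → ℝ} (hf : Continuous f)
    (h0 : ∀ p, 0 ≤ f p) (hI : integralTop Ω f = 0) (p : M) : f p = 0 := by
  rw [integralTop_eq_sum, Finset.sum_eq_zero_iff_of_nonneg] at hI
  swap
  · intro x _
    exact integral_nonneg fun y =>
      mul_nonneg (mul_nonneg ((chartPartition m M).nonneg x _) (h0 _)) (abs_nonneg _)
  -- Every summand is zero; one whose partition function is nonzero at p gives information about `f
  -- p`.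
  obtain ⟨x, hx, hxp⟩ : ∃ x ∈ chartIndices m M, chartPartition m M x p ≠ 0 := by
    by_contra! h
    have := sum_chartPartition (m := m) p
    rw [Finset.sum_eq_zero h] at this
    exact zero_ne_one this
  have hpx : p ∈ (chartAt (Model m) x).source :=
    tsupport_chartPartition x (subset_tsupport _ hxp)
  obtain ⟨h1, h2, h3⟩ := compact_chart_image (tsupport_chartPartition_mul (m := m) x f)
  set q : Model m → ℝ := fun y => chartPartition m M x ((chartAt (Model m) x).symm y) *
    f ((chartAt (Model m) x).symm y) * |chartDensity Ω x y| with hq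
  have hqc : ContinuousOn q (chartAt (Model m) x).target :=
    ((continuous_chartPartition_mul x hf).comp_continuousOn
      (chartAt (Model m) x).continuousOn_symm).mul (continuousOn_chartDensity Ω x).abs
  have hq0 : ∀ y ∈ (chartAt (Model m) x).target,
      y ∉ (chartAt (Model m) x) '' tsupport (fun p => chartPartition m M x p * f p) → q y = 0 := by
    intro y hy hyn
    have := image_eq_zero_of_notMem_tsupport (h3 y hy hyn)
    simp only [hq, this, zero_mul]
  have hcont := continuous_indicator_of_compact (chartAt (Model m) x).open_target h1 h2 hqc hq0
  have hI' : ∫ y, (chartAt (Model m) x).target.indicator q y = 0 := by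
    rw [integral_indicator (chartAt (Model m) x).open_target.measurableSet]
    exact hI x hx
  have hnn : 0 ≤ (chartAt (Model m) x).target.indicator q := fun y =>
    indicator_nonneg (fun y _ =>
      mul_nonneg (mul_nonneg ((chartPartition m M).nonneg x _) (h0 _)) (abs_nonneg _)) y
  have hzero := (integral_eq_zero_iff_of_nonneg hnn (hcont.integrable_of_hasCompactSupport
    (hasCompactSupport_indicator h1 hq0))).1 hI'
  have hz := congrFun ((hcont.ae_eq_iff_eq volume continuous_const).1 hzero)
    (chartAt (Model m) x p)
  rw [indicator_of_mem ((chartAt (Model m) x).map_source hpx)] at hz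
  change q _ = 0 at hz
  rw [hq] at hz
  simp only [(chartAt (Model m) x).left_inv hpx] at hz
  rcases mul_eq_zero.1 hz with h | h
  · exact (mul_eq_zero.1 h).resolve_left hxp
  · exact absurd (abs_eq_zero.1 h) (chartDensity_ne_zero Ω ((chartAt (Model m) x).map_source hpx))

end IntegralTop

/-! ### Green's formula and zero mean of Poisson brackets -/

section Green

variable {m : ℕ} {M : Type*} [TopologicalSpace M] [ChartedSpace (Model m) M]

theorem SmoothFun.mul {F G : M → ℝ} (hF : SmoothFun m F) (hG : SmoothFun m G) :
    SmoothFun m (fun p => F p * G p) := ContMDiff.mul hF hG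

theorem dFun_add {F G : M → ℝ} {p : M} (hF : MDifferentiableAt 𝓘(ℝ, Model m) 𝓘(ℝ, ℝ) F p)
    (hG : MDifferentiableAt 𝓘(ℝ, Model m) 𝓘(ℝ, ℝ) G p) (v : TM m p) :
    dFun (fun p => F p + G p) p v = dFun F p v + dFun G p v :=
  congrArg (fun A : TM m p →L[ℝ] ℝ => A v) (hF.hasMFDerivAt.add hG.hasMFDerivAt).mfderiv

theorem dFun_mul {F G : M → ℝ} {p : M} (hF : MDifferentiableAt 𝓘(ℝ, Model m) 𝓘(ℝ, ℝ) F p)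
    (hG : MDifferentiableAt 𝓘(ℝ, Model m) 𝓘(ℝ, ℝ) G p) (v : TM m p) :
    dFun (fun p => F p * G p) p v = F p * dFun G p v + G p * dFun F p v :=
  congrArg (fun A : TM m p →L[ℝ] ℝ => A v) (hF.hasMFDerivAt.mul hG.hasMFDerivAt).mfderiv

theorem dFun_const_mul (c : ℝ) {F : M → ℝ} {p : M} (v : TM m p)
    (hF : MDifferentiableAt 𝓘(ℝ, Model m) 𝓘(ℝ, ℝ) F p) :
    dFun (fun p => c * F p) p v = c * dFun F p v :=
  congrArg (fun A : TM m p →L[ℝ] ℝ => A v) (hF.hasMFDerivAt.const_smul c).mfderiv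

theorem dFun_eq_zero_of_notMem_tsupport {F : M → ℝ} {p : M} (hp : p ∉ tsupport F) :
    dFun (m := m) F p = 0 := by
  have h : F =ᶠ[𝓝 p] fun _ => 0 := notMem_tsupport_iff_eventuallyEq.1 hp
  have h2 := h.mfderiv_eq (I := 𝓘(ℝ, Model m)) (I' := 𝓘(ℝ, ℝ))
  exact h2.trans mfderiv_const

/-- The value `α(sgrad F)` of a one-form on a Hamiltonian vector field. -/
def formSgrad (Ω : SymplecticForm m M) (α : ∀ p : M, TM m p [⋀^Fin 1]→L[ℝ] ℝ) (F : M → ℝ)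
    (p : M) : ℝ := α p ![sgrad Ω F p]

/-- The vector is the X with i_X Ω = α at p. The formula exhibits α(sgrad F) as local and additive
in F, as localization by a partition of unity requires. -/
theorem exists_formSgrad_eq (Ω : SymplecticForm m M) (α : ∀ p : M, TM m p [⋀^Fin 1]→L[ℝ] ℝ)
    (p : M) : ∃ v : TM m p, ∀ F : M → ℝ, formSgrad Ω α F p = -dFun F p v := by
  obtain ⟨v, hv⟩ := Ω.exists_contraction p
    ((covectorCLE (Model m)).symm (α p) : Model m →L[ℝ] ℝ)
  refine ⟨v, fun F => ?_⟩
  have h1 : formSgrad Ω α F p = Ω.form p ![v, sgrad Ω F p] :=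
    ((hv _).trans (covectorCLE_symm_apply (V := Model m) (α p) _)).symm
  rw [h1, ← sgrad_spec Ω F p v]
  exact twoForm_swap (V := Model m) (Ω.form p) _ _

theorem tsupport_formSgrad (Ω : SymplecticForm m M) (α : ∀ p : M, TM m p [⋀^Fin 1]→L[ℝ] ℝ)
    (F : M → ℝ) : tsupport (formSgrad Ω α F) ⊆ tsupport F := by
  refine closure_minimal (fun p hp => ?_) (isClosed_tsupport F)
  by_contra h
  apply hp
  obtain ⟨v, hv⟩ := exists_formSgrad_eq Ω α p
  rw [hv, dFun_eq_zero_of_notMem_tsupport h]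
  simp

variable [IsManifold 𝓘(ℝ, Model m) ∞ M]

/-- The covector field of a one-form in coordinates. -/
def chartCovector (α : ∀ p : M, TM m p [⋀^Fin 1]→L[ℝ] ℝ) (x : M) (y : Model m) :
    Model m →L[ℝ] ℝ := (covectorCLE (Model m)).symm (chartRep α x y)

omit [IsManifold 𝓘(ℝ, Model m) ∞ M] in
theorem contDiffAt_chartCovector {α : ∀ p : M, TM m p [⋀^Fin 1]→L[ℝ] ℝ} (hα : IsSmoothForm α)
    {x : M} {y : Model m} (hy : y ∈ (chartAt (Model m) x).target) :
    ContDiffAt ℝ ∞ (chartCovector α x) y :=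
  ContDiffAt.comp (𝕜 := ℝ) (x := y) (g := fun a => (covectorCLE (Model m)).symm a)
    (f := chartRep α x) (covectorCLE (Model m)).symm.contDiff.contDiffAt (hα.contDiffAt hy)

variable (Ω : SymplecticForm m M) {α : ∀ p : M, TM m p [⋀^Fin 1]→L[ℝ] ℝ} {F : M → ℝ}

theorem formSgrad_comp_symm (hF : SmoothFun m F) {x : M} {y : Model m}
    (hy : y ∈ (chartAt (Model m) x).target) :
    formSgrad Ω α F ((chartAt (Model m) x).symm y) =
      -fderiv ℝ (F ∘ (chartAt (Model m) x).symm) y (chartRaise Ω x (chartCovector α x) y) := by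
  have h1 : formSgrad Ω α F ((chartAt (Model m) x).symm y) =
      chartCovector α x y (chartSgrad Ω x F y) := by
    rw [chartCovector, covectorCLE_symm_apply, chartRep_apply, formSgrad,
      ← invD_chartSgrad Ω hy (hF.mdifferentiableAt _)]
    congr 1
    funext i
    fin_cases i
    rfl
  rw [h1, ← chartRaise_spec Ω hy, twoForm_swap, chartSgrad, chartRaise_spec Ω hy]

theorem smoothFun_formSgrad (hα : IsSmoothForm α) (hF : SmoothFun m F) :
    SmoothFun m (formSgrad Ω α F) := by
  refine smoothFun_of_contDiffAt fun x y hy => ?_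
  have h1 : ContDiffAt ℝ ∞ (fun y => -fderiv ℝ (F ∘ (chartAt (Model m) x).symm) y
      (chartRaise Ω x (chartCovector α x) y)) y :=
    (((hF.contDiffAt hy).fderiv_right (by norm_num)).clm_apply
      (contDiffAt_chartRaise Ω hy (contDiffAt_chartCovector hα hy))).neg
  refine h1.congr_of_eventuallyEq ?_
  filter_upwards [(chartAt (Model m) x).open_target.mem_nhds hy] with y' hy'
  exact formSgrad_comp_symm Ω hF hy'

/-- In coordinates, `α(sgrad F) - m F (dα ∧ Ω^{m-1} / Ω^m)` is minus the divergence of `F X`, where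
`i_X Ω = α`. -/
theorem trace_fderiv_density_smul (hm : 1 ≤ m) (hα : IsSmoothForm α) (hF : SmoothFun m F) {x : M}
    {y : Model m} (hy : y ∈ (chartAt (Model m) x).target) :
    LinearMap.trace ℝ (Model m) (fderiv ℝ (fun z => (F ((chartAt (Model m) x).symm z) *
      |chartDensity Ω x z|) • chartRaise Ω x (chartCovector α x) z) y : Model m →ₗ[ℝ] Model m) =
    -((formSgrad Ω α F ((chartAt (Model m) x).symm y) -
      m * (F ((chartAt (Model m) x).symm y) *
        formRatio Ω (extD α) ((chartAt (Model m) x).symm y))) * |chartDensity Ω x y|) := by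
  set X := chartRaise Ω x (chartCovector α x) with hX
  set d := chartDensity Ω x with hd
  set f := F ∘ (chartAt (Model m) x).symm with hf
  have hXd : DifferentiableAt ℝ X y :=
    (contDiffAt_chartRaise Ω hy (contDiffAt_chartCovector hα hy)).differentiableAt (by norm_num)
  have hdd : DifferentiableAt ℝ d y := (contDiffAt_chartDensity Ω hy).differentiableAt (by norm_num)
  have hfd : DifferentiableAt ℝ f y := (hF.contDiffAt hy).differentiableAt (by norm_num)
  have hd0 : d y ≠ 0 := chartDensity_ne_zero Ω hy
  have hdiv := divergence_topPower hm (modelBasis m) (Θ := chartRep Ω.form x) (X := X)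
    (α := chartRep α x) (y := y) ((Ω.smooth.contDiffAt hy).differentiableAt (by norm_num)) hXd
    ((hα.contDiffAt hy).differentiableAt (by norm_num))
    (by
      filter_upwards [(chartAt (Model m) x).open_target.mem_nhds hy] with z hz u
      rw [hX, chartRaise_spec Ω hz, chartCovector, covectorCLE_symm_apply])
    (extDeriv_chartRep_form Ω hy)
  rw [coe_modelBasis, extDeriv_chartRep hα hy] at hdiv
  change _ * d y + fderiv ℝ d y (X y) = _ at hdiv
  -- The density does not vanish, so |d| is differentiable; its sign accounts for charts reversing
  -- the orientation by ω^m.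
  have habs : HasFDerivAt (fun z => |d z|) ((SignType.sign (d y) : ℝ) • fderiv ℝ d y) y :=
    (hasDerivAt_abs hd0).comp_hasFDerivAt y hdd.hasFDerivAt
  have hs : HasFDerivAt (fun z => F ((chartAt (Model m) x).symm z) * |d z|)
      (f y • ((SignType.sign (d y) : ℝ) • fderiv ℝ d y) + |d y| • fderiv ℝ f y) y :=
    hfd.hasFDerivAt.mul habs
  have hW := hs.smul hXd.hasFDerivAt
  rw [show fderiv ℝ (fun z => (F ((chartAt (Model m) x).symm z) * |d z|) • X z) y = _ from hW.fderiv,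
    formSgrad_comp_symm Ω hF hy, formRatio_comp_symm Ω _ hy, ← hX, ← hf]
  have htr : ∀ (a : Model m →L[ℝ] ℝ) (v : Model m),
      LinearMap.trace ℝ (Model m) (a.smulRight v : Model m →ₗ[ℝ] Model m) = a v := fun a v =>
    LinearMap.trace_smulRight (a : Model m →ₗ[ℝ] ℝ) v
  have hF' : F ((chartAt (Model m) x).symm y) = f y := rfl
  rw [ContinuousLinearMap.toLinearMap_add, map_add, htr, ContinuousLinearMap.toLinearMap_smul,
    map_smul, hF']
  simp only [_root_.add_apply, _root_.smul_apply, smul_eq_mul]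
  have hsgn : |d y| = SignType.sign (d y) * d y := (sign_mul_self (d y)).symm
  set w := wedgePower m (chartRep (extD α) x y) (chartRep Ω.form x y) (stdBasis m)
  have hdiv2 : LinearMap.trace ℝ (Model m) (fderiv ℝ X y : Model m →ₗ[ℝ] Model m) * d y +
    fderiv ℝ d y (X y) = m * w := hdiv
  have hw : w / d y * |d y| = SignType.sign (d y) * w := by
    rw [hsgn]
    field_simp
  -- Product rule for F |d| X: the terms with F undifferentiated form F sign(d) times the divergence
  -- identity, and the remaining one is dF(X) |d|.
  linear_combination f y * SignType.sign (d y) * hdiv2 - m * f y * hw +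
    f y * LinearMap.trace ℝ (Model m) (fderiv ℝ X y : Model m →ₗ[ℝ] Model m) * hsgn

omit [IsManifold 𝓘(ℝ, Model m) ∞ M] in
theorem continuous_of_smoothFun {F : M → ℝ} (hF : SmoothFun m F) : Continuous F :=
  ContMDiff.continuous hF

variable [T2Space M] [CompactSpace M]

theorem integralTop_formSgrad_of_tsupport (hm : 1 ≤ m) (hα : IsSmoothForm α) (hF : SmoothFun m F)
    {x : M} (hx : tsupport F ⊆ (chartAt (Model m) x).source) :
    integralTop Ω (formSgrad Ω α F) =
      m * integralTop Ω (fun p => F p * formRatio Ω (extD α) p) := by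
  have hr := smoothFun_formRatio_extD Ω hα
  have hc1 : Continuous (formSgrad Ω α F) :=
    continuous_of_smoothFun (smoothFun_formSgrad Ω hα hF)
  have hc2 : Continuous (fun p => F p * formRatio Ω (extD α) p) :=
    continuous_of_smoothFun (hF.mul hr)
  have hs1 := (tsupport_formSgrad Ω α F).trans hx
  have hs2 : tsupport (fun p => F p * formRatio Ω (extD α) p) ⊆ (chartAt (Model m) x).source :=
    (closure_mono (Function.support_mul_subset_left _ _)).trans hx
  obtain ⟨h1, h2, h3⟩ := compact_chart_image hx
  set U := (chartAt (Model m) x).target with hU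
  set W : Model m → Model m := fun z => (F ((chartAt (Model m) x).symm z) *
      |chartDensity Ω x z|) • chartRaise Ω x (chartCovector α x) z with hW
  have hUo : IsOpen U := (chartAt (Model m) x).open_target
  have hW0 : ∀ y ∈ U, y ∉ (chartAt (Model m) x) '' tsupport F → W y = 0 := fun y hy hyn => by
    rw [hW]
    simp only [image_eq_zero_of_notMem_tsupport (h3 y hy hyn), zero_mul, zero_smul]
  have hWd : ∀ y ∈ U, ContDiffAt ℝ 1 W y := fun y hy => by
    have hd := contDiffAt_chartDensity Ω hy
    exact ((((hF.contDiffAt hy).mul (hd.abs (chartDensity_ne_zero Ω hy))).smul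
      (contDiffAt_chartRaise Ω hy (contDiffAt_chartCovector hα hy))).of_le (by norm_num))
  -- The field F |d| X, extended by zero, is compactly supported and C^1 on the whole space.
  have key := integral_trace_fderiv_eq_zero (contDiff_indicator hUo h1 h2 hWd hW0)
    (hasCompactSupport_indicator h1 hW0)
  have key2 : ∫ y in U, LinearMap.trace ℝ (Model m) (fderiv ℝ W y : Model m →ₗ[ℝ] Model m) = 0 := by
    rw [← key, ← integral_indicator hUo.measurableSet]
    refine integral_congr_ae (Filter.Eventually.of_forall fun y => ?_)
    by_cases hy : y ∈ U
    · have : U.indicator W =ᶠ[𝓝 y] W := by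
        filter_upwards [hUo.mem_nhds hy] with z hz using indicator_of_mem hz W
      simp only [indicator_of_mem hy, this.fderiv_eq]
    · have : U.indicator W =ᶠ[𝓝 y] fun _ => 0 := by
        filter_upwards [h1.isClosed.isOpen_compl.mem_nhds fun hyK => hy (h2 hyK)] with z hz
        by_cases hzU : z ∈ U
        · rw [indicator_of_mem hzU, hW0 z hzU hz]
        · exact indicator_of_notMem hzU W
      simp [indicator_of_notMem hy, this.fderiv_eq]
  rw [setIntegral_congr_fun hUo.measurableSet
    fun y hy => trace_fderiv_density_smul Ω hm hα hF hy, integral_neg, neg_eq_zero] at key2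
  rw [← sub_eq_zero, integralTop_eq_chartIntegral Ω hc1 hs1, integralTop_eq_chartIntegral Ω hc2 hs2,
    chartIntegral, chartIntegral, ← integral_const_mul, ← integral_sub
      (integrableOn_chart Ω hc1 hs1) ((integrableOn_chart Ω hc2 hs2).const_mul _), ← key2]
  refine integral_congr_ae (Filter.Eventually.of_forall fun y => ?_)
  dsimp only
  ring

omit [IsManifold 𝓘(ℝ, Model m) ∞ M] [T2Space M] [CompactSpace M] in
theorem dFun_finset_sum {ι : Type*} (s : Finset ι) {F : ι → M → ℝ} (hF : ∀ i, SmoothFun m (F i))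
    (p : M) (v : TM m p) : dFun (fun p => ∑ i ∈ s, F i p) p v = ∑ i ∈ s, dFun (F i) p v := by
  classical
  have hs : ∀ s : Finset ι, SmoothFun m (fun p => ∑ i ∈ s, F i p) := fun s =>
    contMDiff_finsetSum fun i _ => hF i
  induction s using Finset.induction_on with
  | empty =>
    simp only [Finset.sum_empty]
    exact congrArg (fun A : TM m p →L[ℝ] ℝ => A v) mfderiv_const
  | insert i s hi ih =>
    simp only [Finset.sum_insert hi]
    rw [dFun_add ((hF i).mdifferentiableAt p) ((hs s).mdifferentiableAt p), ih]

theorem integralTop_finset_sum {ι : Type*} (s : Finset ι) {F : ι → M → ℝ}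
    (hF : ∀ i, Continuous (F i)) :
    integralTop Ω (fun p => ∑ i ∈ s, F i p) = ∑ i ∈ s, integralTop Ω (F i) := by
  classical
  induction s using Finset.induction_on with
  | empty =>
    have := integralTop_const_mul Ω 0 (fun _ : M => (0 : ℝ))
    simpa using this
  | insert i s hi ih =>
    simp only [Finset.sum_insert hi]
    rw [integralTop_add Ω (hF i) (continuous_finsetSum _ fun i _ => hF i), ih]

/-- Green's formula: `∫ α(sgrad F) Ω^m = m ∫ F dα ∧ Ω^{m-1}`. -/
theorem integralTop_formSgrad (hm : 1 ≤ m) (hα : IsSmoothForm α) (hF : SmoothFun m F) :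
    integralTop Ω (formSgrad Ω α F) =
      m * integralTop Ω (fun p => F p * formRatio Ω (extD α) p) := by
  have hr := smoothFun_formRatio_extD Ω hα
  have hFx : ∀ x, SmoothFun m (fun p => chartPartition m M x p * F p) := fun x =>
    (smooth_chartPartition x).mul hF
  have hsum : ∀ p, ∑ x ∈ chartIndices m M, chartPartition m M x p * F p = F p := fun p => by
    rw [← Finset.sum_mul, sum_chartPartition, one_mul]
  have h1 : formSgrad Ω α F = fun p => ∑ x ∈ chartIndices m M,
      formSgrad Ω α (fun p => chartPartition m M x p * F p) p := by
    funext p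
    obtain ⟨v, hv⟩ := exists_formSgrad_eq Ω α p
    simp only [hv, Finset.sum_neg_distrib]
    rw [← dFun_finset_sum _ hFx, funext hsum]
  have h2 : (fun p => F p * formRatio Ω (extD α) p) = fun p => ∑ x ∈ chartIndices m M,
      chartPartition m M x p * F p * formRatio Ω (extD α) p := by
    funext p
    rw [← Finset.sum_mul, hsum]
  rw [h1, h2, integralTop_finset_sum Ω _ fun x =>
    continuous_of_smoothFun (smoothFun_formSgrad Ω hα (hFx x)),
    integralTop_finset_sum Ω _ fun x => continuous_of_smoothFun ((hFx x).mul hr), Finset.mul_sum]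
  exact Finset.sum_congr rfl fun x _ =>
    integralTop_formSgrad_of_tsupport Ω hm hα (hFx x) (tsupport_chartPartition_mul x F)

omit [IsManifold 𝓘(ℝ, Model m) ∞ M] [T2Space M] [CompactSpace M] in
/-- The differential of a function, as a one-form. -/
def dForm (F : M → ℝ) (p : M) : TM m p [⋀^Fin 1]→L[ℝ] ℝ := covectorCLE (Model m) (dFun F p)

omit [T2Space M] [CompactSpace M] in
theorem chartRep_dForm (hF : SmoothFun m F) {x : M} {y : Model m}
    (hy : y ∈ (chartAt (Model m) x).target) :
    chartRep (dForm F) x y =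
      covectorCLE (Model m) (fderiv ℝ (F ∘ (chartAt (Model m) x).symm) y) := by
  ext v
  rw [covectorCLE_apply, ← dFun_invD hy (hF.mdifferentiableAt _)]
  exact (chartRep_apply ..).trans (covectorCLE_apply (V := Model m) _ _)

omit [T2Space M] [CompactSpace M] in
theorem isSmoothForm_dForm (hF : SmoothFun m F) : IsSmoothForm (dForm (m := m) F) := by
  intro x y hy
  have h1 : ContDiffAt ℝ ∞ (fun y => covectorCLE (Model m)
      (fderiv ℝ (F ∘ (chartAt (Model m) x).symm) y)) y :=
    ContDiffAt.comp (𝕜 := ℝ) (x := y) (g := fun a => covectorCLE (Model m) a)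
      (f := fun y => fderiv ℝ (F ∘ (chartAt (Model m) x).symm) y)
      (covectorCLE (Model m)).contDiff.contDiffAt ((hF.contDiffAt hy).fderiv_right (by norm_num))
  refine ContDiffAt.contDiffWithinAt (h1.congr_of_eventuallyEq ?_)
  filter_upwards [(chartAt (Model m) x).open_target.mem_nhds hy] with z hz
  exact chartRep_dForm hF hz

/-- d² = 0 on functions, by symmetry of the second derivative. -/
theorem extDeriv_covector_fderiv {V : Type*} [NormedAddCommGroup V] [NormedSpace ℝ V] {f : V → ℝ}
    {y : V} (hf : ContDiffAt ℝ ∞ f y) :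
    extDeriv (fun z => covectorCLE V (fderiv ℝ f z)) y = 0 := by
  have h2 : DifferentiableAt ℝ (fderiv ℝ f) y :=
    (hf.fderiv_right (m := ∞) (by norm_num)).differentiableAt (by norm_num)
  have hs : IsSymmSndFDerivAt ℝ f y :=
    hf.isSymmSndFDerivAt (by
      rw [minSmoothness_of_isRCLikeNormedField]
      exact WithTop.coe_le_coe.2 le_top)
  have h3 : HasFDerivAt (fun z => covectorCLE V (fderiv ℝ f z))
      ((covectorCLE V : (V →L[ℝ] ℝ) →L[ℝ] V [⋀^Fin 1]→L[ℝ] ℝ) ∘L fderiv ℝ (fderiv ℝ f) y) y :=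
    (covectorCLE V).hasFDerivAt.comp y h2.hasFDerivAt
  ext v
  have h4 : ∀ (w : Fin 1 → V) (u : V),
      fderiv ℝ (fun x => covectorCLE V (fderiv ℝ f x) w) y u = fderiv ℝ (fderiv ℝ f) y u (w 0) :=
    fun w u => by
      have h5 : HasFDerivAt (fun x => fderiv ℝ f x (w 0))
        ((ContinuousLinearMap.apply ℝ ℝ (w 0)) ∘L fderiv ℝ (fderiv ℝ f) y) y :=
        (ContinuousLinearMap.apply ℝ ℝ (w 0)).hasFDerivAt.comp y h2.hasFDerivAt
      exact congrArg (fun A : V →L[ℝ] ℝ => A u) h5.fderiv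
  rw [extDeriv_apply h3.differentiableAt]
  simp only [h4]
  simp [Fin.removeNth, hs.eq (v 0) (v 1)]

omit [T2Space M] [CompactSpace M] in
theorem extD_dForm (hF : SmoothFun m F) (p : M) : extD (dForm (m := m) F) p = 0 := by
  have hy := mem_chart_target (Model m) p
  have h1 : chartRep (dForm (m := m) F) p =ᶠ[𝓝 (chartAt (Model m) p p)] fun z =>
      covectorCLE (Model m) (fderiv ℝ (F ∘ (chartAt (Model m) p).symm) z) := by
    filter_upwards [(chartAt (Model m) p).open_target.mem_nhds hy] with z hz
    exact chartRep_dForm hF hz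
  rw [extD, h1.extDeriv_eq, extDeriv_covector_fderiv (hF.contDiffAt hy)]
  rfl

theorem wedgePower_zero_left {V : Type*} [NormedAddCommGroup V] [NormedSpace ℝ V] {m : ℕ}
    (hm : 1 ≤ m) (Θ : V [⋀^Fin 2]→L[ℝ] ℝ) (v : Fin (2 * m) → V) : wedgePower m 0 Θ v = 0 :=
  wedgeTwoForms_eq_zero_of_slot (k := ⟨0, hm⟩) (by simp) v

/-- Poisson brackets have zero mean. -/
theorem integralTop_poisson (hm : 1 ≤ m) {G F : M → ℝ} (hG : SmoothFun m G) (hF : SmoothFun m F) :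
    integralTop Ω (poisson Ω G F) = 0 := by
  have h1 : poisson Ω G F = formSgrad Ω (dForm G) F := by
    funext p
    exact (poisson_eq Ω G F p).trans
      (covectorCLE_apply (V := Model m) (dFun G p) ![sgrad Ω F p]).symm
  have h2 : (fun p => F p * formRatio Ω (extD (dForm G)) p) = fun p => 0 * F p := by
    funext p
    have : formRatio Ω (extD (dForm G)) p = 0 := by
      rw [formRatio, extD_dForm hG p]
      exact div_eq_zero_iff.2 (Or.inl (wedgePower_zero_left (V := Model m) hm _ _))
    rw [this, mul_zero, zero_mul]
  rw [h1, integralTop_formSgrad Ω hm (isSmoothForm_dForm hG) hF, h2, integralTop_const_mul]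
  ring

omit [IsManifold 𝓘(ℝ, Model m) ∞ M] [T2Space M] [CompactSpace M] in
theorem poisson_mul_right {ψ G H : M → ℝ} (hG : SmoothFun m G) (hH : SmoothFun m H) (p : M) :
    poisson Ω ψ (fun p => G p * H p) p = G p * poisson Ω ψ H p + H p * poisson Ω ψ G p := by
  rw [poisson_antisymm, poisson_antisymm Ω ψ H, poisson_antisymm Ω ψ G, poisson_eq, poisson_eq,
    poisson_eq, dFun_mul (hG.mdifferentiableAt p) (hH.mdifferentiableAt p)]
  ring

/-- The bracket with ψ is a derivation, and {ψ, HG} has zero mean. -/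
theorem integralTop_poisson_mul (hm : 1 ≤ m) {ψ G H : M → ℝ} (hψ : SmoothFun m ψ)
    (hG : SmoothFun m G) (hH : SmoothFun m H) :
    integralTop Ω (fun p => poisson Ω ψ H p * G p) =
      -integralTop Ω (fun p => H p * poisson Ω ψ G p) := by
  have h0 := integralTop_poisson Ω hm hψ (hH.mul hG)
  have h1 : poisson Ω ψ (fun p => H p * G p) =
      fun p => H p * poisson Ω ψ G p + poisson Ω ψ H p * G p := by
    funext p
    rw [poisson_mul_right Ω hH hG]
    ring
  rw [h1, integralTop_add Ω (continuous_of_smoothFun (hH.mul (hψ.poisson Ω hG)))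
    (continuous_of_smoothFun ((hψ.poisson Ω hH).mul hG))] at h0
  linarith

/-- Green's formula for α = (sgrad ψ)^♭. -/
theorem integralTop_inner_sgrad (hm : 1 ≤ m) (g : Metric m M) {ψ : M → ℝ} (hψ : SmoothFun m ψ)
    (hF : SmoothFun m F) :
    integralTop Ω (fun p => g.inner p (sgrad Ω ψ p) (sgrad Ω F p)) =
      m * integralTop Ω (fun p => F p * laplacian Ω g ψ p) := by
  rw [laplacian_eq_formRatio, ← integralTop_formSgrad Ω hm (isSmoothForm_flat_sgrad g Ω hψ) hF]
  rfl

end Green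

/-! ### Dependence on a time parameter -/

section Parametric

variable {E : Type*} [NormedAddCommGroup E] [NormedSpace ℝ E]

theorem hasDerivAt_slice {F : Type*} [NormedAddCommGroup F] [NormedSpace ℝ F] {k : ℝ × E → F}
    {t : ℝ} {y : E} (hk : DifferentiableAt ℝ k (t, y)) :
    HasDerivAt (fun s => k (s, y)) (fderiv ℝ k (t, y) (1, 0)) t := by
  have h1 : HasDerivAt (fun s : ℝ => (s, y)) ((1, 0) : ℝ × E) t :=
    (hasDerivAt_id t).prodMk (hasDerivAt_const t y)
  exact hk.hasFDerivAt.comp_hasDerivAt t h1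

theorem fderiv_slice {F : Type*} [NormedAddCommGroup F] [NormedSpace ℝ F] {k : ℝ × E → F}
    {t : ℝ} {y : E} (hk : DifferentiableAt ℝ k (t, y)) :
    fderiv ℝ (fun z => k (t, z)) y =
      (fderiv ℝ k (t, y)).comp (ContinuousLinearMap.inr ℝ ℝ E) :=
  (hk.hasFDerivAt.comp y (hasFDerivAt_prodMk_right t y)).fderiv

theorem contDiffAt_fderiv_slice {k : ℝ × E → ℝ} {t : ℝ} {y : E} (hk : ContDiffAt ℝ ∞ k (t, y)) :
    ContDiffAt ℝ ∞ (fun q : ℝ × E => fderiv ℝ (fun z => k (q.1, z)) q.2) (t, y) := by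
  have h1 : ContDiffAt ℝ ∞ (fun q => (fderiv ℝ k q).comp (ContinuousLinearMap.inr ℝ ℝ E)) (t, y) :=
    (hk.fderiv_right (m := ∞) (by norm_num)).clm_comp contDiffAt_const
  refine h1.congr_of_eventuallyEq ?_
  filter_upwards [(hk.of_le (m := 1) (by norm_num)).eventually (by simp)] with q hq
  exact fderiv_slice (hq.differentiableAt one_ne_zero)

/-- Mixed partial derivatives commute. -/
theorem hasDerivAt_fderiv_slice {k : ℝ × E → ℝ} {t : ℝ} {y : E} (hk : ContDiffAt ℝ ∞ k (t, y)) :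
    HasDerivAt (fun s => fderiv ℝ (fun z => k (s, z)) y)
      (fderiv ℝ (fun z => deriv (fun s => k (s, z)) t) y) t := by
  have hd : DifferentiableAt ℝ (fderiv ℝ k) (t, y) :=
    (hk.fderiv_right (m := ∞) (by norm_num)).differentiableAt (by norm_num)
  have hs : IsSymmSndFDerivAt ℝ k (t, y) :=
    hk.isSymmSndFDerivAt (by
      rw [minSmoothness_of_isRCLikeNormedField]
      exact WithTop.coe_le_coe.2 le_top)
  have hev : ∀ᶠ q in 𝓝 (t, y), DifferentiableAt ℝ k q := by
    filter_upwards [(hk.of_le (m := 1) (by norm_num)).eventually (by simp)] with q hq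
    exact hq.differentiableAt one_ne_zero
  have ht : Filter.Tendsto (fun s : ℝ => (s, y)) (𝓝 t) (𝓝 (t, y)) :=
    (Continuous.prodMk_left y).tendsto t
  have hz : Filter.Tendsto (fun z : E => (t, z)) (𝓝 y) (𝓝 (t, y)) :=
    (Continuous.prodMk_right t).tendsto y
  have h1 : HasDerivAt (fun s => (fderiv ℝ k (s, y)).comp (ContinuousLinearMap.inr ℝ ℝ E))
      ((fderiv ℝ (fderiv ℝ k) (t, y) (1, 0)).comp (ContinuousLinearMap.inr ℝ ℝ E)) t :=
    HasFDerivAt.comp_hasDerivAt t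
      (((ContinuousLinearMap.compL ℝ E (ℝ × E) ℝ).flip
        (ContinuousLinearMap.inr ℝ ℝ E)).hasFDerivAt) (hasDerivAt_slice hd)
  have h2 : HasFDerivAt (fun z => fderiv ℝ k (t, z) (1, 0))
      ((ContinuousLinearMap.apply ℝ ℝ ((1, 0) : ℝ × E)) ∘L
        ((fderiv ℝ (fderiv ℝ k) (t, y)).comp (ContinuousLinearMap.inr ℝ ℝ E))) y :=
    (ContinuousLinearMap.apply ℝ ℝ ((1, 0) : ℝ × E)).hasFDerivAt.comp y
      (hd.hasFDerivAt.comp y (hasFDerivAt_prodMk_right t y))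
  have h3 : fderiv ℝ (fun z => deriv (fun s => k (s, z)) t) y =
      (fderiv ℝ (fderiv ℝ k) (t, y) (1, 0)).comp (ContinuousLinearMap.inr ℝ ℝ E) := by
    have : (fun z => deriv (fun s => k (s, z)) t) =ᶠ[𝓝 y] fun z => fderiv ℝ k (t, z) (1, 0) :=
      (hz.eventually hev).mono fun z hz => (hasDerivAt_slice hz).deriv
    rw [this.fderiv_eq, h2.fderiv]
    ext v
    exact (hs.eq (1, 0) (0, v)).symm
  rw [h3]
  exact h1.congr_of_eventuallyEq ((ht.eventually hev).mono fun s hs => fderiv_slice hs)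

theorem contDiffAt_raise_comp {E V : Type*} [NormedAddCommGroup E] [NormedSpace ℝ E]
    [NormedAddCommGroup V] [NormedSpace ℝ V]
    [FiniteDimensional ℝ V] {n : WithTop ℕ∞} {w : E → V [⋀^Fin 2]→L[ℝ] ℝ} {a : E → V →L[ℝ] ℝ}
    {q : E} (hw : ContDiffAt ℝ n w q) (ha : ContDiffAt ℝ n a q)
    (h0 : ∀ v, (∀ u, w q ![v, u] = 0) → v = 0) :
    ContDiffAt ℝ n (fun q => raise (w q) (a q)) q :=
  ContDiffAt.comp (𝕜 := ℝ) (x := q)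
    (g := fun q : (V [⋀^Fin 2]→L[ℝ] ℝ) × (V →L[ℝ] ℝ) => raise q.1 q.2)
    (f := fun q => (w q, a q)) (contDiffAt_raise h0 (a q)) (hw.prodMk ha)

/-- Differentiation under the integral sign, for integrands supported in a fixed compact set. -/
theorem hasDerivAt_setIntegral [MeasurableSpace E] [BorelSpace E] [FiniteDimensional ℝ E]
    (μ : Measure E) [IsFiniteMeasureOnCompacts μ] {U K : Set E} (hU : IsOpen U) (hK : IsCompact K)
    (hKU : K ⊆ U) {k : ℝ × E → ℝ} (hk : ∀ t, ∀ y ∈ U, ContDiffAt ℝ 1 k (t, y))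
    (h0 : ∀ t, ∀ y ∈ U, y ∉ K → k (t, y) = 0) :
    HasDerivAt (fun t => ∫ y in U, k (t, y) ∂μ) (∫ y in U, deriv (fun t => k (t, y)) 0 ∂μ) 0 := by
  have hD : ∀ t, ∀ y ∈ U, ContinuousAt (fun q => fderiv ℝ k q (1, 0)) (t, y) := fun t y hy =>
    (((hk t y hy).fderiv_right (m := 0) (by norm_num)).continuousAt).clm_apply continuousAt_const
  have hder : ∀ t, ∀ y ∈ U, HasDerivAt (fun t => k (t, y)) (fderiv ℝ k (t, y) (1, 0)) t :=
    fun t y hy => hasDerivAt_slice ((hk t y hy).differentiableAt one_ne_zero)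
  -- The time derivative is bounded on [-1, 1] × K and zero off K, so C times the indicator of K
  -- dominates it.
  obtain ⟨C, hC⟩ := (isCompact_Icc.prod hK).exists_bound_of_continuousOn (s := Icc (-1 : ℝ) 1 ×ˢ K)
    (f := fun q => fderiv ℝ k q (1, 0))
    fun q hq => (hD q.1 q.2 (hKU hq.2)).continuousWithinAt
  have hcont : ∀ t, ContinuousOn (fun y => k (t, y)) U := fun t y hy =>
    ((hk t y hy).continuousAt.comp
      (Continuous.prodMk_right t).continuousAt).continuousWithinAt
  have h1 := hasDerivAt_integral_of_dominated_loc_of_deriv_le (μ := μ.restrict U)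
    (F := fun t y => k (t, y)) (F' := fun t y => fderiv ℝ k (t, y) (1, 0))
    (bound := K.indicator fun _ => C) (x₀ := (0 : ℝ)) (s := Icc (-1) 1)
    (Icc_mem_nhds (by norm_num) (by norm_num))
    (Filter.Eventually.of_forall fun t => (hcont t).aestronglyMeasurable hU.measurableSet)
    (integrableOn_of_compact μ hU hK hKU (hcont 0) (h0 0))
    (ContinuousOn.aestronglyMeasurable (fun y hy => ((hD 0 y hy).comp
      (f := fun y => ((0 : ℝ), y))
      (Continuous.prodMk_right (0 : ℝ)).continuousAt).continuousWithinAt) hU.measurableSet)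
    (ae_restrict_of_forall_mem hU.measurableSet fun y hy t ht => by
      by_cases hyK : y ∈ K
      · rw [indicator_of_mem hyK]
        exact hC (t, y) ⟨ht, hyK⟩
      · rw [indicator_of_notMem hyK, ← (hder t y hy).deriv]
        simp [h0 _ y hy hyK])
    ((integrable_indicator_iff hK.measurableSet).2
      (integrableOn_const
      ((Measure.le_iff'.1 Measure.restrict_le_self K).trans_lt hK.measure_lt_top).ne))
    (ae_restrict_of_forall_mem hU.measurableSet fun y hy t _ => hder t y hy)
  rw [setIntegral_congr_fun hU.measurableSet fun y hy => (hder 0 y hy).deriv]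
  exact h1.2

end Parametric

/-! ### First variation of the Dirichlet functional -/

section FirstVariation

variable {m : ℕ} {M : Type*} [TopologicalSpace M] [ChartedSpace (Model m) M]
  [IsManifold 𝓘(ℝ, Model m) ∞ M]

/-- A time-dependent function, in coordinates. -/
def chartFamily (u : ℝ → M → ℝ) (x : M) (q : ℝ × Model m) : ℝ :=
  u q.1 ((chartAt (Model m) x).symm q.2)

theorem SmoothFamily.contDiffAt {u : ℝ → M → ℝ} (hu : SmoothFamily m u) (x : M) (t : ℝ)
    {y : Model m} (hy : y ∈ (chartAt (Model m) x).target) :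
    ContDiffAt ℝ ∞ (chartFamily u x) (t, y) := by
  rw [← contMDiffAt_iff_contDiffAt, modelWithCornersSelf_prod, ← chartedSpaceSelf_prod]
  exact ContMDiffAt.comp (t, y) (hu (t, (chartAt (Model m) x).symm y))
    (contMDiffAt_fst.prodMk ((contMDiffAt_symm hy).comp (t, y) contMDiffAt_snd))

omit [IsManifold 𝓘(ℝ, Model m) ∞ M] in
theorem SmoothFamily.smoothFun {u : ℝ → M → ℝ} (hu : SmoothFamily m u) (t : ℝ) :
    SmoothFun m (u t) :=
  ContMDiff.comp (g := fun q : ℝ × M => u q.1 q.2) (f := fun p => (t, p)) hu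
    (contMDiff_const.prodMk contMDiff_id)

theorem SmoothFamily.smoothFun_deriv {u : ℝ → M → ℝ} (hu : SmoothFamily m u) (t : ℝ) :
    SmoothFun m (fun p => deriv (fun s => u s p) t) := by
  refine smoothFun_of_contDiffAt fun x y hy => ?_
  have hk := hu.contDiffAt x t hy
  have h1 : ContDiffAt ℝ ∞ (fun z => fderiv ℝ (chartFamily u x) (t, z) (1, 0)) y :=
    ContDiffAt.comp y ((hk.fderiv_right (m := ∞) (by norm_num)).clm_apply contDiffAt_const)
      (contDiffAt_const.prodMk contDiffAt_id)
  refine h1.congr_of_eventuallyEq ?_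
  filter_upwards [(chartAt (Model m) x).open_target.mem_nhds hy] with z hz
  exact (hasDerivAt_slice ((hu.contDiffAt x t hz).differentiableAt (by norm_num))).deriv

variable (Ω : SymplecticForm m M) (g : Metric m M)

theorem inner_sgrad_comp_symm {F G : M → ℝ} (hF : SmoothFun m F) (hG : SmoothFun m G) {x : M}
    {y : Model m} (hy : y ∈ (chartAt (Model m) x).target) :
    g.inner ((chartAt (Model m) x).symm y) (sgrad Ω F ((chartAt (Model m) x).symm y))
      (sgrad Ω G ((chartAt (Model m) x).symm y)) =
    chartMetric g x y (chartSgrad Ω x F y) (chartSgrad Ω x G y) := by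
  rw [← invD_chartSgrad Ω hy (hF.mdifferentiableAt _),
    ← invD_chartSgrad Ω hy (hG.mdifferentiableAt _)]
  rfl

theorem contDiffAt_chartSgrad_family {u : ℝ → M → ℝ} (hu : SmoothFamily m u) (x : M) (t : ℝ)
    {y : Model m} (hy : y ∈ (chartAt (Model m) x).target) :
    ContDiffAt ℝ ∞ (fun q : ℝ × Model m => chartSgrad Ω x (u q.1) q.2) (t, y) := by
  have h1 : ContDiffAt ℝ ∞ (fun q : ℝ × Model m => chartRep Ω.form x q.2) (t, y) :=
    ContDiffAt.comp (x := (t, y)) (g := chartRep Ω.form x) (f := Prod.snd)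
      (Ω.smooth.contDiffAt hy) contDiffAt_snd
  exact contDiffAt_raise_comp (q := (t, y)) h1 (contDiffAt_fderiv_slice (hu.contDiffAt x t hy))
    (nondegenerate_chartRep Ω hy)

/-- At a fixed point the Hamiltonian field is a continuous linear function of the differential, so
only mixed partial derivatives have to be exchanged. -/
theorem hasDerivAt_chartSgrad {u : ℝ → M → ℝ} (hu : SmoothFamily m u) (x : M) (t : ℝ)
    {y : Model m} (hy : y ∈ (chartAt (Model m) x).target) :
    HasDerivAt (fun s => chartSgrad Ω x (u s) y)
      (chartSgrad Ω x (fun p => deriv (fun s => u s p) t) y) t :=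
  ((bilinCLM (Model m) (chartRep Ω.form x y)).inverse).hasFDerivAt.comp_hasDerivAt t
    (hasDerivAt_fderiv_slice (hu.contDiffAt x t hy))

theorem hasDerivAt_inner_sgrad {u : ℝ → M → ℝ} (hu : SmoothFamily m u) (t : ℝ) (p : M) :
    HasDerivAt (fun s => g.inner p (sgrad Ω (u s) p) (sgrad Ω (u s) p))
      (2 * g.inner p (sgrad Ω (u t) p) (sgrad Ω (fun p => deriv (fun s => u s p) t) p)) t := by
  have hy := mem_chart_target (Model m) p
  have h1 := hasDerivAt_chartSgrad Ω hu p t hy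
  have h2 := ((chartMetric g p (chartAt (Model m) p p)).hasFDerivAt.comp_hasDerivAt t
    h1).clm_apply h1
  have hp : (chartAt (Model m) p).symm (chartAt (Model m) p p) = p :=
    (chartAt (Model m) p).left_inv (mem_chart_source _ p)
  have h3 := inner_sgrad_comp_symm Ω g (hu.smoothFun t) (hu.smoothFun_deriv t) hy
  have h4 : ∀ s, g.inner p (sgrad Ω (u s) p) (sgrad Ω (u s) p) =
      chartMetric g p (chartAt (Model m) p p) (chartSgrad Ω p (u s) (chartAt (Model m) p p))
        (chartSgrad Ω p (u s) (chartAt (Model m) p p)) := fun s => by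
    have h5 := inner_sgrad_comp_symm Ω g (hu.smoothFun s) (hu.smoothFun s) hy
    rwa [hp] at h5
  rw [hp] at h3
  simp only [h3, h4]
  refine h2.congr_deriv ?_
  exact (congrArg (· + _) (chartMetric_symm g p _ _ _)).trans (two_mul _).symm

variable [T2Space M] [CompactSpace M]

/-- Differentiation of the integral over `M` of a smooth time-dependent function. -/
theorem hasDerivAt_integralTop {f : ℝ → M → ℝ}
    (hf : ∀ x t, ∀ y ∈ (chartAt (Model m) x).target, ContDiffAt ℝ 1 (chartFamily f x) (t, y)) :
    HasDerivAt (fun t => integralTop Ω (f t))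
      (integralTop Ω (fun p => deriv (fun t => f t p) 0)) 0 := by
  simp only [integralTop_eq_sum]
  refine HasDerivAt.fun_sum fun x _ => ?_
  have hx := tsupport_chartPartition (m := m) x
  obtain ⟨h1, h2, h3⟩ := compact_chart_image hx
  have h4 := hasDerivAt_setIntegral volume (chartAt (Model m) x).open_target h1 h2
    (k := fun q => chartPartition m M x ((chartAt (Model m) x).symm q.2) * chartFamily f x q *
      |chartDensity Ω x q.2|)
    (fun t y hy => by
      have hd : ContDiffAt ℝ ∞ (fun y => |chartDensity Ω x y|) y :=
        (contDiffAt_chartDensity Ω hy).abs (chartDensity_ne_zero Ω hy)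
      have hd2 : ContDiffAt ℝ 1 (fun q : ℝ × Model m => |chartDensity Ω x q.2|) (t, y) :=
        ContDiffAt.comp (x := (t, y)) (f := Prod.snd) (g := fun y => |chartDensity Ω x y|)
          (hd.of_le (by norm_num)) contDiffAt_snd
      have hr : ContDiffAt ℝ 1 (fun q : ℝ × Model m =>
          chartPartition m M x ((chartAt (Model m) x).symm q.2)) (t, y) :=
        ContDiffAt.comp (x := (t, y)) (f := Prod.snd)
          (g := (fun p => chartPartition m M x p) ∘ (chartAt (Model m) x).symm)
          (((smooth_chartPartition x).contDiffAt hy).of_le (by norm_num)) contDiffAt_snd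
      exact (hr.mul (hf x t y hy)).mul hd2)
    (fun t y hy hyn => by
      have := image_eq_zero_of_notMem_tsupport (h3 y hy hyn)
      simp only [this, zero_mul])
  unfold chartIntegral
  refine h4.congr_deriv (Eq.symm ?_)
  refine setIntegral_congr_fun (chartAt (Model m) x).open_target.measurableSet fun y hy => ?_
  have h5 := hasDerivAt_slice ((hf x 0 y hy).differentiableAt one_ne_zero)
  have h6 := (h5.const_mul (chartPartition m M x ((chartAt (Model m) x).symm y))).mul_const
    |chartDensity Ω x y|
  rw [h6.deriv, ← h5.deriv]
  rfl

/-- The derivative of the Dirichlet functional along a smooth family. -/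
theorem hasDerivAt_dirichlet {u : ℝ → M → ℝ} (hu : SmoothFamily m u) :
    HasDerivAt (fun t => dirichlet Ω g (u t))
      (2 * integralTop Ω fun p => g.inner p (sgrad Ω (u 0) p)
        (sgrad Ω (fun p => deriv (fun s => u s p) 0) p)) 0 := by
  have h1 := hasDerivAt_integralTop Ω
    (f := fun t p => g.inner p (sgrad Ω (u t) p) (sgrad Ω (u t) p)) fun x t y hy => by
      have h2 : ContDiffAt ℝ ∞ (fun q : ℝ × Model m => chartMetric g x q.2
          (chartSgrad Ω x (u q.1) q.2) (chartSgrad Ω x (u q.1) q.2)) (t, y) :=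
        ((ContDiffAt.comp (x := (t, y)) (f := Prod.snd) (g := chartMetric g x)
          (contDiffAt_chartMetric g hy) contDiffAt_snd).clm_apply
          (contDiffAt_chartSgrad_family Ω hu x t hy)).clm_apply
          (contDiffAt_chartSgrad_family Ω hu x t hy)
      refine (h2.of_le (by norm_num)).congr_of_eventuallyEq ?_
      filter_upwards [(isOpen_univ.prod (chartAt (Model m) x).open_target).mem_nhds
        (⟨mem_univ t, hy⟩ : (t, y) ∈ univ ×ˢ (chartAt (Model m) x).target)] with q hq
      exact inner_sgrad_comp_symm Ω g (hu.smoothFun _) (hu.smoothFun _) hq.2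
  rw [← integralTop_const_mul]
  simp only [(hasDerivAt_inner_sgrad Ω g hu 0 _).deriv] at h1
  exact h1

/-- The first variation of the Dirichlet functional along a Hamiltonian isotopy. -/
theorem hasDerivAt_dirichlet_isotopy (hm : 1 ≤ m) {ψ : M → ℝ} (hψ : SmoothFun m ψ)
    {φ : ℝ → Diffeomorph 𝓘(ℝ, Model m) 𝓘(ℝ, Model m) M M ∞} {H : ℝ → M → ℝ}
    (hφ : IsHamiltonianIsotopy Ω φ H) :
    HasDerivAt (fun t => dirichlet Ω g (ψ ∘ φ t))
      (-(2 * m * integralTop Ω fun p => H 0 p * poisson Ω ψ (laplacian Ω g ψ) p)) 0 := by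
  have hu : SmoothFamily m (fun t => ψ ∘ φ t) := ContMDiff.comp hψ hφ.smooth_flow
  have h1 := hasDerivAt_dirichlet Ω g hu
  -- Chain rule: the velocity is dψ(sgrad H_0).
  have h2 : (fun p => deriv (fun s => (ψ ∘ φ s) p) 0) = poisson Ω ψ (H 0) := by
    funext p
    have h3 := (hψ.mdifferentiableAt (φ 0 p)).hasMFDerivAt.comp (0 : ℝ) (hφ.flow 0 p)
    let w : Model m := sgrad Ω (H 0) (φ 0 p)
    let A : Model m →L[ℝ] ℝ := dFun ψ (φ 0 p)
    have h4 : HasFDerivAt (fun s => ψ (φ s p)) (A.comp ((1 : ℝ →L[ℝ] ℝ).smulRight w)) 0 :=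
      h3.hasFDerivAt
    have h5 : deriv (fun s => ψ (φ s p)) 0 = A w := by
      rw [h4.hasDerivAt.deriv]
      simp
    refine h5.trans ((poisson_eq Ω ψ (H 0) (φ 0 p)).symm.trans ?_)
    rw [hφ.map_zero]
  have h5 : ψ ∘ φ 0 = ψ := by
    funext p
    simp [hφ.map_zero]
  have hH := hφ.smooth_hamiltonian.smoothFun 0
  rw [h2, h5, integralTop_inner_sgrad Ω hm g hψ (hψ.poisson Ω hH),
    integralTop_poisson_mul Ω hm hψ (hψ.laplacian g Ω) hH] at h1
  convert h1 using 1
  ring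

end FirstVariation

/-! ### Smoothness of composition with a fixed map on path spaces -/

section Superposition

variable {K : Type} [TopologicalSpace K] [CompactSpace K] {E F : Type} [NormedAddCommGroup E]
  [NormedSpace ℝ E] [NormedAddCommGroup F] [NormedSpace ℝ F]

variable (K E F) in
/-- Pointwise application, as a continuous bilinear map. -/
def pointwiseApply : C(K, E →L[ℝ] F) →L[ℝ] C(K, E) →L[ℝ] C(K, F) :=
  LinearMap.mkContinuous₂
    (LinearMap.mk₂ ℝ (fun (A : C(K, E →L[ℝ] F)) (h : C(K, E)) =>
        (⟨fun s => A s (h s), by fun_prop⟩ : C(K, F)))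
      (fun A B h => by ext s; simp) (fun c A h => by ext s; simp) (fun A h k => by ext s; simp)
      (fun c A h => by ext s; simp)) 1
    fun A h => by
      rw [one_mul]
      refine (ContinuousMap.norm_le _ (by positivity)).2 fun s => ?_
      exact ((A s).le_opNorm (h s)).trans (mul_le_mul (A.norm_coe_le_norm s) (h.norm_coe_le_norm s)
        (by positivity) (by positivity))

/-- Compact support makes f' uniformly continuous, so the mean value inequality bounds the remainder
uniformly along γ. -/
theorem hasFDerivAt_postcomp {f : E → F} (hf : ContDiff ℝ 1 f) (hc : HasCompactSupport f)
    (γ : C(K, E)) :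
    HasFDerivAt (fun γ : C(K, E) => (⟨f, hf.continuous⟩ : C(E, F)).comp γ)
      (pointwiseApply K E F
        ((⟨fderiv ℝ f, hf.continuous_fderiv one_ne_zero⟩ : C(E, E →L[ℝ] F)).comp γ)) γ := by
  have hu : UniformContinuous (fderiv ℝ f) :=
    (hc.fderiv (𝕜 := ℝ)).uniformContinuous_of_continuous (hf.continuous_fderiv one_ne_zero)
  rw [hasFDerivAt_iff_isLittleO_nhds_zero, Asymptotics.isLittleO_iff]
  intro c hc0
  obtain ⟨δ, hδ, h⟩ := Metric.uniformContinuous_iff.1 hu c hc0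
  filter_upwards [Metric.ball_mem_nhds (0 : C(K, E)) hδ] with k hk
  rw [mem_ball_zero_iff] at hk
  refine (ContinuousMap.norm_le _ (by positivity)).2 fun s => ?_
  have hks : ‖k s‖ < δ := (k.norm_coe_le_norm s).trans_lt hk
  have h1 := (convex_ball (γ s) δ).norm_image_sub_le_of_norm_hasFDerivWithin_le' (𝕜 := ℝ)
    (f := f) (f' := fderiv ℝ f) (φ := fderiv ℝ f (γ s)) (C := c) (x := γ s) (y := γ s + k s)
    (fun x _ => ((hf.differentiable one_ne_zero) x).hasFDerivAt.hasFDerivWithinAt)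
    (fun x hx => by
      rw [← dist_eq_norm]
      exact (h hx).le) (Metric.mem_ball_self hδ) (by simpa using hks)
  rw [add_sub_cancel_left] at h1
  exact h1.trans (mul_le_mul_of_nonneg_left (k.norm_coe_le_norm s) hc0.le)

/-- The derivative is a continuous linear image of the superposition operator of f', so the order
goes up by one. `F` varies in the induction because f' takes values in `E →L[ℝ] F`. -/
theorem contDiff_postcomp_nat (n : ℕ) : ∀ {F : Type} [NormedAddCommGroup F] [NormedSpace ℝ F]
    {f : E → F} (hf : ContDiff ℝ ∞ f) (_ : HasCompactSupport f),
    ContDiff ℝ n (fun γ : C(K, E) => (⟨f, hf.continuous⟩ : C(E, F)).comp γ) := by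
  induction n with
  | zero =>
    intro F _ _ f hf _
    exact contDiff_zero.2 (ContinuousMap.continuous_postcomp _)
  | succ n ih =>
    intro F _ _ f hf hc
    rw [Nat.cast_add, Nat.cast_one, contDiff_succ_iff_hasFDerivAt]
    have hf1 : ContDiff ℝ 1 f := hf.of_le (by norm_num)
    refine ⟨_, ?_, hasFDerivAt_postcomp hf1 hc⟩
    exact (pointwiseApply K E F).contDiff.comp
      (ih (hf.fderiv_right (m := ∞) (by norm_num)) (hc.fderiv (𝕜 := ℝ)))

/-- The superposition operator `γ ↦ f ∘ γ` of a compactly supported smooth map is smooth. -/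
theorem contDiff_postcomp {f : E → F} (hf : ContDiff ℝ ∞ f) (hc : HasCompactSupport f) :
    ContDiff ℝ ∞ (fun γ : C(K, E) => (⟨f, hf.continuous⟩ : C(E, F)).comp γ) :=
  contDiff_infty.2 fun n => contDiff_postcomp_nat n hf hc

end Superposition

/-! ### Local flows by the implicit function theorem -/

section LocalFlow

variable {E : Type} [NormedAddCommGroup E] [NormedSpace ℝ E] [CompleteSpace E]

/-- The interval on which the rescaled integral curves are parametrized. -/
abbrev FlowInterval : Type := Icc (-2 : ℝ) 2

/-- The extension of a path to the real line. -/
def extendPath (γ : C(FlowInterval, E)) (s : ℝ) : E := γ (projIcc (-2) 2 (by norm_num) s)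

omit [NormedSpace ℝ E] [CompleteSpace E] in
theorem continuous_extendPath (γ : C(FlowInterval, E)) : Continuous (extendPath γ) :=
  γ.continuous.comp continuous_projIcc

variable (E) in
/-- The primitive vanishing at zero, as a continuous linear operator. -/
def primitiveCLM : C(FlowInterval, E) →L[ℝ] C(FlowInterval, E) :=
  LinearMap.mkContinuous
    { toFun := fun γ => (⟨fun s => ∫ τ in (0 : ℝ)..s, extendPath γ τ,
        (intervalIntegral.continuous_primitive
          (fun a b => (continuous_extendPath γ).intervalIntegrable a b) 0).comp
          continuous_subtype_val⟩ : C(FlowInterval, E))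
      map_add' := fun γ η => by
        ext s
        exact intervalIntegral.integral_add ((continuous_extendPath γ).intervalIntegrable _ _)
          ((continuous_extendPath η).intervalIntegrable _ _)
      map_smul' := fun c γ => by
        ext s
        exact intervalIntegral.integral_smul c (extendPath γ) } 2
    fun γ => by
      refine (ContinuousMap.norm_le _ (by positivity)).2 fun s => ?_
      have h1 := intervalIntegral.norm_integral_le_of_norm_le_const (a := (0 : ℝ)) (b := s)
        (f := extendPath γ) (C := ‖γ‖) fun τ _ => γ.norm_coe_le_norm _
      refine h1.trans ?_
      rw [mul_comm, sub_zero]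
      exact mul_le_mul_of_nonneg_right (abs_le.2 s.2) (norm_nonneg _)

variable (E) in
/-- Constant paths, as a continuous linear operator. -/
def constPathCLM : E →L[ℝ] C(FlowInterval, E) :=
  LinearMap.mkContinuous
    { toFun := fun x => ContinuousMap.const _ x
      map_add' := fun _ _ => rfl
      map_smul' := fun _ _ => rfl } 1
    fun x => by
      rw [one_mul]
      exact (ContinuousMap.norm_le _ (norm_nonneg x)).2 fun s => le_rfl

/-- Smooth dependence of the integral curves of `ε f`, on a fixed interval, on `ε` near zero and on
the initial point. -/
theorem exists_contDiffAt_flow {f : E → E} (hf : ContDiff ℝ ∞ f) (hc : HasCompactSupport f)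
    (x₀ : E) : ∃ Γ : ℝ × E → C(FlowInterval, E), ContDiffAt ℝ ∞ Γ (0, x₀) ∧
      Γ (0, x₀) = constPathCLM E x₀ ∧ ∀ᶠ q in 𝓝 ((0 : ℝ), x₀),
        extendPath (Γ q) 0 = q.2 ∧
        ∀ s ∈ Ioo (-2 : ℝ) 2, HasDerivAt (extendPath (Γ q)) (q.1 • f (extendPath (Γ q) s)) s := by
  let N : C(FlowInterval, E) → C(FlowInterval, E) :=
    fun γ => (⟨f, hf.continuous⟩ : C(E, E)).comp γ
  have hN : ContDiff ℝ ∞ N := contDiff_postcomp hf hc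
  -- A zero of `G` at (ε, x) is a solution of the integral equation γ(s) = x + ε ∫_0^s f(γ).
  let G : (ℝ × E) × C(FlowInterval, E) → C(FlowInterval, E) :=
    fun q => q.2 - constPathCLM E q.1.2 - q.1.1 • primitiveCLM E (N q.2)
  have hG : ContDiff ℝ ∞ G := by
    refine (contDiff_snd.sub ((constPathCLM E).contDiff.comp (contDiff_snd.comp contDiff_fst))).sub
      ((contDiff_fst.comp contDiff_fst).smul ?_)
    exact (primitiveCLM E).contDiff.comp (hN.comp contDiff_snd)
  let u : (ℝ × E) × C(FlowInterval, E) := ((0, x₀), constPathCLM E x₀)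
  have hu : G u = 0 := by simp [G, u]
  -- At ε = 0 the integral term disappears and the derivative in γ is the identity.
  have hinv : (fderiv ℝ G u ∘L .inr ℝ (ℝ × E) C(FlowInterval, E)).IsInvertible := by
    have h1 : HasFDerivAt (fun γ => G ((0, x₀), γ))
        (fderiv ℝ G u ∘L .inr ℝ (ℝ × E) C(FlowInterval, E)) (constPathCLM E x₀) :=
      ((hG.differentiable (by norm_num)) u).hasFDerivAt.comp _ (hasFDerivAt_prodMk_right _ _)
    have h2 : HasFDerivAt (fun γ => G ((0, x₀), γ)) (.id ℝ C(FlowInterval, E))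
        (constPathCLM E x₀) := by
      have : (fun γ => G ((0, x₀), γ)) = fun γ => γ - constPathCLM E x₀ := by
        funext γ
        simp [G]
      rw [this]
      exact (hasFDerivAt_id _).sub_const _
    rw [h1.unique h2]
    exact ⟨.refl ℝ _, rfl⟩
  have hGu := hG.contDiffAt (x := u)
  refine ⟨hGu.implicitFunction (by norm_num) hinv,
    hGu.contDiffAt_implicitFunction (by norm_num) hinv,
    hGu.implicitFunction_apply_self (by norm_num) hinv, ?_⟩
  filter_upwards [hGu.eventually_apply_implicitFunction (by norm_num) hinv] with q hq
  set γ := hGu.implicitFunction (by norm_num) hinv q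
  rw [hu] at hq
  have hq2 : ∀ s : FlowInterval, γ s = q.2 + q.1 • ∫ τ in (0 : ℝ)..s, f (extendPath γ τ) := by
    intro s
    have h3 : γ s - q.2 - q.1 • ∫ τ in (0 : ℝ)..s, f (extendPath γ τ) = 0 :=
      congrArg (fun η : C(FlowInterval, E) => η s) hq
    rw [sub_sub, sub_eq_zero] at h3
    exact h3
  have hproj : ∀ s ∈ Icc (-2 : ℝ) 2,
      extendPath γ s = q.2 + q.1 • ∫ τ in (0 : ℝ)..s, f (extendPath γ τ) := by
    intro s hs
    rw [extendPath, hq2, projIcc_of_mem _ hs]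
  refine ⟨?_, fun s hs => ?_⟩
  · rw [hproj 0 (by norm_num)]
    simp
  · have hcf : Continuous (fun τ => f (extendPath γ τ)) :=
      hf.continuous.comp (continuous_extendPath γ)
    have h4 : HasDerivAt (fun s => q.2 + q.1 • ∫ τ in (0 : ℝ)..s, f (extendPath γ τ))
        (q.1 • f (extendPath γ s)) s :=
      ((hcf.integral_hasStrictDerivAt 0 s).hasDerivAt.const_smul q.1).const_add _
    refine h4.congr_of_eventuallyEq ?_
    filter_upwards [Icc_mem_nhds hs.1 hs.2] with τ hτ using hproj τ hτ

end LocalFlow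

/-! ### Global Hamiltonian flows on closed manifolds -/

section Flow

variable {m : ℕ} {M : Type*} [TopologicalSpace M] [ChartedSpace (Model m) M]
  [IsManifold 𝓘(ℝ, Model m) ∞ M] (Ω : SymplecticForm m M) {K : M → ℝ}

theorem contMDiff_sgrad (hK : SmoothFun m K) :
    ContMDiff 𝓘(ℝ, Model m) 𝓘(ℝ, Model m).tangent ∞
      (fun p => (⟨p, sgrad Ω K p⟩ : TangentBundle 𝓘(ℝ, Model m) M)) := by
  intro p
  have h1 := contMDiffOn_chartVector (x := p) (X := chartSgrad Ω p K)
    fun y hy => (contDiffAt_chartSgrad Ω hK hy).contDiffWithinAt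
  have h2 := h1.contMDiffAt ((chartAt (Model m) p).open_target.mem_nhds
    (mem_chart_target (Model m) p))
  have h3 := h2.comp p (contMDiffAt_chart (mem_chart_source (Model m) p))
  refine h3.congr_of_eventuallyEq ?_
  filter_upwards [(chartAt (Model m) p).open_source.mem_nhds (mem_chart_source _ p)] with q hq
  have h4 := (chartAt (Model m) p).left_inv hq
  have h5 := invD_chartSgrad Ω ((chartAt (Model m) p).map_source hq)
    (hK.mdifferentiableAt ((chartAt (Model m) p).symm (chartAt (Model m) p q)))
  refine Eq.symm ((congrArg (fun w => (⟨_, w⟩ : TangentBundle 𝓘(ℝ, Model m) M)) h5).trans ?_)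
  rw [h4]

/-- Every smooth vector field on an open set agrees near a given point with a compactly supported
smooth vector field. -/
theorem exists_contDiff_cutoff {E : Type*} [NormedAddCommGroup E] [InnerProductSpace ℝ E]
    [FiniteDimensional ℝ E] {U : Set E}
    (hU : IsOpen U) {X : E → E} (hX : ∀ y ∈ U, ContDiffAt ℝ ∞ X y) {y₀ : E} (hy₀ : y₀ ∈ U) :
    ∃ (f : E → E) (r : ℝ), 0 < r ∧ ContDiff ℝ ∞ f ∧ HasCompactSupport f ∧
      ∀ y ∈ Metric.ball y₀ r, y ∈ U ∧ f y = X y := by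
  obtain ⟨R, hR, hRU⟩ := Metric.nhds_basis_closedBall.mem_iff.1 (hU.mem_nhds hy₀)
  let χ : ContDiffBump y₀ := ⟨R / 2, R, by positivity, by linarith⟩
  have h0 : ∀ y ∈ U, y ∉ Metric.closedBall y₀ R → χ y • X y = 0 := fun y _ hy => by
    rw [χ.zero_of_le_dist (not_le.1 hy).le, zero_smul]
  have hc := isCompact_closedBall y₀ R
  refine ⟨U.indicator fun y => χ y • X y, R / 2, by positivity,
    contDiff_indicator hU hc hRU (fun y hy => χ.contDiffAt.smul (hX y hy)) h0,
    hasCompactSupport_indicator hc h0, fun y hy => ?_⟩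
  have hyU : y ∈ U := hRU (Metric.ball_subset_closedBall (Metric.ball_subset_ball (by linarith) hy))
  refine ⟨hyU, ?_⟩
  rw [indicator_of_mem hyU, χ.one_of_mem_closedBall (Metric.ball_subset_closedBall hy), one_smul]

/-- Near every point, the integral curves of `ε sgrad K` on a fixed interval depend smoothly on `ε`
near zero and on the initial point. -/
theorem exists_local_flow (hK : SmoothFun m K) (p₀ : M) :
    ∃ Φ : ℝ × M → M, ContMDiffAt (𝓘(ℝ, ℝ).prod 𝓘(ℝ, Model m)) 𝓘(ℝ, Model m) ∞ Φ (0, p₀) ∧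
      ∀ᶠ q in 𝓝 ((0 : ℝ), p₀), ∃ σ : ℝ → M, σ 0 = q.2 ∧ σ 1 = Φ q ∧
        IsMIntegralCurveOn (I := 𝓘(ℝ, Model m)) σ (q.1 • fun p => sgrad Ω K p) (Ioo (-2) 2) := by
  set y₀ := chartAt (Model m) p₀ p₀ with hy₀
  have hy₀U : y₀ ∈ (chartAt (Model m) p₀).target := mem_chart_target _ p₀
  obtain ⟨f, r, hr, hf, hfc, hfX⟩ := exists_contDiff_cutoff (chartAt (Model m) p₀).open_target
    (fun y hy => contDiffAt_chartSgrad Ω hK hy) hy₀U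
  obtain ⟨Γ, hΓ, hΓ0, hΓev⟩ := exists_contDiffAt_flow hf hfc y₀
  -- The flow at time ε is the value at parameter 1 of the curve with velocity ε sgrad K, and 1 is
  -- interior to [-2, 2].
  have one_mem : (1 : ℝ) ∈ Icc (-2 : ℝ) 2 := by norm_num
  have hchart : ContMDiffAt (𝓘(ℝ, ℝ).prod 𝓘(ℝ, Model m)) (𝓘(ℝ, ℝ).prod 𝓘(ℝ, Model m)) ∞
      (fun q : ℝ × M => (q.1, chartAt (Model m) p₀ q.2)) (0, p₀) :=
    contMDiffAt_fst.prodMk ((contMDiffAt_chart (mem_chart_source (Model m) p₀)).comp (0, p₀)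
      contMDiffAt_snd)
  have hev : ContDiffAt ℝ ∞ (fun q => Γ q ⟨1, one_mem⟩) (0, y₀) :=
    ContDiffAt.comp (𝕜 := ℝ) (x := ((0 : ℝ), y₀))
      (g := fun γ : C(FlowInterval, Model m) => γ ⟨1, one_mem⟩)
      (ContinuousMap.evalCLM ℝ ⟨1, one_mem⟩ :
        C(FlowInterval, Model m) →L[ℝ] Model m).contDiff.contDiffAt hΓ
  have hev2 : ContMDiffAt (𝓘(ℝ, ℝ).prod 𝓘(ℝ, Model m)) 𝓘(ℝ, Model m) ∞
      (fun q => Γ q ⟨1, one_mem⟩) (0, y₀) := by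
    rw [← contMDiffAt_iff_contDiffAt, modelWithCornersSelf_prod, ← chartedSpaceSelf_prod] at hev
    exact hev
  have hbase : Γ (0, y₀) ⟨1, one_mem⟩ = y₀ := by
    rw [hΓ0]
    rfl
  refine ⟨fun q => (chartAt (Model m) p₀).symm (Γ (q.1, chartAt (Model m) p₀ q.2) ⟨1, one_mem⟩),
    ?_, ?_⟩
  · refine ContMDiffAt.comp (I' := 𝓘(ℝ, Model m)) (0, p₀)
      (g := (chartAt (Model m) p₀).symm)
      (f := fun q : ℝ × M => Γ (q.1, chartAt (Model m) p₀ q.2) ⟨1, one_mem⟩) ?_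
      (ContMDiffAt.comp (0, p₀) (g := fun q => Γ q ⟨1, one_mem⟩) hev2 hchart)
    refine contMDiffAt_symm ?_
    rw [← hy₀, hbase]
    exact hy₀U
  · have hsrc : ∀ᶠ q in 𝓝 ((0 : ℝ), p₀), q.2 ∈ (chartAt (Model m) p₀).source :=
      continuousAt_snd.eventually ((chartAt (Model m) p₀).open_source.mem_nhds
        (mem_chart_source _ p₀))
    have hball : ∀ᶠ q in 𝓝 ((0 : ℝ), y₀), Γ q ∈ Metric.ball (constPathCLM _ y₀) r :=
      hΓ.continuousAt.eventually (by
        rw [hΓ0]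
        exact Metric.ball_mem_nhds _ hr)
    filter_upwards [hsrc, hchart.continuousAt.eventually (hΓev.and hball)] with q hq1 hq2
    obtain ⟨⟨hq2, hq3⟩, hq4⟩ := hq2
    set γ := Γ (q.1, chartAt (Model m) p₀ q.2)
    have hmem : ∀ s, extendPath γ s ∈ Metric.ball y₀ r := fun s =>
      (ContinuousMap.dist_apply_le_dist (f := γ) (g := constPathCLM _ y₀) _).trans_lt hq4
    refine ⟨fun s => (chartAt (Model m) p₀).symm (extendPath γ s), ?_, ?_, fun s hs => ?_⟩
    · simp only [hq2]
      exact (chartAt (Model m) p₀).left_inv hq1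
    · simp only [extendPath, projIcc_of_mem _ one_mem]
    · obtain ⟨h1, h2⟩ := hfX _ (hmem s)
      have h3 := ((contMDiffAt_symm h1).mdifferentiableAt (by norm_num)).hasMFDerivAt.comp s
        (hq3 s hs).hasFDerivAt.hasMFDerivAt
      refine HasMFDerivAt.hasMFDerivWithinAt ?_
      have h4 := invD_chartSgrad Ω h1
        (hK.mdifferentiableAt ((chartAt (Model m) p₀).symm (extendPath γ s)))
      let w : Model m := sgrad Ω K ((chartAt (Model m) p₀).symm (extendPath γ s))
      have h5 : (invD p₀ (extendPath γ s)).comp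
          ((1 : ℝ →L[ℝ] ℝ).smulRight (q.1 • f (extendPath γ s))) =
          (1 : ℝ →L[ℝ] ℝ).smulRight (q.1 • w) := by
        rw [h2]
        refine ContinuousLinearMap.ext_ring ?_
        simp only [ContinuousLinearMap.comp_apply, ContinuousLinearMap.smulRight_apply,
          one_apply_eq_self, one_smul, map_smul]
        exact congrArg (fun z : Model m => q.1 • z) h4
      exact h3.congr_mfderiv h5

variable [T2Space M]

/-- Hamiltonian vector fields on closed manifolds are complete. -/
theorem exists_integralCurve [CompactSpace M] (hK : SmoothFun m K) :
    ∃ φ : ℝ → M → M, (∀ p, φ 0 p = p) ∧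
      ∀ p, IsMIntegralCurve (I := 𝓘(ℝ, Model m)) (fun t => φ t p) (fun p => sgrad Ω K p) := by
  have hv := (contMDiff_sgrad Ω hK).of_le (m := 1) (by norm_num)
  have hev : ∀ᶠ ε in 𝓝 (0 : ℝ), ∀ p : M, ∃ σ : ℝ → M, σ 0 = p ∧
      IsMIntegralCurveOn (I := 𝓘(ℝ, Model m)) σ (ε • fun p => sgrad Ω K p) (Ioo (-2) 2) := by
    have := isCompact_univ.eventually_forall_of_forall_eventually
      (x₀ := (0 : ℝ)) (P := fun (ε : ℝ) (p : M) => ∃ σ : ℝ → M, σ 0 = p ∧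
      IsMIntegralCurveOn (I := 𝓘(ℝ, Model m)) σ (ε • fun p => sgrad Ω K p) (Ioo (-2) 2))
      fun p _ => by
        obtain ⟨Φ, -, h⟩ := exists_local_flow Ω hK p
        exact h.mono fun q ⟨σ, h1, _, h2⟩ => ⟨σ, h1, h2⟩
    simpa using this
  obtain ⟨δ, hδ, hball⟩ := Metric.eventually_nhds_iff.1 hev
  have hε : dist (δ / 2) 0 < δ := by
    rw [Real.dist_0_eq_abs, abs_of_pos (half_pos hδ)]
    linarith
  -- Velocity (δ/2) sgrad K on (-2, 2) becomes sgrad K on (-δ, δ); a lifetime independent of p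
  -- implies completeness.
  have hglob := exists_isMIntegralCurve_of_isMIntegralCurveOn hv hδ fun p => by
    obtain ⟨σ, h1, h2⟩ := hball hε p
    refine ⟨fun t => σ (t * (2 / δ)), by simpa using h1, ?_⟩
    have h3 := h2.comp_mul (2 / δ)
    have hδ2 : 2 / δ * (δ / 2) = 1 := by field_simp
    rw [smul_smul, hδ2, one_smul] at h3
    refine h3.mono fun t ht => ?_
    have h4 : t * (2 / δ) = 2 * (t / δ) := by ring
    have h5 : -1 < t / δ := by
      rw [lt_div_iff₀ hδ]
      linarith [ht.1]
    have h6 : t / δ < 1 := (div_lt_one hδ).2 ht.2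
    rw [mem_ofPred_eq, h4]
    constructor <;> linarith
  choose φ hφ0 hφ using hglob
  exact ⟨fun t p => φ p t, hφ0, hφ⟩

variable {Ω} {φ : ℝ → M → M}

theorem flow_add (hK : SmoothFun m K) (h0 : ∀ p, φ 0 p = p)
    (hφ : ∀ p, IsMIntegralCurve (I := 𝓘(ℝ, Model m)) (fun t => φ t p) (fun p => sgrad Ω K p))
    (s t : ℝ) (p : M) : φ (t + s) p = φ t (φ s p) := by
  have hv := (contMDiff_sgrad Ω hK).of_le (m := 1) (by norm_num)
  have h1 := isMIntegralCurve_Ioo_eq_of_contMDiff_boundaryless (t₀ := 0) hv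
    ((hφ p).comp_add s) (hφ (φ s p)) (by simp [h0])
  exact congrFun h1 t

/-- The curve s ↦ φ(sε) q has velocity ε sgrad K, so by uniqueness its value at s = 1 is that of the
smooth local flow. -/
theorem contMDiffAt_flow_zero (hK : SmoothFun m K) (h0 : ∀ p, φ 0 p = p)
    (hφ : ∀ p, IsMIntegralCurve (I := 𝓘(ℝ, Model m)) (fun t => φ t p) (fun p => sgrad Ω K p))
    (p : M) : ContMDiffAt (𝓘(ℝ, ℝ).prod 𝓘(ℝ, Model m)) 𝓘(ℝ, Model m) ∞
      (fun q : ℝ × M => φ q.1 q.2) (0, p) := by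
  have hv := (contMDiff_sgrad Ω hK).of_le (m := 1) (by norm_num)
  obtain ⟨Φ, hΦ, hev⟩ := exists_local_flow Ω hK p
  refine hΦ.congr_of_eventuallyEq (hev.mono ?_)
  rintro ⟨ε, q⟩ ⟨σ, h1, h2, h3⟩
  have h4 := (hφ q).comp_mul ε
  have h5 := isMIntegralCurveOn_Ioo_eqOn_of_contMDiff_boundaryless (t₀ := (0 : ℝ)) (a := -2) (b := 2)
    (by norm_num) (v := ε • fun p => sgrad Ω K p) ((contMDiff_const (c := ε)).smul_section hv) h3
    (h4.isMIntegralCurveOn _) (by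
      simp only [h1]
      simp [h0])
  have h6 := h5 (show (1 : ℝ) ∈ Ioo (-2 : ℝ) 2 by norm_num)
  rw [h2] at h6
  simpa using h6.symm

theorem contMDiff_flow [CompactSpace M] (hK : SmoothFun m K) (h0 : ∀ p, φ 0 p = p)
    (hφ : ∀ p, IsMIntegralCurve (I := 𝓘(ℝ, Model m)) (fun t => φ t p) (fun p => sgrad Ω K p)) :
    ContMDiff (𝓘(ℝ, ℝ).prod 𝓘(ℝ, Model m)) 𝓘(ℝ, Model m) ∞ (fun q : ℝ × M => φ q.1 q.2) := by
  -- Being C^n at a point is an open condition for finite n; with compactness it yields one time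
  -- interval good for all points.
  rw [contMDiff_infty]
  intro n
  have hn : ((n : ℕ) : WithTop ℕ∞) ≤ ∞ := by exact_mod_cast le_top
  have hsmall : ∀ᶠ t in 𝓝 (0 : ℝ), ContMDiff 𝓘(ℝ, Model m) 𝓘(ℝ, Model m) n (φ t) := by
    have := isCompact_univ.eventually_forall_of_forall_eventually
      (x₀ := (0 : ℝ)) (P := fun (t : ℝ) (p : M) => ContMDiffAt 𝓘(ℝ, Model m) 𝓘(ℝ, Model m) n (φ t) p)
      fun p _ => by
        have h1 := (contMDiffAt_iff_contMDiffAt_nhds (by simp)).1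
          ((contMDiffAt_flow_zero hK h0 hφ p).of_le hn)
        refine h1.mono fun q hq => ?_
        exact ContMDiffAt.comp (g := fun q : ℝ × M => φ q.1 q.2) (f := fun z => (q.1, z)) q.2 hq
          (contMDiffAt_const.prodMk contMDiffAt_id)
    exact this.mono fun t ht p => ht p (mem_univ p)
  have hmul : ∀ t, ContMDiff 𝓘(ℝ, Model m) 𝓘(ℝ, Model m) n (φ t) → ∀ k : ℕ,
      ContMDiff 𝓘(ℝ, Model m) 𝓘(ℝ, Model m) n (φ (k * t)) := by
    intro t ht k
    induction k with
    | zero =>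
      have : φ ((0 : ℕ) * t) = id := by
        funext p
        simp [h0]
      rw [this]
      exact contMDiff_id
    | succ k ih =>
      have : φ ((k + 1 : ℕ) * t) = φ t ∘ φ (k * t) := by
        funext p
        rw [Function.comp_apply, ← flow_add hK h0 hφ]
        push_cast
        ring_nf
      rw [this]
      exact ht.comp ih
  have hall : ∀ t, ContMDiff 𝓘(ℝ, Model m) 𝓘(ℝ, Model m) n (φ t) := by
    intro t
    -- Any φ_t is the k-th iterate of φ_{t/k}, and t/k is small for large k.
    have ht : Filter.Tendsto (fun k : ℕ => t / k) Filter.atTop (𝓝 0) :=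
      tendsto_const_div_atTop_nhds_zero_nat t
    obtain ⟨k, hk1, hk2⟩ := ((ht.eventually hsmall).and (Filter.eventually_gt_atTop 0)).exists
    have h2 := hmul _ hk1 k
    rwa [mul_div_cancel₀ t (by exact_mod_cast hk2.ne')] at h2
  rintro ⟨t, p⟩
  -- The group law moves joint smoothness at time t back to time 0.
  have h3 : (fun q : ℝ × M => φ q.1 q.2) = fun q : ℝ × M => φ (q.1 - t) (φ t q.2) := by
    funext q
    rw [← flow_add hK h0 hφ, sub_add_cancel]
  rw [h3]
  refine ContMDiffAt.comp (I' := 𝓘(ℝ, ℝ).prod 𝓘(ℝ, Model m)) (g := fun q : ℝ × M => φ q.1 q.2)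
    (f := fun q : ℝ × M => (q.1 - t, φ t q.2)) (t, p) ?_ ?_
  · simpa using (contMDiffAt_flow_zero hK h0 hφ (φ t p)).of_le hn
  · have h4 : ContMDiffAt (𝓘(ℝ, ℝ).prod 𝓘(ℝ, Model m)) 𝓘(ℝ, ℝ) n
        (fun q : ℝ × M => q.1 - t) (t, p) := contMDiffAt_fst.sub contMDiffAt_const
    exact h4.prodMk ((hall t).contMDiffAt.comp (t, p)
      contMDiffAt_snd)

variable (Ω) in
/-- Every smooth function is the Hamiltonian of a Hamiltonian isotopy. -/
theorem exists_isHamiltonianIsotopy [CompactSpace M] (hK : SmoothFun m K) :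
    ∃ φ, IsHamiltonianIsotopy Ω φ (fun _ => K) := by
  obtain ⟨φ, h0, hφ⟩ := exists_integralCurve Ω hK
  have hs := contMDiff_flow hK h0 hφ
  have hst : ∀ t, ContMDiff 𝓘(ℝ, Model m) 𝓘(ℝ, Model m) ∞ (φ t) := fun t =>
    hs.comp (f := fun p => (t, p)) (contMDiff_const.prodMk contMDiff_id)
  refine ⟨fun t => ⟨⟨φ t, φ (-t), fun p => ?_, fun p => ?_⟩, hst t, hst (-t)⟩, ?_, hs, h0,
    fun t p => hφ p t⟩
  · rw [← flow_add hK h0 hφ, neg_add_cancel, h0]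
  · rw [← flow_add hK h0 hφ, add_neg_cancel, h0]
  · exact ContMDiff.comp (g := K) (f := fun q : ℝ × M => q.2) hK contMDiff_snd

end Flow

/-! ### Composition of Hamiltonian diffeomorphisms -/

section Concatenation

variable {m : ℕ} {M : Type*} [TopologicalSpace M] [ChartedSpace (Model m) M]
  {Ω : SymplecticForm m M}

theorem twoForm_sub_smul {V : Type*} [NormedAddCommGroup V] [NormedSpace ℝ V]
    (A : V [⋀^Fin 2]→L[ℝ] ℝ) (u v : V) (c : ℝ) (w : V) :
    A ![u - c • v, w] = A ![u, w] - c * A ![v, w] := by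
  simp only [← bilinCLM_apply, map_sub, map_smul, _root_.sub_apply, _root_.smul_apply, smul_eq_mul]

theorem sgrad_eq_smul {F G : M → ℝ} {p : M} {c : ℝ} (h : dFun (m := m) F p = c • dFun G p) :
    sgrad Ω F p = c • sgrad Ω G p := by
  rw [← sub_eq_zero]
  refine Ω.nondegenerate p _ fun w => ?_
  have h1 : Ω.form p ![sgrad Ω F p - c • sgrad Ω G p, w] =
      Ω.form p ![sgrad Ω F p, w] - c * Ω.form p ![sgrad Ω G p, w] :=
    twoForm_sub_smul (V := Model m) (Ω.form p) _ _ c w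
  rw [h1, sgrad_spec, sgrad_spec, h]
  exact sub_self _

theorem IsHamiltonianIsotopy.hasMFDerivAt_comp
    {φ : ℝ → Diffeomorph 𝓘(ℝ, Model m) 𝓘(ℝ, Model m) M M ∞} {H : ℝ → M → ℝ}
    (hφ : IsHamiltonianIsotopy Ω φ H) {a : ℝ → ℝ} {a' s : ℝ} (ha : HasDerivAt a a' s) (x : M) :
    HasMFDerivAt 𝓘(ℝ, ℝ) 𝓘(ℝ, Model m) (fun τ => φ (a τ) x) s
      ((1 : ℝ →L[ℝ] ℝ).smulRight (a' • sgrad Ω (H (a s)) (φ (a s) x))) := by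
  have h1 := (hφ.flow (a s) x).comp s ha.hasFDerivAt.hasMFDerivAt
  let w : Model m := sgrad Ω (H (a s)) (φ (a s) x)
  have h2 : ((1 : ℝ →L[ℝ] ℝ).smulRight w).comp (ContinuousLinearMap.toSpanSingleton ℝ a') =
      (1 : ℝ →L[ℝ] ℝ).smulRight (a' • w) := by
    refine ContinuousLinearMap.ext_ring ?_
    simp
  exact h1.congr_mfderiv h2

/-- The composition of Hamiltonian diffeomorphisms is Hamiltonian. -/
theorem IsHamiltonianIsotopy.isHamiltonianDiffeo_trans
    {φ φ' : ℝ → Diffeomorph 𝓘(ℝ, Model m) 𝓘(ℝ, Model m) M M ∞} {H H' : ℝ → M → ℝ}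
    (hφ : IsHamiltonianIsotopy Ω φ H) (hφ' : IsHamiltonianIsotopy Ω φ' H') (t : ℝ) :
    IsHamiltonianDiffeo Ω ((φ t).trans (φ' 1)) := by
  -- Two smooth clocks: `a` runs φ from time 0 to t during [0, 1/3], and `b` runs φ' from 0 to 1
  -- during [2/3, 1].
  let a : ℝ → ℝ := fun s => t * Real.smoothTransition (3 * s)
  let b : ℝ → ℝ := fun s => Real.smoothTransition (3 * s - 2)
  have hac : ContDiff ℝ ∞ a := contDiff_const.mul
    (Real.smoothTransition.contDiff.comp (contDiff_const.mul contDiff_id))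
  have hbc : ContDiff ℝ ∞ b :=
    Real.smoothTransition.contDiff.comp ((contDiff_const.mul contDiff_id).sub contDiff_const)
  have ha0 : a 0 = 0 := by simp [a, Real.smoothTransition.zero_of_nonpos]
  have hb0 : ∀ s, s < 2 / 3 → b s = 0 := fun s hs =>
    Real.smoothTransition.zero_of_nonpos (by linarith)
  have ha1 : ∀ s, 1 / 3 < s → a s = t := fun s hs => by
    simp only [a]
    rw [Real.smoothTransition.one_of_one_le (by linarith), mul_one]
  have hb1 : b 1 = 1 := Real.smoothTransition.one_of_one_le (by norm_num)
  have had : ∀ s, HasDerivAt a (deriv a s) s := fun s =>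
    (hac.differentiable (by norm_num) s).hasDerivAt
  have hbd : ∀ s, HasDerivAt b (deriv b s) s := fun s =>
    (hbc.differentiable (by norm_num) s).hasDerivAt
  have hda : ∀ s, 1 / 3 < s → deriv a s = 0 := fun s hs => by
    have : a =ᶠ[𝓝 s] fun _ => t := by
      filter_upwards [lt_mem_nhds hs] with τ hτ using ha1 τ hτ
    rw [this.deriv_eq, deriv_const]
  have hdb : ∀ s, s < 2 / 3 → deriv b s = 0 := fun s hs => by
    have : b =ᶠ[𝓝 s] fun _ => 0 := by
      filter_upwards [gt_mem_nhds hs] with τ hτ using hb0 τ hτ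
    rw [this.deriv_eq, deriv_const]
  have hfam : ∀ (c : ℝ → ℝ) (F : ℝ → M → ℝ), ContDiff ℝ ∞ c → SmoothFamily m F →
      SmoothFamily m (fun s p => deriv c s * F (c s) p) := fun c F hc hF => by
    have h1 : ContMDiff (𝓘(ℝ, ℝ).prod 𝓘(ℝ, Model m)) 𝓘(ℝ, ℝ) ∞ (fun q : ℝ × M => deriv c q.1) :=
      (contDiff_infty_iff_deriv.1 hc).2.contMDiff.comp contMDiff_fst
    have h2 : ContMDiff (𝓘(ℝ, ℝ).prod 𝓘(ℝ, Model m)) 𝓘(ℝ, ℝ) ∞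
        (fun q : ℝ × M => F (c q.1) q.2) :=
      ContMDiff.comp (g := fun q : ℝ × M => F q.1 q.2) (f := fun q : ℝ × M => (c q.1, q.2)) hF
        ((hc.contMDiff.comp contMDiff_fst).prodMk contMDiff_snd)
    exact ContMDiff.mul h1 h2
  have hflow : ∀ (c : ℝ → ℝ) (χ : ℝ → Diffeomorph 𝓘(ℝ, Model m) 𝓘(ℝ, Model m) M M ∞),
      ContDiff ℝ ∞ c → ContMDiff (𝓘(ℝ, ℝ).prod 𝓘(ℝ, Model m)) 𝓘(ℝ, Model m) ∞
        (fun q : ℝ × M => χ q.1 q.2) → ContMDiff (𝓘(ℝ, ℝ).prod 𝓘(ℝ, Model m))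
          (𝓘(ℝ, ℝ).prod 𝓘(ℝ, Model m)) ∞ (fun q : ℝ × M => (q.1, χ (c q.1) q.2)) :=
    fun c χ hc hχ => contMDiff_fst.prodMk
      (ContMDiff.comp (g := fun q : ℝ × M => χ q.1 q.2) (f := fun q : ℝ × M => (c q.1, q.2)) hχ
        ((hc.contMDiff.comp contMDiff_fst).prodMk contMDiff_snd))
  refine ⟨fun s => (φ (a s)).trans (φ' (b s)),
    fun s p => deriv a s * H (a s) p + deriv b s * H' (b s) p, ⟨?_, ?_, ?_, ?_⟩, ?_⟩
  · exact ContMDiff.add (hfam a H hac hφ.smooth_hamiltonian) (hfam b H' hbc hφ'.smooth_hamiltonian)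
  · exact contMDiff_snd.comp ((hflow b φ' hbc hφ'.smooth_flow).comp
      (hflow a φ hac hφ.smooth_flow))
  · intro x
    change φ' (b 0) (φ (a 0) x) = x
    rw [ha0, hb0 0 (by norm_num), hφ.map_zero, hφ'.map_zero]
  · intro s x
    have hH : ∀ p, MDifferentiableAt 𝓘(ℝ, Model m) 𝓘(ℝ, ℝ) (H (a s)) p :=
      (hφ.smooth_hamiltonian.smoothFun _).mdifferentiableAt
    have hH' : ∀ p, MDifferentiableAt 𝓘(ℝ, Model m) 𝓘(ℝ, ℝ) (H' (b s)) p :=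
      (hφ'.smooth_hamiltonian.smoothFun _).mdifferentiableAt
    change HasMFDerivAt 𝓘(ℝ, ℝ) 𝓘(ℝ, Model m) (fun τ => φ' (b τ) (φ (a τ) x)) s
      ((1 : ℝ →L[ℝ] ℝ).smulRight (sgrad Ω (fun p => deriv a s * H (a s) p + deriv b s * H' (b s) p)
        (φ' (b s) (φ (a s) x))))
    -- Near each s at least one clock stands still, so only one term of the Hamiltonian survives.
    rcases lt_or_ge s (2 / 3) with hs | hs
    · have h1 : (fun τ => φ' (b τ) (φ (a τ) x)) =ᶠ[𝓝 s] fun τ => φ (a τ) x := by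
        filter_upwards [gt_mem_nhds hs] with τ hτ
        rw [hb0 τ hτ, hφ'.map_zero]
      have h2 : (fun p => deriv a s * H (a s) p + deriv b s * H' (b s) p) =
          fun p => deriv a s * H (a s) p := by
        funext p
        rw [hdb s hs, zero_mul, add_zero]
      rw [hb0 s hs, hφ'.map_zero, ← hb0 s hs, h2,
        sgrad_eq_smul (c := deriv a s) (G := H (a s)) (by
          ext w
          exact dFun_const_mul _ w (hH _))]
      exact (hφ.hasMFDerivAt_comp (had s) x).congr_of_eventuallyEq h1
    · have hs' : 1 / 3 < s := by linarith
      have h1 : (fun τ => φ' (b τ) (φ (a τ) x)) =ᶠ[𝓝 s] fun τ => φ' (b τ) (φ t x) := by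
        filter_upwards [lt_mem_nhds hs'] with τ hτ
        rw [ha1 τ hτ]
      have h2 : (fun p => deriv a s * H (a s) p + deriv b s * H' (b s) p) =
          fun p => deriv b s * H' (b s) p := by
        funext p
        rw [hda s hs', zero_mul, zero_add]
      rw [h2, ha1 s hs', sgrad_eq_smul (c := deriv b s) (G := H' (b s)) (by
          ext w
          exact dFun_const_mul _ w (hH' _))]
      exact (hφ'.hasMFDerivAt_comp (hbd s) (φ t x)).congr_of_eventuallyEq h1
  · simp only [ha1 1 (by norm_num), hb1]

theorem comp_isotopy_mem_hamOrbit {ψ₀ ψ : M → ℝ} (hψ : ψ ∈ hamOrbit Ω ψ₀)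
    {φ : ℝ → Diffeomorph 𝓘(ℝ, Model m) 𝓘(ℝ, Model m) M M ∞} {H : ℝ → M → ℝ}
    (hφ : IsHamiltonianIsotopy Ω φ H) (t : ℝ) : ψ ∘ φ t ∈ hamOrbit Ω ψ₀ := by
  obtain ⟨_, ⟨φ', H', hφ', rfl⟩, rfl⟩ := hψ
  exact ⟨_, hφ.isHamiltonianDiffeo_trans hφ' t, rfl⟩

end Concatenation

/-! ### Extremals, steady fields and minimizers -/

section Extremals

variable {m : ℕ} {M : Type*} [TopologicalSpace M] [ChartedSpace (Model m) M]
  [IsManifold 𝓘(ℝ, Model m) ∞ M] {Ω : SymplecticForm m M} {g : Metric m M} {ψ₀ ψ : M → ℝ}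

omit [IsManifold 𝓘(ℝ, Model m) ∞ M] in
theorem smoothFun_of_mem_hamOrbit (hψ₀ : SmoothFun m ψ₀) (hψ : ψ ∈ hamOrbit Ω ψ₀) :
    SmoothFun m ψ := by
  obtain ⟨f, -, rfl⟩ := hψ
  exact ContMDiff.comp hψ₀ f.contMDiff

/-- The vorticity of a constant family has zero time derivative, and derivatives are unique; -L_v ν
is {ψ, ν}. -/
theorem isSteadyHamiltonian_iff (hψ : SmoothFun m ψ) :
    IsSteadyHamiltonian Ω g ψ ↔ ∀ p, poisson Ω ψ (laplacian Ω g ψ) p = 0 := by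
  have h1 : ∀ p, -(dFun (vorticity Ω g (sgrad Ω ψ)) p (sgrad Ω ψ p)) =
      poisson Ω ψ (laplacian Ω g ψ) p := fun p => by
    rw [poisson_antisymm, poisson_eq]
    rfl
  constructor
  · intro h p
    rw [← h1]
    exact (h.2 0 p).unique (hasDerivAt_const 0 _)
  · intro h
    refine ⟨ContMDiff.comp (g := ψ) (f := fun q : ℝ × M => q.2) hψ contMDiff_snd, fun t p => ?_⟩
    rw [h1, h]
    exact hasDerivAt_const t _

variable [T2Space M] [CompactSpace M]

theorem isExtremal_iff (hm : 1 ≤ m) (hψ₀ : SmoothFun m ψ₀) (hψ : ψ ∈ hamOrbit Ω ψ₀) :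
    IsExtremal Ω g ψ₀ ψ ↔ ∀ p, poisson Ω ψ (laplacian Ω g ψ) p = 0 := by
  have hs := smoothFun_of_mem_hamOrbit hψ₀ hψ
  have hP := hs.poisson Ω (hs.laplacian g Ω)
  constructor
  · intro h
    -- Testing with the Hamiltonian {ψ, Δψ} itself makes the first variation -2m ∫ {ψ, Δψ}² ω^m.
    obtain ⟨φ, hφ⟩ := exists_isHamiltonianIsotopy Ω hP
    have h1 := (h.2 φ _ hφ).unique (hasDerivAt_dirichlet_isotopy Ω g hm hs hφ)
    have hm0 : (m : ℝ) ≠ 0 := by exact_mod_cast (by omega : m ≠ 0)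
    have h2 : integralTop Ω (fun p => poisson Ω ψ (laplacian Ω g ψ) p *
        poisson Ω ψ (laplacian Ω g ψ) p) = 0 := by
      have h3 := neg_eq_zero.1 h1.symm
      exact (mul_eq_zero.1 h3).resolve_left (mul_ne_zero two_ne_zero hm0)
    intro p
    exact mul_self_eq_zero.1 (eq_zero_of_integralTop_eq_zero Ω
      (continuous_of_smoothFun (hP.mul hP)) (fun p => mul_self_nonneg _) h2 p)
  · intro h
    refine ⟨hψ, fun φ H hφ => ?_⟩
    have h1 := hasDerivAt_dirichlet_isotopy Ω g hm hs hφ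
    have h2 := integralTop_const_mul Ω 0 (fun _ : M => (0 : ℝ))
    simp only [zero_mul] at h2
    simpa only [h, mul_zero, h2, neg_zero] using h1

theorem isExtremal_of_isMinimizer (hm : 1 ≤ m) (hψ₀ : SmoothFun m ψ₀)
    (h : IsMinimizer Ω g ψ₀ ψ) : IsExtremal Ω g ψ₀ ψ := by
  have hs := smoothFun_of_mem_hamOrbit hψ₀ h.1
  refine ⟨h.1, fun φ H hφ => ?_⟩
  have h1 := hasDerivAt_dirichlet_isotopy Ω g hm hs hφ
  have h0 : ψ ∘ φ 0 = ψ := by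
    funext p
    simp [hφ.map_zero]
  have hmin : IsLocalMin (fun t => dirichlet Ω g (ψ ∘ φ t)) 0 :=
    Filter.Eventually.of_forall fun t => by
      simp only [h0]
      exact h.2 _ (comp_isotopy_mem_hamOrbit h.1 hφ t)
  rwa [hmin.hasDerivAt_eq_zero h1] at h1

end Extremals

/-! ### Determinants of bilinear forms and their derivatives -/

section Determinants

/-- The derivative involves only A(t) and A'(t), so the path may be replaced by any other with the
same value and velocity. -/
theorem hasDerivAt_det {n : Type*} [Fintype n] [DecidableEq n] {A : ℝ → Matrix n n ℝ}
    {A' : Matrix n n ℝ} {t : ℝ} (h : ∀ i j, HasDerivAt (fun s => A s i j) (A' i j) t) :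
    HasDerivAt (fun s => (A s).det) (∑ σ : Equiv.Perm n, ((Equiv.Perm.sign σ : ℤ) : ℝ) *
      ∑ i, (∏ j ∈ Finset.univ.erase i, A t (σ j) j) • A' (σ i) i) t := by
  simp only [Matrix.det_apply']
  exact HasDerivAt.fun_sum fun σ _ =>
    (HasDerivAt.fun_finsetProd fun i _ => h (σ i) i).const_mul _

/-- Jacobi's formula along a path `A` with `A' = B A`. -/
theorem hasDerivAt_det_of_eq_mul {n : Type*} [Fintype n] [DecidableEq n] {A : ℝ → Matrix n n ℝ}
    {B : Matrix n n ℝ} (h : ∀ i j, HasDerivAt (fun s => A s i j) ((B * A 0) i j) 0) :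
    HasDerivAt (fun s => (A s).det) (B.trace * (A 0).det) 0 := by
  -- The comparison path (1 + sB) A(0) has the same value and velocity at 0, and a determinant that
  -- factors.
  have h1 := hasDerivAt_det (A := fun s => (1 + s • B) * A 0) (A' := B * A 0) (t := 0)
    fun i j => by
      have h2 : (fun s : ℝ => ((1 + s • B) * A 0) i j) = fun s => A 0 i j + s * (B * A 0) i j := by
        funext s
        simp [add_mul]
      rw [h2]
      simpa using ((hasDerivAt_id (0 : ℝ)).mul_const ((B * A 0) i j)).const_add (A 0 i j)
  have h3 : HasDerivAt (fun s : ℝ => ((1 + s • B) * A 0).det) (B.trace * (A 0).det) 0 := by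
    simp only [Matrix.det_mul]
    exact (hasDerivAt_det_one_add_smul B).mul_const _
  have h5 := hasDerivAt_det h
  have h6 := h1.unique h3
  simp only [zero_smul, add_zero, one_mul] at h6
  rwa [h6] at h5

variable {m : ℕ}

/-- The matrix of a bilinear form in the standard basis. -/
def formMatrix (B : Model m →L[ℝ] Model m →L[ℝ] ℝ) : Matrix (Fin (2 * m)) (Fin (2 * m)) ℝ :=
  Matrix.of fun i j => B (stdBasis m i) (stdBasis m j)

/-- The matrix of an endomorphism in the standard basis. -/
def endMatrix (T : Model m →L[ℝ] Model m) : Matrix (Fin (2 * m)) (Fin (2 * m)) ℝ :=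
  LinearMap.toMatrix (modelBasis m) (modelBasis m) (T : Model m →ₗ[ℝ] Model m)

theorem formMatrix_eq_mul {B C : Model m →L[ℝ] Model m →L[ℝ] ℝ} {T : Model m →L[ℝ] Model m}
    (h : ∀ u v, C u v = B (T u) v) : formMatrix C = (endMatrix T).transpose * formMatrix B := by
  ext i j
  have h1 : T (stdBasis m i) = ∑ k, endMatrix T k i • stdBasis m k := by
    have h2 := (modelBasis m).sum_repr (T (stdBasis m i))
    simp only [coe_modelBasis] at h2
    rw [← h2]
    refine Finset.sum_congr rfl fun k _ => ?_
    rw [endMatrix, LinearMap.toMatrix_apply, coe_modelBasis]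
    rfl
  simp only [formMatrix, Matrix.of_apply, Matrix.mul_apply, Matrix.transpose_apply]
  rw [h, h1, map_sum]
  simp

theorem endMatrix_mul_self {J : Model m →L[ℝ] Model m} (hJ : ∀ v, J (J v) = -v) :
    (endMatrix J).det ^ 2 = 1 := by
  have h1 : endMatrix J * endMatrix J = -1 := by
    rw [endMatrix, ← LinearMap.toMatrix_comp]
    have : (J : Model m →ₗ[ℝ] Model m) ∘ₗ (J : Model m →ₗ[ℝ] Model m) = -LinearMap.id := by
      ext v
      simp [hJ]
    rw [this, map_neg, LinearMap.toMatrix_id]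
  rw [sq, ← Matrix.det_mul, h1, Matrix.det_neg]
  simp

theorem det_formMatrix_pos {B : Model m →L[ℝ] Model m →L[ℝ] ℝ} (hs : ∀ u v, B u v = B v u)
    (hB : ∀ v, v ≠ 0 → 0 < B v v) : 0 < (formMatrix B).det := by
  refine (Matrix.PosDef.of_dotProduct_mulVec_pos ?_ fun x hx => ?_).det_pos
  · ext i j
    simp [formMatrix, hs (stdBasis m i)]
  · have h1 : star x ⬝ᵥ (formMatrix B).mulVec x =
        B (∑ i, x i • stdBasis m i) (∑ j, x j • stdBasis m j) := by
      simp only [dotProduct, Matrix.mulVec, formMatrix, Matrix.of_apply, map_sum, map_smul,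
        _root_.sum_apply, _root_.smul_apply, smul_eq_mul]
      simp only [Finset.mul_sum]
      rw [Finset.sum_comm]
      refine Finset.sum_congr rfl fun j _ => Finset.sum_congr rfl fun i _ => ?_
      simp only [Pi.star_apply, star_trivial]
      ring
    rw [h1]
    refine hB _ fun h0 => hx ?_
    have h2 := (modelBasis m).linearIndependent
    rw [coe_modelBasis] at h2
    exact funext (Fintype.linearIndependent_iff.1 h2 x h0)

end Determinants

/-! ### Compatible metrics and the Laplace-Beltrami operator -/

section Compatible

variable {m : ℕ} {M : Type*} [TopologicalSpace M] [ChartedSpace (Model m) M]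
  [IsManifold 𝓘(ℝ, Model m) ∞ M] (Ω : SymplecticForm m M) (g : Metric m M)

theorem chartMetric_pos {x : M} {y : Model m} (hy : y ∈ (chartAt (Model m) x).target)
    {v : Model m} (hv : v ≠ 0) : 0 < chartMetric g x y v v := by
  refine g.pos ((chartAt (Model m) x).symm y) (invD x y v) fun h => hv ?_
  have h2 := chartD_invD_apply hy v
  rw [← h2]
  exact (congrArg (chartD x ((chartAt (Model m) x).symm y)) h).trans (map_zero _)

theorem gram_eq_formMatrix (x : M) (y : Model m) :
    gram g x y = formMatrix (chartMetric g x y) := rfl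

theorem det_gram_pos {x : M} {y : Model m} (hy : y ∈ (chartAt (Model m) x).target) :
    0 < (gram g x y).det := by
  rw [gram_eq_formMatrix]
  exact det_formMatrix_pos (chartMetric_symm g x y) fun v hv => chartMetric_pos g hy hv

theorem isInvertible_of_pos {V : Type*} [NormedAddCommGroup V] [NormedSpace ℝ V]
    [FiniteDimensional ℝ V] {B : V →L[ℝ] V →L[ℝ] ℝ} (hB : ∀ v, v ≠ 0 → 0 < B v v) :
    B.IsInvertible := by
  have hinj : Function.Injective (B : V →ₗ[ℝ] (V →L[ℝ] ℝ)) := by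
    rw [← LinearMap.ker_eq_bot, LinearMap.ker_eq_bot']
    intro v hv
    by_contra h0
    have h1 := hB v h0
    have h2 : B v = 0 := hv
    simp [h2] at h1
  have hfin : Module.finrank ℝ V = Module.finrank ℝ (V →L[ℝ] ℝ) := by
    rw [← (LinearMap.toContinuousLinearMap : (V →ₗ[ℝ] ℝ) ≃ₗ[ℝ] (V →L[ℝ] ℝ)).finrank_eq]
    exact (Subspace.dual_finrank_eq (K := ℝ) (V := V)).symm
  exact ⟨(LinearEquiv.ofInjectiveOfFinrankEq _ hinj hfin).toContinuousLinearEquiv, by ext; rfl⟩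

/-- The Riemannian gradient in coordinates. -/
def chartGrad (x : M) (F : M → ℝ) (y : Model m) : Model m :=
  (chartMetric g x y).inverse (fderiv ℝ (F ∘ (chartAt (Model m) x).symm) y)

theorem chartGrad_spec {x : M} {y : Model m} (hy : y ∈ (chartAt (Model m) x).target) (F : M → ℝ)
    (u : Model m) : chartMetric g x y (chartGrad g x F y) u =
      fderiv ℝ (F ∘ (chartAt (Model m) x).symm) y u := by
  rw [chartGrad, (isInvertible_of_pos fun v hv => chartMetric_pos g hy hv).self_apply_inverse]

theorem contDiffAt_chartGrad {F : M → ℝ} (hF : SmoothFun m F) {x : M} {y : Model m}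
    (hy : y ∈ (chartAt (Model m) x).target) : ContDiffAt ℝ ∞ (chartGrad g x F) y := by
  obtain ⟨e, he⟩ := isInvertible_of_pos fun v hv => chartMetric_pos g hy hv
  have h1 : ContDiffAt ℝ ∞ (ContinuousLinearMap.inverse (R := ℝ) (M := Model m)
      (M₂ := Model m →L[ℝ] ℝ)) (chartMetric g x y) := by
    rw [← he]
    exact contDiffAt_map_inverse (𝕜 := ℝ) (E := Model m) (F := Model m →L[ℝ] ℝ) e
  exact (ContDiffAt.comp (𝕜 := ℝ) (x := y) (g := ContinuousLinearMap.inverse)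
    (f := chartMetric g x) h1 (contDiffAt_chartMetric g hy)).clm_apply
      ((hF.contDiffAt hy).fderiv_right (by norm_num))

/-- Inverting the Gram matrix identifies the inner sums of `laplaceBeltrami` with the components of
the gradient. -/
theorem chartGrad_apply {x : M} {y : Model m} (hy : y ∈ (chartAt (Model m) x).target) (F : M → ℝ)
    (i : Fin (2 * m)) : chartGrad g x F y i = ∑ j, (gram g x y)⁻¹ i j *
      fderiv ℝ (F ∘ (chartAt (Model m) x).symm) y (stdBasis m j) := by
  have h1 : (gram g x y).mulVec (chartGrad g x F y) =
      fun j => fderiv ℝ (F ∘ (chartAt (Model m) x).symm) y (stdBasis m j) := by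
    funext j
    rw [← chartGrad_spec g hy, chartMetric_symm]
    have h2 := (modelBasis m).sum_repr (chartGrad g x F y)
    simp only [coe_modelBasis] at h2
    conv_rhs => rw [← h2, map_sum]
    simp only [Matrix.mulVec, dotProduct, map_smul, smul_eq_mul]
    refine Finset.sum_congr rfl fun k _ => ?_
    rw [mul_comm]
    rfl
  have h3 : IsUnit (gram g x y).det := (det_gram_pos g hy).ne'.isUnit
  have h4 := congrArg (fun w => (gram g x y)⁻¹.mulVec w i) h1
  simp only [Matrix.mulVec_mulVec, Matrix.nonsing_inv_mul _ h3, Matrix.one_mulVec] at h4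
  exact h4

variable {Ω g}

theorem exists_chart_complexStructure (hc : IsCompatible Ω g) {x : M} {y : Model m}
    (hy : y ∈ (chartAt (Model m) x).target) : ∃ J : Model m →L[ℝ] Model m,
      (∀ v, J (J v) = -v) ∧
      ∀ u v, chartRep Ω.form x y ![u, v] = chartMetric g x y (J u) v := by
  obtain ⟨J, hJ⟩ := hc
  set p := (chartAt (Model m) x).symm y with hp
  let J' : Model m →L[ℝ] Model m := J p
  have hJ' : ∀ v, J' (J' v) = -v := fun v => (hJ p v v).1
  have hinv : ∀ w, invD x y (chartD x p w) = w := fun w => invD_chartD_apply hy w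
  refine ⟨(chartD x p).comp (J'.comp (invD x y)), fun v => ?_, fun u v => ?_⟩
  · simp only [ContinuousLinearMap.comp_apply]
    rw [hinv, hJ', map_neg]
    exact congrArg Neg.neg (chartD_invD_apply hy v)
  · rw [chartRep_two_apply, chartMetric_apply]
    refine ((hJ p (invD x y u) (invD x y v)).2).trans ?_
    exact congrArg (fun w : Model m => g.inner p w (invD x y v)) (hinv (J' (invD x y u))).symm

/-- For a compatible metric, `i_{-grad F} Ω` is dual to `sgrad F`. -/
theorem chartGrad_contraction (hc : IsCompatible Ω g) {x : M}
    {y : Model m} (hy : y ∈ (chartAt (Model m) x).target) (F : M → ℝ) (u : Model m) :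
    chartMetric g x y (chartSgrad Ω x F y) u =
      chartRep Ω.form x y ![-chartGrad g x F y, u] := by
  obtain ⟨J, hJ, h⟩ := exists_chart_complexStructure hc hy
  have h1 : J (chartSgrad Ω x F y) = chartGrad g x F y := by
    by_contra hne
    have h2 := chartMetric_pos g hy (sub_ne_zero.2 hne)
    have h3 : ∀ w, chartMetric g x y (J (chartSgrad Ω x F y) - chartGrad g x F y) w = 0 :=
      fun w => by
        rw [(chartMetric g x y).map_sub, _root_.sub_apply, ← h, chartGrad_spec g hy, chartSgrad,
          chartRaise_spec Ω hy, sub_self]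
    rw [h3] at h2
    exact lt_irrefl _ h2
  rw [h, map_neg, ← h1, hJ, neg_neg]

/-- The matrix of Ω is J^t times the Gram matrix, and J² = -1 gives (det J)² = (-1)^{2m} = 1.
Comparing squares makes the sign of det J irrelevant. -/
theorem det_gram_sq (hc : IsCompatible Ω g) {x : M} {y : Model m}
    (hy : y ∈ (chartAt (Model m) x).target) :
    (gram g x y).det ^ 2 = (formMatrix (bilinCLM (Model m) (chartRep Ω.form x y))).det ^ 2 := by
  obtain ⟨J, hJ, h⟩ := exists_chart_complexStructure hc hy
  have h1 : formMatrix (bilinCLM (Model m) (chartRep Ω.form x y)) =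
      (endMatrix J).transpose * formMatrix (chartMetric g x y) :=
    formMatrix_eq_mul fun u v => (bilinCLM_apply ..).trans (h u v)
  rw [h1, Matrix.det_mul, Matrix.det_transpose, mul_pow, endMatrix_mul_self hJ, one_mul,
    gram_eq_formMatrix]

theorem differentiableAt_det_gram (g : Metric m M) {x : M} {y : Model m}
    (hy : y ∈ (chartAt (Model m) x).target) :
    DifferentiableAt ℝ (fun z => (gram g x z).det) y := by
  have h1 : DifferentiableAt ℝ (chartMetric g x) y :=
    (contDiffAt_chartMetric g hy).differentiableAt (by norm_num)
  have h2 : ∀ i j, DifferentiableAt ℝ (fun z => gram g x z i j) y := fun i j =>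
    (h1.clm_apply (differentiableAt_const (stdBasis m i))).clm_apply
      (differentiableAt_const (stdBasis m j))
  simp only [Matrix.det_apply']
  exact DifferentiableAt.fun_sum fun σ _ => (differentiableAt_const _).mul
    (HasFDerivAt.finsetProd fun i _ => (h2 (σ i) i).hasFDerivAt).differentiableAt

/-- The matrix of the derivative of Θ along Y is (2T)^t times that of Θ, so Jacobi's formula
applies. The factor 2 is removed later by the square root in the Riemannian density. -/
theorem hasDerivAt_det_formMatrix {y Y : Model m} {Θ : Model m → Model m [⋀^Fin 2]→L[ℝ] ℝ}
    (hΘ : DifferentiableAt ℝ Θ y) {T : Model m →L[ℝ] Model m}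
    (hT : ∀ u v, Θ y ![T u, v] = 2⁻¹ * fderiv ℝ Θ y Y ![u, v]) :
    HasDerivAt (fun s : ℝ => (formMatrix (bilinCLM (Model m) (Θ (y + s • Y)))).det)
      (2 * LinearMap.trace ℝ (Model m) T * (formMatrix (bilinCLM (Model m) (Θ y))).det) 0 := by
  have h1 : formMatrix (bilinCLM (Model m) (fderiv ℝ Θ y Y)) =
      (endMatrix ((2 : ℝ) • T)).transpose * formMatrix (bilinCLM (Model m) (Θ y)) :=
    formMatrix_eq_mul fun u v => by
      rw [_root_.smul_apply, map_smul, _root_.smul_apply, bilinCLM_apply, bilinCLM_apply, hT]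
      simp
  have h2 := hasDerivAt_det_of_eq_mul
    (A := fun s : ℝ => formMatrix (bilinCLM (Model m) (Θ (y + s • Y))))
    (B := (endMatrix ((2 : ℝ) • T)).transpose) fun i j => by
      simp only [zero_smul, add_zero]
      rw [← h1]
      simp only [formMatrix, Matrix.of_apply, bilinCLM_apply]
      exact hasDerivAt_twoForm_line hΘ Y _ _
  refine h2.congr_deriv ?_
  rw [Matrix.trace_transpose, endMatrix, ← LinearMap.trace_eq_matrix_trace,
    ContinuousLinearMap.toLinearMap_smul, map_smul]
  simp

/-- For compatible metrics, the logarithmic derivative of the Riemannian density. -/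
theorem fderiv_sqrt_det_gram (hc : IsCompatible Ω g) {x : M} {y : Model m}
    (hy : y ∈ (chartAt (Model m) x).target) {Y : Model m} {T : Model m →L[ℝ] Model m}
    (hT : ∀ u v, chartRep Ω.form x y ![T u, v] =
      2⁻¹ * fderiv ℝ (chartRep Ω.form x) y Y ![u, v]) :
    fderiv ℝ (fun z => √(gram g x z).det) y Y =
      LinearMap.trace ℝ (Model m) T * √(gram g x y).det := by
  have hG := (differentiableAt_det_gram g hy).hasFDerivAt
  have hpos := det_gram_pos g hy
  have h1 := hasDerivAt_det_formMatrix (Y := Y)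
    ((Ω.smooth.contDiffAt hy).differentiableAt (by norm_num)) hT
  have hline : HasDerivAt (fun s : ℝ => y + s • Y) Y 0 := by
    simpa using ((hasDerivAt_id (0 : ℝ)).smul_const Y).const_add y
  have h2 : HasDerivAt (fun s : ℝ => (gram g x (y + s • Y)).det)
      (fderiv ℝ (fun z => (gram g x z).det) y Y) 0 := by
    have h3 : HasFDerivAt (fun z => (gram g x z).det) (fderiv ℝ (fun z => (gram g x z).det) y)
        (y + (0 : ℝ) • Y) := by simpa using hG
    exact h3.comp_hasDerivAt (0 : ℝ) hline
  have h4 : (fun s : ℝ => (gram g x (y + s • Y)).det ^ 2) =ᶠ[𝓝 0] fun s =>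
      (formMatrix (bilinCLM (Model m) (chartRep Ω.form x (y + s • Y)))).det ^ 2 := by
    have h5 : ∀ᶠ s in 𝓝 (0 : ℝ), y + s • Y ∈ (chartAt (Model m) x).target :=
      hline.continuousAt.eventually (by
        simpa using (chartAt (Model m) x).open_target.mem_nhds hy)
    exact h5.mono fun s hs => det_gram_sq hc hs
  -- The squared determinants agree near y along the line, hence so do their derivatives; positivity
  -- of the Gram determinant then permits division.
  have h6 := (h2.fun_pow 2).unique ((h1.fun_pow 2).congr_of_eventuallyEq h4)
  have h7 := det_gram_sq hc hy
  simp only [zero_smul, add_zero] at h6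
  have h8 : fderiv ℝ (fun z => (gram g x z).det) y Y =
      2 * LinearMap.trace ℝ (Model m) T * (gram g x y).det := by
    refine mul_left_cancel₀ (mul_ne_zero two_ne_zero hpos.ne') ?_
    norm_num at h6
    linear_combination h6 - 4 * LinearMap.trace ℝ (Model m) T * h7
  have h9 := hG.sqrt hpos.ne'
  rw [h9.fderiv, _root_.smul_apply, h8, smul_eq_mul]
  have hs := Real.sqrt_pos.2 hpos
  have hss := Real.mul_self_sqrt hpos.le
  field_simp
  linear_combination -LinearMap.trace ℝ (Model m) T * hss

/-- The Laplace-Beltrami operator in divergence form. -/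
theorem laplaceBeltrami_eq (g : Metric m M) {F : M → ℝ} (hF : SmoothFun m F) (p : M) :
    laplaceBeltrami g F p =
      LinearMap.trace ℝ (Model m) (fderiv ℝ (chartGrad g p F) (chartAt (Model m) p p)) +
      (√(gram g p (chartAt (Model m) p p)).det)⁻¹ *
        fderiv ℝ (fun z => √(gram g p z).det) (chartAt (Model m) p p)
          (chartGrad g p F (chartAt (Model m) p p)) := by
  set y := chartAt (Model m) p p with hyd
  have hy : y ∈ (chartAt (Model m) p).target := mem_chart_target (Model m) p
  have hpos := det_gram_pos g hy
  set s : Model m → ℝ := fun z => √(gram g p z).det with hs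
  have hsd : DifferentiableAt ℝ s y := (differentiableAt_det_gram g hy).sqrt hpos.ne'
  have hY : DifferentiableAt ℝ (chartGrad g p F) y :=
    (contDiffAt_chartGrad g hF hy).differentiableAt (by norm_num)
  have hs0 : s y ≠ 0 := (Real.sqrt_pos.2 hpos).ne'
  have h1 : ∀ i, fderiv ℝ (fun z => √(gram g p z).det * ∑ j, (gram g p z)⁻¹ i j *
      fderiv ℝ (F ∘ (chartAt (Model m) p).symm) z (stdBasis m j)) y (stdBasis m i) =
      s y * fderiv ℝ (chartGrad g p F) y (stdBasis m i) i +
        chartGrad g p F y i * fderiv ℝ s y (stdBasis m i) := by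
    intro i
    have h2 : (fun z => √(gram g p z).det * ∑ j, (gram g p z)⁻¹ i j *
        fderiv ℝ (F ∘ (chartAt (Model m) p).symm) z (stdBasis m j)) =ᶠ[𝓝 y]
        fun z => s z * chartGrad g p F z i := by
      filter_upwards [(chartAt (Model m) p).open_target.mem_nhds hy] with z hz
      rw [chartGrad_apply g hz]
    have h3 : HasFDerivAt (fun z => chartGrad g p F z i)
        ((EuclideanSpace.proj (𝕜 := ℝ) i) ∘L fderiv ℝ (chartGrad g p F) y) y :=
      ((EuclideanSpace.proj (𝕜 := ℝ) i).hasFDerivAt).comp y hY.hasFDerivAt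
    rw [h2.fderiv_eq, show fderiv ℝ (fun z => s z * chartGrad g p F z i) y = _ from
      (hsd.hasFDerivAt.mul h3).fderiv]
    simp
  have h4 : fderiv ℝ s y (chartGrad g p F y) =
      ∑ i, chartGrad g p F y i * fderiv ℝ s y (stdBasis m i) := by
    have h5 := (modelBasis m).sum_repr (chartGrad g p F y)
    simp only [coe_modelBasis] at h5
    conv_lhs => rw [← h5, map_sum]
    refine Finset.sum_congr rfl fun k _ => ?_
    rw [map_smul]
    rfl
  have h6 : (√(gram g p y).det)⁻¹ * (s y * LinearMap.trace ℝ (Model m)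
      (fderiv ℝ (chartGrad g p F) y : Model m →ₗ[ℝ] Model m)) = LinearMap.trace ℝ (Model m)
      (fderiv ℝ (chartGrad g p F) y : Model m →ₗ[ℝ] Model m) := by
    rw [← mul_assoc, inv_mul_cancel₀ hs0, one_mul]
  rw [laplaceBeltrami, ← hyd, Finset.sum_congr rfl fun i _ => h1 i, Finset.sum_add_distrib, ← h4,
    ← Finset.mul_sum, mul_add]
  rw [trace_eq_sum_coord] at h6 ⊢
  exact congrArg (· + _) h6

/-- For a compatible metric, the Laplace-Beltrami operator is a multiple of the Laplacian. -/
theorem laplaceBeltrami_eq_laplacian (hm : 1 ≤ m) (hc : IsCompatible Ω g) {F : M → ℝ}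
    (hF : SmoothFun m F) (p : M) :
    laplaceBeltrami g F p = -(m : ℝ) * laplacian Ω g F p := by
  rw [laplaceBeltrami_eq g hF]
  set y := chartAt (Model m) p p with hyd
  have hy : y ∈ (chartAt (Model m) p).target := mem_chart_target (Model m) p
  have hp : (chartAt (Model m) p).symm y = p :=
    (chartAt (Model m) p).left_inv (mem_chart_source _ p)
  have hΘ : DifferentiableAt ℝ (chartRep Ω.form p) y :=
    (Ω.smooth.contDiffAt hy).differentiableAt (by norm_num)
  have hα := isSmoothForm_flat_sgrad g Ω hF
  have hd0 : chartDensity Ω p y ≠ 0 := chartDensity_ne_zero Ω hy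
  have hY : DifferentiableAt ℝ (chartGrad g p F) y :=
    (contDiffAt_chartGrad g hF hy).differentiableAt (by norm_num)
  -- The trace of T is the logarithmic derivative along grad F of both ω^m and the Riemannian
  -- density, so the two densities give grad F the same divergence.
  obtain ⟨T, hT1, hT2⟩ := exists_formAction_eq (nondegenerate_chartRep Ω hy)
    (fderiv ℝ (chartRep Ω.form p) y (chartGrad g p F y))
  have h1 := fderiv_topPower_eq_trace_mul (modelBasis m) hΘ hT2
  -- The field contracting ω to (sgrad F)^♭ is -grad F; this is where the sign in -m comes from.
  have h2 := divergence_topPower hm (modelBasis m) (X := fun z => -chartGrad g p F z)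
    (α := chartRep (flat g (sgrad Ω F)) p) hΘ hY.neg
    ((hα.contDiffAt hy).differentiableAt (by norm_num))
    (by
      filter_upwards [(chartAt (Model m) p).open_target.mem_nhds hy] with z hz u
      rw [chartRep_flat_sgrad g Ω hF hz, covectorCLE_apply]
      exact chartGrad_contraction hc hz F u) (extDeriv_chartRep_form Ω hy)
  rw [coe_modelBasis] at h1 h2
  rw [extDeriv_chartRep hα hy] at h2
  rw [map_neg, h1, fderiv_fun_neg] at h2
  rw [fderiv_sqrt_det_gram hc hy hT1]
  have h3 := formRatio_comp_symm Ω (extD (flat g (sgrad Ω F))) hy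
  rw [hp, ← laplacian_eq_formRatio] at h3
  have hs0 : √(gram g p y).det ≠ 0 := (Real.sqrt_pos.2 (det_gram_pos g hy)).ne'
  rw [h3, mul_comm (LinearMap.trace ℝ (Model m) T), ← mul_assoc, inv_mul_cancel₀ hs0, one_mul]
  change _ * chartDensity Ω p y + -(_ * chartDensity Ω p y) = _ at h2
  rw [ContinuousLinearMap.toLinearMap_neg, map_neg] at h2
  refine mul_right_cancel₀ hd0 ?_
  rw [mul_assoc, div_mul_cancel₀ _ hd0]
  linear_combination -h2

theorem poisson_laplacian_eq_zero_iff (hm : 1 ≤ m) (hc : IsCompatible Ω g) {ψ : M → ℝ}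
    (hψ : SmoothFun m ψ) :
    (∀ p, poisson Ω ψ (laplacian Ω g ψ) p = 0) ↔
      ∀ p, poisson Ω ψ (laplaceBeltrami g ψ) p = 0 := by
  have hm0 : (m : ℝ) ≠ 0 := by exact_mod_cast (by omega : m ≠ 0)
  have h1 : laplaceBeltrami g ψ = fun p => -(m : ℝ) * laplacian Ω g ψ p :=
    funext (laplaceBeltrami_eq_laplacian hm hc hψ)
  have h2 : ∀ p, poisson Ω ψ (laplaceBeltrami g ψ) p =
      -(m : ℝ) * poisson Ω ψ (laplacian Ω g ψ) p := fun p => by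
    rw [poisson_antisymm, poisson_antisymm Ω ψ (laplacian Ω g ψ), poisson_eq, poisson_eq, h1,
      dFun_const_mul _ _ ((hψ.laplacian g Ω).mdifferentiableAt p)]
    ring
  refine forall_congr' fun p => ?_
  rw [h2, mul_eq_zero, neg_eq_zero, or_iff_right hm0]

end Compatible

end SymplecticFluid

end

theorem proposition3p9 (m : ℕ) (hm : 1 ≤ m) (M : Type*) [TopologicalSpace M]
    [ChartedSpace (SymplecticFluid.Model m) M]
    [IsManifold (modelWithCornersSelf ℝ (SymplecticFluid.Model m)) ∞ M]
    [T2Space M] [CompactSpace M]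
    (Ω : SymplecticFluid.SymplecticForm m M) (g : SymplecticFluid.Metric m M)
    (ψ₀ ψ : M → ℝ) (hψ₀ : SymplecticFluid.SmoothFun m ψ₀)
    (hψ : ψ ∈ SymplecticFluid.hamOrbit Ω ψ₀) :
    (SymplecticFluid.IsExtremal Ω g ψ₀ ψ ↔
      ∀ p, SymplecticFluid.poisson Ω ψ (SymplecticFluid.laplacian Ω g ψ) p = 0) ∧
    (SymplecticFluid.IsExtremal Ω g ψ₀ ψ ↔ SymplecticFluid.IsSteadyHamiltonian Ω g ψ) ∧
    (SymplecticFluid.IsMinimizer Ω g ψ₀ ψ → SymplecticFluid.IsExtremal Ω g ψ₀ ψ) ∧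
    (SymplecticFluid.IsCompatible Ω g →
      (SymplecticFluid.IsExtremal Ω g ψ₀ ψ ↔
        ∀ p, SymplecticFluid.poisson Ω ψ (SymplecticFluid.laplaceBeltrami g ψ) p = 0)) := by
  have h1 := SymplecticFluid.isExtremal_iff (g := g) hm hψ₀ hψ
  have hs := SymplecticFluid.smoothFun_of_mem_hamOrbit hψ₀ hψ
  refine ⟨h1, h1.trans (SymplecticFluid.isSteadyHamiltonian_iff hs).symm,
    SymplecticFluid.isExtremal_of_isMinimizer hm hψ₀, fun hc => h1.trans ?_⟩
  exact SymplecticFluid.poisson_laplacian_eq_zero_iff hm hc hs
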